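/- Let $\gamma>-\tfrac12$, $p_c=\frac{\gamma+1/2}{\gamma+1}$ and $\widehat p=\frac{\gamma}{\gamma+1}$, and let $p\in[0,p_c)$. Let $\{\mu_n\}_{n\ge1}$ be a sequence of positive real numbers that is regularly varying of index $\gamma$, that is, $\lim_{n\to\infty}\mu_{\lfloor\lambda n\rfloor}/\mu_n=\lambda^{\gamma}$ for every $\lambda>0$. Let $\{\xi_n\}_{n\ge1}$ be i.i.d. real random variables with $\mathbb E\xi_1=0$ and $\mathbb E\xi_1^2=1$; let $\{\alpha_n\}_{n\ge2}$ be i.i.d. Bernoulli random variables with parameter $p$; let $\{\beta_n\}_{n\ge2}$ be independent random variables with $$\mathbb P(\beta_n=k)=\frac{\mu_k}{\mu_1+\cdots+\mu_{n-1}},\qquad 1\le k\le n-1;$$ and let these three sequences be independent of each other. Define the increments by $X_1=\xi_1$ and $$X_{n+1}=\alpha_{n+1}X_{\beta_{n+1}}+(1-\alpha_{n+1})\xi_{n+1},\qquad n\ge1,$$ and the random walk by $S_n=\sum_{k=1}^nX_k$. Then, as $n\to\infty$, $S_n/\sqrt n$ converges in distribution to the centered normal distribution $N(0,v^2)$, where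 $$v^2=\begin{cases}\dfrac{2\gamma+1-p}{(1-p)\,(2(1-p)(\gamma+1)-1)}, & p\neq\widehat p,\\[2mm] 2\gamma^2+2\gamma+1, & p=\widehat p.\end{cases}$$ -/

import Mathlib

open MeasureTheory ProbabilityTheory Filter Topology

/-- A sequence `(c n)` for `n ≥ 1` of positive reals is regularly varying with index `ρ` when
`c ⌊l n⌋ / c n → l ^ ρ` for every `l > 0`. The value `c 0` is irrelevant. -/
def IsRegularlyVarying (c : ℕ → ℝ) (ρ : ℝ) : Prop :=
  (∀ n, 1 ≤ n → 0 < c n) ∧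
    ∀ l : ℝ, 0 < l → Tendsto (fun n : ℕ => c ⌊l * (n : ℝ)⌋₊ / c n) atTop (𝓝 (l ^ ρ))

/-- The increments built from one realization of the innovations `ξ`, the recollection
indicators `α` and the memory indices `β`:
`X 1 = ξ 1` and `X (n + 1) = α (n + 1) * X (β (n + 1)) + (1 - α (n + 1)) * ξ (n + 1)`.
The guard and the entry at index `0` matter only when a memory index `β (n + 1)` lies outside
`{1, …, n}`, an event of probability zero in the model. -/
noncomputable def rwStep (ξ α : ℕ → ℝ) (β : ℕ → ℕ) : ℕ → ℝ
  | 0 => 0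
  | 1 => ξ 1
  | n + 2 =>
      α (n + 2) * (if _h : β (n + 2) < n + 2 then rwStep ξ α β (β (n + 2)) else 0)
        + (1 - α (n + 2)) * ξ (n + 2)

theorem rwStep_one (ξ α : ℕ → ℝ) (β : ℕ → ℕ) : rwStep ξ α β 1 = ξ 1 := by
  rw [rwStep]

theorem rwStep_succ (ξ α : ℕ → ℝ) (β : ℕ → ℕ) {n : ℕ} (hn : 1 ≤ n) (hβ : β (n + 1) ≤ n) :
    rwStep ξ α β (n + 1) =
      α (n + 1) * rwStep ξ α β (β (n + 1)) + (1 - α (n + 1)) * ξ (n + 1) := by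
  obtain ⟨m, rfl⟩ : ∃ m, n = m + 1 := ⟨n - 1, by omega⟩
  have h : β (m + 2) < m + 2 := Nat.lt_succ_of_le hβ
  conv_lhs => rw [rwStep]
  rw [dif_pos h]

/-- The position `S n = X 1 + ⋯ + X n` of the step reinforced random walk. -/
noncomputable def rwPosition {Ω : Type*} (ξ α : ℕ → Ω → ℝ) (β : ℕ → Ω → ℕ) (n : ℕ) (ω : Ω) : ℝ :=
  ∑ k ∈ Finset.Icc 1 n, rwStep (fun i => ξ i ω) (fun i => α i ω) (fun i => β i ω) k

/-- The probabilistic input of the step reinforced random walk with memory sequence `μ` and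
recollection probability `p`: innovations `ξ n` (`n ≥ 1`), indicators `α n` (`n ≥ 2`) and
memory indices `β n` (`n ≥ 2`). Entries with smaller indices are not used. -/
structure IsRWInput {Ω : Type*} [MeasurableSpace Ω] (P : Measure Ω) (p : ℝ) (μ : ℕ → ℝ)
    (ξ α : ℕ → Ω → ℝ) (β : ℕ → Ω → ℕ) : Prop where
  measurable_ξ : ∀ n, 1 ≤ n → Measurable (ξ n)
  measurable_α : ∀ n, 2 ≤ n → Measurable (α n)
  measurable_β : ∀ n, 2 ≤ n → Measurable (β n)
  /-- The innovations are identically distributed. -/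
  identDistrib_ξ : ∀ n, 1 ≤ n → IdentDistrib (ξ n) (ξ 1) P P
  /-- The innovations have mean zero. -/
  integrable_ξ : Integrable (ξ 1) P
  mean_ξ : ∫ ω, ξ 1 ω ∂P = 0
  /-- The indicators are Bernoulli with parameter `p`. -/
  prob_α_one : ∀ n, 2 ≤ n → P.real {ω | α n ω = 1} = p
  prob_α_zero : ∀ n, 2 ≤ n → P.real {ω | α n ω = 0} = 1 - p
  /-- The law of `β n` on `{1, …, n - 1}` is proportional to `μ`. -/
  prob_β : ∀ n, 2 ≤ n → ∀ k ∈ Finset.Icc 1 (n - 1),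
    P.real {ω | β n ω = k} = μ k / ∑ j ∈ Finset.Icc 1 (n - 1), μ j
  /-- Each of the three sequences is independent and the three sequences are independent of each
  other, that is, all the variables `ξ n` (`n ≥ 1`), `α n` (`n ≥ 2`), `β n` (`n ≥ 2`) are
  mutually independent. -/
  indep : iIndepFun (Sum.elim (fun n : ℕ => ξ (n + 1))
    (Sum.elim (fun n : ℕ => α (n + 2)) (fun (n : ℕ) (ω : Ω) => (β (n + 2) ω : ℝ)))) P

/-- The critical recollection probability `p_c`. -/
noncomputable def pCrit (γ : ℝ) : ℝ := (γ + 1 / 2) / (γ + 1)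

/-- The exceptional recollection probability `p̂`. -/
noncomputable def pHat (γ : ℝ) : ℝ := γ / (γ + 1)

/-- The limiting variance `v²`. -/
noncomputable def limitVariance (γ p : ℝ) : ℝ :=
  if p = pHat γ then 2 * γ ^ 2 + 2 * γ + 1
  else (2 * γ + 1 - p) / ((1 - p) * (2 * (1 - p) * (γ + 1) - 1))

/-! Follow each recollection back to the innovation it repeats. The times 1, …, n split into
clusters, one for each time `j` at which a fresh innovation is used, and every step in the cluster
of `j` equals `ξ j`. Hence S_n = ∑ ξ_j N_j, where N_j is the size of the cluster of `j` at time n.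
The clusters depend on `α` and `β` only, so they are independent of the innovations. Given the
clusters, S_n/√n is a weighted sum of i.i.d. variables. It is therefore asymptotically N(0, v²) once
∑ N_j²/n → v² and ∑ N_j³/n^{3/2} → 0 in mean. This is proved with characteristic functions, in
`charFun_rwPosition` and `tendsto_integral_prod`.

Let W_j be the total `μ`-weight of cluster `j` and M_n = μ_1 + ⋯ + μ_n. Given the past, time n+1
joins cluster `j` with probability p W_j/M_n and founds a new one with probability 1 - p. The three
sums ∑ W_j², ∑ N_j W_j, ∑ N_j² therefore have conditional drifts forming a closed triangular linear
system, each fed by the one before. The only asymptotic fact needed about `μ` is n μ_{n+1}/M_n → κ =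
γ + 1, which is Karamata's theorem. After normalization the system has the limits ∑ W_j²/(M_n²/n) →
A = κ²/(2κ - 1 - 2pκ), ∑ N_j W_j/M_n → B = (pA + κ)/(κ - pκ), ∑ N_j²/n → 2pB + 1 = v². The condition
p < p_c says exactly that the first denominator, which is the damping rate of the first equation, is
positive.

The limits hold in L² (`tendsto_clusterSum_of_drift`). One-step fluctuations are controlled by ∑
V_j³ with V_j = N_j + (n/M_n) W_j, and this sum is o(n^{3/2}) in mean. The reason is that a suitable
multiple of the weight makes the mean mass of a cluster grow by a factor of at most 1 + c/n with c <
1/2, again because p < p_c. The same third moment bound gives the negligibility needed in the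
central limit theorem. -/

/-! ### Regular variation: uniform convergence and Karamata's theorem -/

theorem IsRegularlyVarying.tendsto_log {c : ℕ → ℝ} {ρ : ℝ} (h : IsRegularlyVarying c ρ) {l : ℝ}
    (hl : 0 < l) :
    Tendsto (fun n : ℕ => Real.log (c ⌊l * (n : ℝ)⌋₊) - Real.log (c n) - ρ * Real.log l) atTop
      (𝓝 0) := by
  have h1 := (h.2 l hl).log (Real.rpow_pos_of_pos hl ρ).ne'
  rw [Real.log_rpow hl] at h1
  have h2 := h1.sub_const (ρ * Real.log l)
  rw [sub_self] at h2
  refine h2.congr' ?_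
  -- From this threshold on the floor is at least 1, so the unconstrained value `c 0` is avoided.
  filter_upwards [eventually_ge_atTop (⌈l⁻¹⌉₊ + 1)] with n hn
  have hn1 : 1 ≤ n := by omega
  have hln : 1 ≤ ⌊l * (n : ℝ)⌋₊ := by
    rw [Nat.one_le_floor_iff]
    have h3 : l⁻¹ ≤ n := (Nat.le_ceil _).trans (by exact_mod_cast (by omega : ⌈l⁻¹⌉₊ ≤ n))
    calc (1 : ℝ) = l * l⁻¹ := (mul_inv_cancel₀ hl.ne').symm
      _ ≤ l * n := by gcongr
  rw [Real.log_div (h.1 _ hln).ne' (h.1 _ hn1).ne']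

/-- The uniform convergence theorem for regularly varying sequences. -/
theorem IsRegularlyVarying.uniform_log {c : ℕ → ℝ} {ρ : ℝ} (h : IsRegularlyVarying c ρ) {ε : ℝ}
    (hε : 0 < ε) :
    ∃ N : ℕ, ∀ n, N ≤ n → ∀ m, n ≤ m → m ≤ 3 * n →
      |Real.log (c m) - Real.log (c n) - ρ * Real.log ((m : ℝ) / n)| ≤ ε := by
  set F : ℕ → ℝ → ℝ := fun n l =>
    Real.log (c ⌊l * (n : ℝ)⌋₊) - Real.log (c n) - ρ * Real.log l with hF
  have hFm : ∀ n, Measurable (F n) := fun n => by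
    have h1 : Measurable (fun l : ℝ => c ⌊l * (n : ℝ)⌋₊) :=
      (measurable_from_nat (f := c)).comp (Nat.measurable_floor.comp (measurable_id.mul_const _))
    exact ((Real.measurable_log.comp h1).sub_const _).sub (Real.measurable_log.const_mul _)
  -- The ratios in [1, 6] at which the pointwise limit still fails by ε/2 at some time n ≥ N. These
  -- sets decrease to ∅, so their measure eventually falls below 1/2.
  set B : ℕ → Set ℝ := fun N => Set.Icc 1 6 ∩ ⋃ n ≥ N, {l | ε / 2 < |F n l|} with hB
  have hBm : ∀ N, MeasurableSet (B N) := fun N =>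
    measurableSet_Icc.inter (MeasurableSet.iUnion fun n => MeasurableSet.iUnion fun _ =>
      measurableSet_lt measurable_const (measurable_norm.comp (hFm n)))
  have hBa : Antitone B := fun a b hab => by
    refine Set.inter_subset_inter_right _ ?_
    exact Set.biUnion_mono (fun n (hn : b ≤ n) => hab.trans hn) fun _ _ => le_rfl
  have hBe : ⋂ N, B N = ∅ := by
    ext l
    simp only [Set.mem_iInter, Set.mem_empty_iff_false, iff_false, not_forall]
    by_cases hl : l ∈ Set.Icc (1 : ℝ) 6
    · have h1 := (h.tendsto_log (lt_of_lt_of_le one_pos hl.1)).abs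
      rw [abs_zero] at h1
      obtain ⟨N, hN⟩ := eventually_atTop.1 (h1.eventually (gt_mem_nhds (half_pos hε)))
      refine ⟨N, fun hc => ?_⟩
      obtain ⟨n, hn, hn2⟩ := Set.mem_iUnion₂.1 hc.2
      exact lt_asymm (hN n hn) hn2
    · exact ⟨0, fun hc => hl hc.1⟩
  have hBt := tendsto_measure_iInter_atTop (μ := volume) (fun N => (hBm N).nullMeasurableSet) hBa
    ⟨0, ((measure_mono Set.inter_subset_left).trans_lt (by simp)).ne⟩
  rw [hBe, measure_empty] at hBt
  obtain ⟨N, hN⟩ := (hBt.eventually (gt_mem_nhds (show (0 : ENNReal) < ENNReal.ofReal (1 / 2) by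
    simp))).exists
  refine ⟨N + 1, fun n hn m hnm hm => ?_⟩
  have hn0 : (0 : ℝ) < n := by exact_mod_cast (by omega : 0 < n)
  have hnm' : (n : ℝ) ≤ m := by exact_mod_cast hnm
  have hm' : (m : ℝ) ≤ 3 * n := by exact_mod_cast hm
  have hm0 : (0 : ℝ) < m := hn0.trans_le hnm'
  have hvol : ∀ k : ℝ, 0 < k →
      volume ((fun x => x * k⁻¹) ⁻¹' B N) ≤ ENNReal.ofReal (k * (1 / 2)) := fun k hk => by
    rw [Real.volume_preimage_mul_right (inv_ne_zero hk.ne'), inv_inv, abs_of_pos hk,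
      ENNReal.ofReal_mul hk.le]
    gcongr
    exact hN.le
  -- The two bad sets have total measure at most n/2 + m/2 ≤ 2n, less than the length 3n of the
  -- interval. So some x is good relative to both n and m, and `c n` and `c m` are compared through
  -- `c ⌊x⌋₊`.
  have hex : ∃ x ∈ Set.Icc (3 * n : ℝ) (6 * n),
      x ∉ (fun x => x * (n : ℝ)⁻¹) ⁻¹' B N ∪ (fun x => x * (m : ℝ)⁻¹) ⁻¹' B N := by
    by_contra! hcon
    have h1 : volume (Set.Icc (3 * n : ℝ) (6 * n)) ≤ _ := measure_mono hcon
    have h2 := h1.trans ((measure_union_le _ _).trans (add_le_add (hvol n hn0) (hvol m hm0)))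
    rw [Real.volume_Icc, ← ENNReal.ofReal_add (by positivity) (by positivity),
      ENNReal.ofReal_le_ofReal_iff (by positivity)] at h2
    linarith
  obtain ⟨x, hx, hxn⟩ := hex
  have hgood : ∀ k : ℕ, 0 < (k : ℝ) → N ≤ k → x * (k : ℝ)⁻¹ ∈ Set.Icc (1 : ℝ) 6 →
      x * (k : ℝ)⁻¹ ∉ B N →
      |Real.log (c ⌊x⌋₊) - Real.log (c k) - ρ * Real.log (x / k)| ≤ ε / 2 := by
    intro k hk hNk hmem hnot
    by_contra! hcon
    refine hnot ⟨hmem, Set.mem_iUnion₂.2 ⟨k, hNk, ?_⟩⟩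
    simp only [Set.mem_ofPred_eq, hF]
    rwa [inv_mul_cancel_right₀ hk.ne', ← div_eq_mul_inv]
  rw [Set.mem_union, not_or] at hxn
  have hx0 : 0 < x := by linarith [hx.1]
  have h1 := hgood n hn0 (by omega) (by
    rw [← div_eq_mul_inv]; constructor
    · rw [le_div_iff₀ hn0]; linarith [hx.1]
    · rw [div_le_iff₀ hn0]; linarith [hx.2]) hxn.1
  have h2 := hgood m hm0 (by omega) (by
    rw [← div_eq_mul_inv]; constructor
    · rw [le_div_iff₀ hm0]; linarith [hx.1]
    · rw [div_le_iff₀ hm0]; linarith [hx.2]) hxn.2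
  rw [Real.log_div hx0.ne' hn0.ne'] at h1
  rw [Real.log_div hx0.ne' hm0.ne'] at h2
  rw [Real.log_div hm0.ne' hn0.ne']
  rw [abs_le] at h1 h2 ⊢
  constructor <;> linarith [h1.1, h1.2, h2.1, h2.2]

/-- A nonnegative sequence that contracts along halving, up to a vanishing error, tends to `0`. -/
theorem tendsto_zero_of_halving {d : ℕ → ℝ} {r : ℝ} (hr0 : 0 ≤ r) (hr1 : r < 1)
    (hd : ∀ n, 0 ≤ d n)
    (hrec : ∀ ε > 0, ∀ᶠ n in atTop, d n ≤ r * d (n / 2) + ε) : Tendsto d atTop (𝓝 0) := by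
  have step : ∀ ε > 0, ∃ N : ℕ, 1 ≤ N ∧ ∃ K : ℝ, 0 ≤ K ∧ ∀ j : ℕ, ∀ n, 2 ^ j * N ≤ n →
      d n ≤ r ^ j * K + ε := by
    intro ε hε
    -- With this error, ε is the fixed point of x ↦ r x + ε(1 - r), so iterating never accumulates
    -- more than ε.
    have hε' : 0 < ε * (1 - r) := mul_pos hε (by linarith)
    obtain ⟨N, hN⟩ := eventually_atTop.1 (hrec _ hε')
    set K := ∑ k ∈ Finset.range (2 * (N + 1)), d k with hK
    have hK0 : 0 ≤ K := Finset.sum_nonneg fun _ _ => hd _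
    have hb : ∀ n, d n ≤ K + ε := by
      intro n
      induction n using Nat.strong_induction_on with
      | _ n ih =>
        by_cases hn : n < 2 * (N + 1)
        · have := Finset.single_le_sum (f := d) (fun k _ => hd k) (Finset.mem_range.2 hn)
          linarith
        · have h1 := hN n (by omega)
          have h2 := ih (n / 2) (by omega)
          nlinarith [mul_le_mul_of_nonneg_left h2 hr0]
    refine ⟨N + 1, by omega, K, hK0, fun j => ?_⟩
    induction j with
    | zero => intro n _; simpa using hb n
    | succ j ih =>
      intro n hn
      have hp : 1 ≤ 2 ^ j := Nat.one_le_two_pow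
      have hn' : 2 * (2 ^ j * (N + 1)) ≤ n := by rw [pow_succ] at hn; linarith
      have h3 : N + 1 ≤ 2 ^ j * (N + 1) := Nat.le_mul_of_pos_left _ (by omega)
      have h1 := hN n (by omega)
      have h2 := mul_le_mul_of_nonneg_left (ih (n / 2) (by omega)) hr0
      rw [pow_succ]
      nlinarith
  rw [Metric.tendsto_atTop]
  intro ε hε
  obtain ⟨N, hN1, K, hK, h⟩ := step (ε / 2) (half_pos hε)
  have hlim : Tendsto (fun j : ℕ => r ^ j * K) atTop (𝓝 0) := by
    simpa using (tendsto_pow_atTop_nhds_zero_of_lt_one hr0 hr1).mul_const K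
  obtain ⟨j, hj⟩ := (hlim.eventually (gt_mem_nhds (half_pos hε))).exists
  refine ⟨2 ^ j * N, fun n hn => ?_⟩
  rw [Real.dist_eq, sub_zero, abs_of_nonneg (hd n)]
  linarith [h j n hn]

/-- The increments of `k ↦ k ^ a`. -/
noncomputable def powIncrement (a : ℝ) (k : ℕ) : ℝ := (k : ℝ) ^ a - ((k - 1 : ℕ) : ℝ) ^ a

theorem powIncrement_pos {a : ℝ} (ha : 0 < a) {k : ℕ} (hk : 1 ≤ k) : 0 < powIncrement a k := by
  have : ((k - 1 : ℕ) : ℝ) < k := by exact_mod_cast (by omega : k - 1 < k)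
  exact sub_pos.2 (Real.rpow_lt_rpow (by positivity) this ha)

theorem sum_powIncrement {a : ℝ} (ha : 0 < a) (n : ℕ) :
    ∑ k ∈ Finset.Icc 1 n, powIncrement a k = (n : ℝ) ^ a := by
  induction n with
  | zero => simp [Real.zero_rpow ha.ne']
  | succ n ih =>
    rw [Finset.sum_Icc_succ_top (by omega), ih, powIncrement, Nat.add_sub_cancel]
    ring

/-- The quotient is the slope of x ↦ x^a between 1 - 1/k and 1, so it tends to the derivative at 1.
-/
theorem tendsto_powIncrement_div (a : ℝ) :
    Tendsto (fun k : ℕ => powIncrement a k / (k : ℝ) ^ (a - 1)) atTop (𝓝 a) := by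
  have h1 : HasDerivAt (fun x : ℝ => x ^ a) a 1 := by
    simpa using Real.hasDerivAt_rpow_const (x := 1) (p := a) (Or.inl one_ne_zero)
  have h2 : Tendsto (fun k : ℕ => 1 - (k : ℝ)⁻¹) atTop (𝓝[≠] 1) := by
    refine tendsto_nhdsWithin_iff.2 ⟨?_, ?_⟩
    · simpa using (tendsto_inv_atTop_nhds_zero_nat (𝕜 := ℝ)).const_sub 1
    · filter_upwards [eventually_ge_atTop 1] with k hk
      have : (k : ℝ) ≠ 0 := by positivity
      simp [this]
  refine (h1.tendsto_slope.comp h2).congr' ?_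
  filter_upwards [eventually_ge_atTop 1] with k hk
  have hk0 : (0 : ℝ) < k := by positivity
  have hk1 : (0 : ℝ) ≤ 1 - (k : ℝ)⁻¹ := by
    rw [sub_nonneg]; exact inv_le_one_of_one_le₀ (by exact_mod_cast hk)
  have h3 : ((k - 1 : ℕ) : ℝ) = k * (1 - (k : ℝ)⁻¹) := by
    rw [Nat.cast_sub hk]; field_simp; simp
  rw [powIncrement, h3, Real.mul_rpow hk0.le hk1, Real.rpow_sub_one hk0.ne']
  have := (Real.rpow_pos_of_pos hk0 a).ne'
  simp only [Function.comp, slope_def_field, Real.one_rpow]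
  field_simp
  ring

/-- Karamata's theorem for regularly varying sequences of index greater than `-1`. -/
theorem IsRegularlyVarying.tendsto_sum_div {c : ℕ → ℝ} {ρ : ℝ} (h : IsRegularlyVarying c ρ)
    (hρ : -1 < ρ) :
    Tendsto (fun n : ℕ => (∑ k ∈ Finset.Icc 1 n, c k) / (n * c n)) atTop (𝓝 (ρ + 1)⁻¹) := by
  set a := ρ + 1 with ha
  have ha0 : 0 < a := by linarith
  -- Dividing by the increments of k^a leaves a slowly varying factor. The sum of `c` then becomes a
  -- Stieltjes sum of `q` against k^a, and the claim reduces to M_n ~ q_n n^a.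
  set q : ℕ → ℝ := fun k => c k / powIncrement a k with hq
  have hq0 : ∀ k, 1 ≤ k → 0 < q k := fun k hk => div_pos (h.1 k hk) (powIncrement_pos ha0 hk)
  have hlog : Tendsto (fun k : ℕ => Real.log (powIncrement a k) - ρ * Real.log k) atTop
      (𝓝 (Real.log a)) := by
    refine ((tendsto_powIncrement_div a).log ha0.ne').congr' ?_
    filter_upwards [eventually_ge_atTop 1] with k hk
    have hk0 : (0 : ℝ) < k := by positivity
    rw [Real.log_div (powIncrement_pos ha0 hk).ne' (Real.rpow_pos_of_pos hk0 _).ne',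
      Real.log_rpow hk0, ha, add_sub_cancel_right]
  have hqlog : ∀ ε > 0, ∃ N : ℕ, 1 ≤ N ∧ ∀ n, N ≤ n → ∀ m, n ≤ m → m ≤ 3 * n →
      |Real.log (q m) - Real.log (q n)| ≤ ε := by
    intro ε hε
    obtain ⟨N, hN⟩ := h.uniform_log (ε := ε / 2) (half_pos hε)
    obtain ⟨N', hN'⟩ := Metric.tendsto_atTop.1 hlog (ε / 4) (by linarith)
    refine ⟨max 1 (max N N'), by omega, fun n hn m hnm hm => ?_⟩
    have hn1 : 1 ≤ n := by omega
    have hm1 : 1 ≤ m := by omega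
    have hn0 : (0 : ℝ) < n := by positivity
    have hm0 : (0 : ℝ) < m := by positivity
    have e1 := hN n (by omega) m hnm hm
    have e2 := hN' n (by omega)
    have e3 := hN' m (by omega)
    rw [Real.dist_eq, abs_lt] at e2 e3
    rw [Real.log_div hm0.ne' hn0.ne', abs_le] at e1
    simp only [hq]
    rw [Real.log_div (h.1 _ hm1).ne' (powIncrement_pos ha0 hm1).ne',
      Real.log_div (h.1 _ hn1).ne' (powIncrement_pos ha0 hn1).ne', abs_le]
    constructor <;> linarith [e1.1, e1.2, e2.1, e2.2, e3.1, e3.2]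
  have hqr : ∀ ε > 0, ∃ N : ℕ, 1 ≤ N ∧ ∀ n, N ≤ n → ∀ m, n ≤ m → m ≤ 3 * n → ∀ k, n ≤ k →
      k ≤ m → |q k / q m - 1| ≤ ε := by
    intro ε hε
    set δ := min ε 1 with hδ
    have hδ0 : 0 < δ := lt_min hε one_pos
    obtain ⟨N, hN1, hN⟩ := hqlog (δ / 4) (by linarith)
    refine ⟨N, hN1, fun n hn m hnm hm k hnk hkm => ?_⟩
    have e1 := hN n hn m hnm hm
    have e2 := hN n hn k hnk (by omega)
    have hk := hq0 k (by omega)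
    have hm' := hq0 m (by omega)
    have e3 : |Real.log (q k / q m)| ≤ δ / 2 := by
      rw [Real.log_div hk.ne' hm'.ne']
      rw [abs_le] at e1 e2 ⊢
      constructor <;> linarith [e1.1, e1.2, e2.1, e2.2]
    have e4 := Real.abs_exp_sub_one_le (x := Real.log (q k / q m))
      (by linarith [min_le_right ε 1])
    rw [Real.exp_log (div_pos hk hm')] at e4
    linarith [min_le_left ε 1]
  set M : ℕ → ℝ := fun n => ∑ k ∈ Finset.Icc 1 n, c k with hM
  have hsum : ∀ n, M n = ∑ k ∈ Finset.Icc 1 n, q k * powIncrement a k := fun n =>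
    Finset.sum_congr rfl fun k hk => by
      simp only [hq]
      rw [div_mul_cancel₀ _ (powIncrement_pos ha0 (Finset.mem_Icc.1 hk).1).ne']
  have hu : Tendsto (fun n : ℕ => |M n / (q n * (n : ℝ) ^ a) - 1|) atTop (𝓝 0) := by
    set s := ((2 : ℝ) ^ a)⁻¹ with hs
    have h2a : 1 < (2 : ℝ) ^ a := Real.one_lt_rpow (by norm_num) ha0
    have hs0 : 0 < s := by positivity
    have hs1 : s < 1 := inv_lt_one_of_one_lt₀ h2a
    refine tendsto_zero_of_halving (r := (1 + s) / 2) (by linarith) (by linarith)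
      (fun _ => abs_nonneg _) fun ε hε => ?_
    -- Passing from n/2 to n multiplies the relative error by at most (1 + δ)s; the second bound on
    -- δ keeps this below (1 + s)/2 < 1.
    set δ := min ε ((1 - s) / 2) with hδ
    have hδ0 : 0 < δ := lt_min hε (by linarith)
    obtain ⟨N, hN1, hN⟩ := hqr δ hδ0
    filter_upwards [eventually_ge_atTop (2 * N)] with n hn
    -- Since n ≤ 2l + 1 ≤ 3l, windows of ratio 3 cover the rounding.
    set l := n / 2 with hl
    have hNl : N ≤ l := by omega
    have hln : l ≤ n := by omega
    have hl0 : (0 : ℝ) < l := by exact_mod_cast (by omega : 0 < l)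
    have hn0 : (0 : ℝ) < n := by exact_mod_cast (by omega : 0 < n)
    have hql := hq0 l (by omega)
    have hqn := hq0 n (by omega)
    have hpl := Real.rpow_pos_of_pos hl0 a
    have hpn := Real.rpow_pos_of_pos hn0 a
    have hdiff : ∀ k, l ≤ k → k ≤ n → |q k - q n| ≤ δ * q n := fun k h1 h2 => by
      have := hN l hNl n hln (by omega) k h1 h2
      rwa [← div_self hqn.ne', ← sub_div, abs_div, abs_of_pos hqn, div_le_iff₀ hqn] at this
    -- Write the error as ∑ (q_k - q_n)Δ(k^a). The terms with k ≤ l reproduce the error at l up to a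
    -- change of the constant from q_l to q_n.
    have hsplit : M n - q n * (n : ℝ) ^ a = (M l - q l * (l : ℝ) ^ a)
        + (q l - q n) * (l : ℝ) ^ a + ∑ k ∈ Finset.Ioc l n, (q k - q n) * powIncrement a k := by
      have e1 : ∀ f : ℕ → ℝ, ∑ k ∈ Finset.Icc 1 n, f k =
          ∑ k ∈ Finset.Icc 1 l, f k + ∑ k ∈ Finset.Ioc l n, f k := fun f => by
        have := Finset.sum_Ioc_consecutive f (Nat.zero_le l) hln
        simpa [← Finset.Icc_succ_left_eq_Ioc] using this.symm
      rw [hsum n, hsum l, ← sum_powIncrement ha0 n, ← sum_powIncrement ha0 l, e1, e1]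
      simp only [sub_mul, Finset.sum_sub_distrib, Finset.mul_sum, mul_add]
      ring
    have hIoc : ∑ k ∈ Finset.Ioc l n, powIncrement a k = (n : ℝ) ^ a - (l : ℝ) ^ a := by
      have := Finset.sum_Ioc_consecutive (powIncrement a) (Nat.zero_le l) hln
      rw [← sum_powIncrement ha0 n, ← sum_powIncrement ha0 l]
      simp only [← Finset.Icc_succ_left_eq_Ioc] at this ⊢
      simp at this ⊢
      linarith
    have hbound : |M n - q n * (n : ℝ) ^ a| ≤ |M l - q l * (l : ℝ) ^ a| + δ * q n * (n : ℝ) ^ a := by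
      rw [hsplit]
      refine (abs_add_le _ _).trans ?_
      have e1 := abs_add_le (M l - q l * (l : ℝ) ^ a) ((q l - q n) * (l : ℝ) ^ a)
      have e2 : |(q l - q n) * (l : ℝ) ^ a| ≤ δ * q n * (l : ℝ) ^ a := by
        rw [abs_mul, abs_of_pos hpl]
        exact mul_le_mul_of_nonneg_right (hdiff l le_rfl hln) hpl.le
      have e3 : |∑ k ∈ Finset.Ioc l n, (q k - q n) * powIncrement a k| ≤
          δ * q n * ((n : ℝ) ^ a - (l : ℝ) ^ a) := by
        rw [← hIoc, Finset.mul_sum]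
        refine (Finset.abs_sum_le_sum_abs _ _).trans (Finset.sum_le_sum fun k hk => ?_)
        rw [Finset.mem_Ioc] at hk
        have := powIncrement_pos ha0 (k := k) (by omega)
        rw [abs_mul, abs_of_pos this]
        exact mul_le_mul_of_nonneg_right (hdiff k hk.1.le hk.2) this.le
      linarith
    have hd : ∀ m, 0 < q m * (m : ℝ) ^ a → |M m / (q m * (m : ℝ) ^ a) - 1| =
        |M m - q m * (m : ℝ) ^ a| / (q m * (m : ℝ) ^ a) := fun m hm => by
      rw [← div_self hm.ne', ← sub_div, abs_div, abs_of_pos hm]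
    rw [hd n (mul_pos hqn hpn), hd l (mul_pos hql hpl), div_le_iff₀ (mul_pos hqn hpn)]
    have hratio : q l * (l : ℝ) ^ a ≤ (1 + s) / 2 * (q n * (n : ℝ) ^ a) := by
      have e1 : q l ≤ (1 + δ) * q n := by
        have := (abs_le.1 (hdiff l le_rfl hln)).2; linarith
      have e2 : (l : ℝ) ^ a ≤ s * (n : ℝ) ^ a := by
        have : (l : ℝ) * 2 ≤ n := by exact_mod_cast (by omega : l * 2 ≤ n)
        have := Real.rpow_le_rpow (by positivity) this ha0.le
        rw [Real.mul_rpow hl0.le (by norm_num)] at this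
        rw [hs, inv_mul_eq_div, le_div_iff₀ (by positivity)]
        exact this
      have e3 : (1 + δ) * s ≤ (1 + s) / 2 := by
        have := min_le_right ε ((1 - s) / 2)
        nlinarith
      calc q l * (l : ℝ) ^ a ≤ ((1 + δ) * q n) * (s * (n : ℝ) ^ a) := by gcongr
        _ = ((1 + δ) * s) * (q n * (n : ℝ) ^ a) := by ring
        _ ≤ _ := by gcongr
    have hx : 0 ≤ |M l - q l * (l : ℝ) ^ a| / (q l * (l : ℝ) ^ a) := by positivity
    have e5 : |M l - q l * (l : ℝ) ^ a| =
        |M l - q l * (l : ℝ) ^ a| / (q l * (l : ℝ) ^ a) * (q l * (l : ℝ) ^ a) :=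
      (div_mul_cancel₀ _ (mul_pos hql hpl).ne').symm
    have e6 := mul_le_mul_of_nonneg_left hratio hx
    have e7 : δ * q n * (n : ℝ) ^ a ≤ ε * (q n * (n : ℝ) ^ a) := by
      rw [mul_assoc]; gcongr; exact min_le_left _ _
    nlinarith
  have hu1 : Tendsto (fun n : ℕ => M n / (q n * (n : ℝ) ^ a)) atTop (𝓝 1) := by
    have := (tendsto_zero_iff_abs_tendsto_zero _).2 hu
    simpa using this.add_const 1
  have hfin := hu1.mul ((tendsto_powIncrement_div a).inv₀ ha0.ne')
  rw [one_mul] at hfin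
  refine hfin.congr' ?_
  filter_upwards [eventually_ge_atTop 1] with n hn
  have hn0 : (0 : ℝ) < n := by positivity
  have h1 := (h.1 n hn).ne'
  have h2 := (powIncrement_pos ha0 hn).ne'
  have h3 := (Real.rpow_pos_of_pos hn0 a).ne'
  simp only [hq]
  rw [Real.rpow_sub_one hn0.ne']
  field_simp
  rfl

/-- Take reciprocals in Karamata's theorem at n + 1 and remove the last summand. The arguments below
use regular variation only through this limit and positivity. -/
theorem IsRegularlyVarying.tendsto_mul_succ_div_sum {c : ℕ → ℝ} {ρ : ℝ}
    (h : IsRegularlyVarying c ρ) (hρ : -1 < ρ) :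
    Tendsto (fun n : ℕ => n * c (n + 1) / ∑ k ∈ Finset.Icc 1 n, c k) atTop (𝓝 (ρ + 1)) := by
  have h0 : 0 < ρ + 1 := by linarith
  have h1 := (h.tendsto_sum_div hρ).comp (tendsto_add_atTop_nat 1)
  have h2 : Tendsto (fun n : ℕ => (n : ℝ)⁻¹) atTop (𝓝 0) := tendsto_inv_atTop_nhds_zero_nat
  have h3 := ((h1.mul (h2.const_add 1)).sub h2).inv₀ (by simpa using h0.ne')
  simp only [add_zero, mul_one, sub_zero, inv_inv] at h3
  refine h3.congr' ?_
  filter_upwards [eventually_ge_atTop 1] with n hn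
  have hn0 : (n : ℝ) ≠ 0 := by positivity
  have hc := (h.1 (n + 1) (by omega)).ne'
  have hs : (∑ k ∈ Finset.Icc 1 n, c k) ≠ 0 := (Finset.sum_pos (fun k hk =>
    h.1 k (Finset.mem_Icc.1 hk).1) ⟨1, Finset.mem_Icc.2 ⟨le_rfl, hn⟩⟩).ne'
  have hn2 : (n : ℝ) + 1 ≠ 0 := by positivity
  simp only [Function.comp]
  rw [Finset.sum_Icc_succ_top (by omega), inv_eq_iff_eq_inv, inv_div]
  push_cast
  field_simp
  ring

/-! ### Roots of clusters for one realization -/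

section Deterministic

variable {a : ℕ → ℝ} {b : ℕ → ℕ}

/-- Every step of the walk equals the innovation at the root of its cluster. -/
theorem exists_root (ha : ∀ n, a n = 0 ∨ a n = 1) (hb : ∀ n, 1 ≤ n → b (n + 1) ∈ Finset.Icc 1 n)
    (k : ℕ) (hk : 1 ≤ k) : ∃ r ∈ Finset.Icc 1 k, ∀ ξ : ℕ → ℝ, rwStep ξ a b k = ξ r := by
  induction k using Nat.strong_induction_on with
  | _ k ih =>
    obtain rfl | ⟨n, rfl⟩ : k = 1 ∨ ∃ n, k = n + 2 := by
      by_cases h : k = 1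
      · exact Or.inl h
      · exact Or.inr ⟨k - 2, by omega⟩
    · exact ⟨1, by simp, fun ξ => rwStep_one ξ a b⟩
    · have hbn : 1 ≤ b (n + 2) ∧ b (n + 2) ≤ n + 1 := Finset.mem_Icc.1 (hb (n + 1) (by omega))
      rcases ha (n + 2) with h | h
      · refine ⟨n + 2, by simp, fun ξ => ?_⟩
        rw [rwStep_succ ξ a b (n := n + 1) (by omega) hbn.2, h]
        ring
      · obtain ⟨r, hr, hr2⟩ := ih (b (n + 2)) (by omega) hbn.1
        rw [Finset.mem_Icc] at hr
        refine ⟨r, Finset.mem_Icc.2 (by omega), fun ξ => ?_⟩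
        rw [rwStep_succ ξ a b (n := n + 1) (by omega) hbn.2, h, hr2]
        ring

/-- Expanding over the possible values of the memory index separates the fresh randomness at time n
+ 1 from the past values, so that expectations can be taken term by term. -/
theorem rwStep_succ_eq_sum (hb : ∀ n, 1 ≤ n → b (n + 1) ∈ Finset.Icc 1 n) (ξ : ℕ → ℝ) {n : ℕ}
    (hn : 1 ≤ n) : rwStep ξ a b (n + 1) =
      ∑ i ∈ Finset.Icc 1 n, (a (n + 1) * if b (n + 1) = i then 1 else 0) * rwStep ξ a b i +
        (1 - a (n + 1)) * ξ (n + 1) := by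
  have h := hb n hn
  rw [rwStep_succ ξ a b hn (Finset.mem_Icc.1 h).2]
  congr 1
  rw [Finset.sum_eq_single_of_mem _ h]
  · simp
  · intro i _ hi
    simp [hi.symm]

end Deterministic

/-! ### Bounded measurable functions and almost sure ranges -/

/-- The bounded measurable functions form a subalgebra. -/
def boundedMeasurable {Ω : Type*} (m : MeasurableSpace Ω) : Subalgebra ℝ (Ω → ℝ) where
  carrier := {f | Measurable[m] f ∧ ∃ K, ∀ ω, |f ω| ≤ K}
  mul_mem' := by
    rintro f g ⟨hf, K, hK⟩ ⟨hg, K', hK'⟩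
    refine ⟨hf.mul hg, K * K', fun ω => ?_⟩
    rw [Pi.mul_apply, abs_mul]
    exact mul_le_mul (hK ω) (hK' ω) (abs_nonneg _) ((abs_nonneg _).trans (hK ω))
  add_mem' := by
    rintro f g ⟨hf, K, hK⟩ ⟨hg, K', hK'⟩
    exact ⟨hf.add hg, K + K', fun ω => (abs_add_le _ _).trans (add_le_add (hK ω) (hK' ω))⟩
  algebraMap_mem' := fun r => ⟨measurable_const, |r|, fun ω => le_rfl⟩

section BoundedMeasurable

variable {Ω : Type*} {m m' mΩ : MeasurableSpace Ω} {f g : Ω → ℝ}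

theorem boundedMeasurable_mono (h : m ≤ m') (hf : f ∈ boundedMeasurable m) :
    f ∈ boundedMeasurable m' := ⟨hf.1.mono h le_rfl, hf.2⟩

theorem const_mem_boundedMeasurable (r : ℝ) : (fun _ : Ω => r) ∈ boundedMeasurable m :=
  (boundedMeasurable m).algebraMap_mem r

theorem integrable_of_boundedMeasurable {P : Measure Ω} [IsFiniteMeasure P]
    (hf : f ∈ boundedMeasurable mΩ) : Integrable f P := by
  obtain ⟨K, hK⟩ := hf.2
  exact Integrable.of_bound hf.1.aestronglyMeasurable K (Eventually.of_forall hK)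

end BoundedMeasurable

/-- The model prescribes point masses only. Since they add up to 1, the recollection data almost
surely have no other values. -/
theorem ae_mem_finset_of_sum_eq_one {Ω S : Type*} [MeasurableSpace Ω] [MeasurableSpace S]
    [MeasurableSingletonClass S] {P : Measure Ω} [IsProbabilityMeasure P] {X : Ω → S}
    (hX : Measurable X) (s : Finset S) (h : ∑ x ∈ s, P.real {ω | X ω = x} = 1) :
    ∀ᵐ ω ∂P, X ω ∈ s := by
  have hm : ∀ x, MeasurableSet {ω | X ω = x} := fun x => hX (measurableSet_singleton x)
  have h1 : P.real (⋃ x ∈ s, {ω | X ω = x}) = 1 := by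
    rw [measureReal_biUnion_finset _ (fun x _ => hm x), h]
    intro x _ y _ hxy
    rw [Function.onFun, Set.disjoint_left]
    intro ω (h1 : X ω = x) (h2 : X ω = y)
    exact hxy (h1.symm.trans h2)
  have h2 : (⋃ x ∈ s, {ω | X ω = x}) ∈ ae P := by
    rw [mem_ae_iff_prob_eq_one (Finset.measurableSet_biUnion s fun x _ => hm x)]
    rwa [measureReal_def, ENNReal.toReal_eq_one_iff] at h1
  filter_upwards [h2] with ω hω
  obtain ⟨x, hx, hx2⟩ := Set.mem_iUnion₂.1 hω
  have : X ω = x := hx2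
  rwa [this]

/-! ### Clusters, their weights, and the σ-algebras of the past -/

section Model

variable {Ω : Type*}

/-- The recollection indicator, forced to take the values `0` and `1`. -/
noncomputable def memInd (α : ℕ → Ω → ℝ) (n : ℕ) (ω : Ω) : ℝ := if α n ω = 1 then 1 else 0

/-- The memory index, forced to lie in `{1, …, n - 1}`. -/
def memIdx (β : ℕ → Ω → ℕ) (n : ℕ) (ω : Ω) : ℕ :=
  if β n ω ∈ Finset.Icc 1 (n - 1) then β n ω else 1

theorem memInd_eq (α : ℕ → Ω → ℝ) (n : ℕ) (ω : Ω) : memInd α n ω = 0 ∨ memInd α n ω = 1 := by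
  unfold memInd; split_ifs <;> simp

theorem memIdx_mem (β : ℕ → Ω → ℕ) (ω : Ω) {n : ℕ} (hn : 1 ≤ n) :
    memIdx β (n + 1) ω ∈ Finset.Icc 1 n := by
  unfold memIdx
  split_ifs with h
  · simpa using h
  · simpa using hn

/-- The indicator that time `k` belongs to the cluster rooted at `j`. -/
noncomputable def member (α : ℕ → Ω → ℝ) (β : ℕ → Ω → ℕ) (j k : ℕ) (ω : Ω) : ℝ :=
  rwStep (Pi.single j 1) (fun i => memInd α i ω) (fun i => memIdx β i ω) k

/-- The weight at time `n` of the cluster rooted at `j`. -/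
noncomputable def clusterWeight (w : ℕ → ℝ) (α : ℕ → Ω → ℝ) (β : ℕ → Ω → ℕ) (j n : ℕ) (ω : Ω) : ℝ :=
  ∑ k ∈ Finset.Icc 1 n, w k * member α β j k ω

variable {α : ℕ → Ω → ℝ} {β : ℕ → Ω → ℕ}

/-- The root does not depend on the innovations, so feeding unit vectors into the recursion detects
it. All facts on cluster indicators follow from this form. -/
theorem exists_root_member (ω : Ω) {k : ℕ} (hk : 1 ≤ k) :
    ∃ r ∈ Finset.Icc 1 k, (∀ j, member α β j k ω = if j = r then 1 else 0) ∧
      ∀ ξ : ℕ → ℝ, rwStep ξ (fun i => memInd α i ω) (fun i => memIdx β i ω) k = ξ r := by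
  obtain ⟨r, hr, h⟩ := exists_root (a := fun i => memInd α i ω) (b := fun i => memIdx β i ω)
    (fun n => memInd_eq α n ω) (fun n hn => memIdx_mem β ω hn) k hk
  refine ⟨r, hr, fun j => ?_, h⟩
  rw [member, h, Pi.single_apply]
  simp only [eq_comm]

theorem member_of_lt {j k : ℕ} (ω : Ω) (hk : 1 ≤ k) (h : k < j) : member α β j k ω = 0 := by
  obtain ⟨r, hr, h1, -⟩ := exists_root_member (α := α) (β := β) ω hk
  rw [h1, if_neg]
  rintro rfl
  rw [Finset.mem_Icc] at hr
  omega

theorem member_eq {k : ℕ} (j : ℕ) (ω : Ω) (hk : 1 ≤ k) :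
    member α β j k ω = 0 ∨ member α β j k ω = 1 := by
  obtain ⟨r, hr, h1, -⟩ := exists_root_member (α := α) (β := β) ω hk
  rw [h1]; split_ifs <;> simp

theorem sum_member {k n : ℕ} (ω : Ω) (hk : 1 ≤ k) (hkn : k ≤ n) :
    ∑ j ∈ Finset.Icc 1 n, member α β j k ω = 1 := by
  obtain ⟨r, hr, h1, -⟩ := exists_root_member (α := α) (β := β) ω hk
  rw [Finset.mem_Icc] at hr
  simp only [h1, Finset.sum_ite_eq']
  rw [if_pos (Finset.mem_Icc.2 (by omega))]

/-- Sums over the exclusive cluster indicators commute with powers. -/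
theorem sum_member_mul_sq {k : ℕ} (ω : Ω) (hk : 1 ≤ k) (s : Finset ℕ) (H : ℕ → ℝ) :
    (∑ j ∈ s, member α β j k ω * H j) ^ 2 = ∑ j ∈ s, member α β j k ω * H j ^ 2 := by
  obtain ⟨r, hr, h1, -⟩ := exists_root_member (α := α) (β := β) ω hk
  simp only [h1, ite_mul, one_mul, zero_mul, Finset.sum_ite_eq']
  split_ifs <;> simp

theorem member_succ (j : ℕ) (ω : Ω) {n : ℕ} (hn : 1 ≤ n) : member α β j (n + 1) ω =
    ∑ i ∈ Finset.Icc 1 n, (memInd α (n + 1) ω * if memIdx β (n + 1) ω = i then 1 else 0) *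
      member α β j i ω + (1 - memInd α (n + 1) ω) * (if j = n + 1 then 1 else 0) := by
  rw [member, rwStep_succ_eq_sum (fun n hn => memIdx_mem β ω hn) _ hn, Pi.single_apply]
  simp only [eq_comm, member]

theorem member_self (ω : Ω) {n : ℕ} (hn : 1 ≤ n) :
    member α β (n + 1) (n + 1) ω = 1 - memInd α (n + 1) ω := by
  rw [member_succ _ _ hn, Finset.sum_eq_zero]
  · simp
  · intro i hi
    rw [Finset.mem_Icc] at hi
    rw [member_of_lt ω hi.1 (by omega), mul_zero]

theorem clusterWeight_succ (w : ℕ → ℝ) (j n : ℕ) (ω : Ω) : clusterWeight w α β j (n + 1) ω =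
    clusterWeight w α β j n ω + w (n + 1) * member α β j (n + 1) ω := by
  rw [clusterWeight, Finset.sum_Icc_succ_top (by omega), clusterWeight]

theorem clusterWeight_of_lt (w : ℕ → ℝ) {j n : ℕ} (ω : Ω) (h : n < j) :
    clusterWeight w α β j n ω = 0 :=
  Finset.sum_eq_zero fun k hk => by
    rw [Finset.mem_Icc] at hk
    rw [member_of_lt ω hk.1 (by omega), mul_zero]

theorem clusterWeight_nonneg {w : ℕ → ℝ} (hw : ∀ n, 1 ≤ n → 0 ≤ w n) (j n : ℕ) (ω : Ω) :
    0 ≤ clusterWeight w α β j n ω :=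
  Finset.sum_nonneg fun k hk => by
    rw [Finset.mem_Icc] at hk
    have := hw k hk.1
    rcases member_eq (α := α) (β := β) j ω hk.1 with h | h <;> simp [h, this]

theorem sum_clusterWeight (w : ℕ → ℝ) (n : ℕ) (ω : Ω) :
    ∑ j ∈ Finset.Icc 1 n, clusterWeight w α β j n ω = ∑ k ∈ Finset.Icc 1 n, w k := by
  unfold clusterWeight
  rw [Finset.sum_comm]
  refine Finset.sum_congr rfl fun k hk => ?_
  rw [Finset.mem_Icc] at hk
  rw [← Finset.mul_sum, sum_member ω hk.1 hk.2, mul_one]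

/-- Grouping times by their root turns the walk into a sum of innovations weighted by cluster sizes.
-/
theorem sum_rwStep_eq_sum_clusterWeight (ξ : ℕ → ℝ) (n : ℕ) (ω : Ω) :
    ∑ k ∈ Finset.Icc 1 n, rwStep ξ (fun i => memInd α i ω) (fun i => memIdx β i ω) k =
      ∑ j ∈ Finset.Icc 1 n, ξ j * clusterWeight (fun _ => 1) α β j n ω := by
  simp only [clusterWeight, Finset.mul_sum]
  rw [Finset.sum_comm]
  refine Finset.sum_congr rfl fun k hk => ?_
  rw [Finset.mem_Icc] at hk
  obtain ⟨r, hr, h1, h2⟩ := exists_root_member (α := α) (β := β) ω hk.1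
  rw [Finset.mem_Icc] at hr
  simp only [h2, h1, mul_ite, mul_one, mul_zero, Finset.sum_ite_eq']
  rw [if_pos (Finset.mem_Icc.2 (by omega))]

/-- The joint family of inputs whose mutual independence is assumed. -/
def inputs (ξ α : ℕ → Ω → ℝ) (β : ℕ → Ω → ℕ) : ℕ ⊕ (ℕ ⊕ ℕ) → Ω → ℝ :=
  Sum.elim (fun n : ℕ => ξ (n + 1))
    (Sum.elim (fun n : ℕ => α (n + 2)) (fun (n : ℕ) (ω : Ω) => (β (n + 2) ω : ℝ)))

/-- The σ-algebra generated by the inputs with label in `S`. -/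
@[reducible] def inputSigma (ξ α : ℕ → Ω → ℝ) (β : ℕ → Ω → ℕ) (S : Set (ℕ ⊕ (ℕ ⊕ ℕ))) : MeasurableSpace Ω :=
  ⨆ i ∈ S, MeasurableSpace.comap (inputs ξ α β i) inferInstance

/-- The labels of the recollection data used up to time `n`. -/
def pastLabels (n : ℕ) : Set (ℕ ⊕ (ℕ ⊕ ℕ)) :=
  {i | ∃ k, k + 2 ≤ n ∧ (i = Sum.inr (Sum.inl k) ∨ i = Sum.inr (Sum.inr k))}

variable {ξ : ℕ → Ω → ℝ}

theorem measurable_inputs_inputSigma {S : Set (ℕ ⊕ (ℕ ⊕ ℕ))} {i : ℕ ⊕ (ℕ ⊕ ℕ)} (hi : i ∈ S) :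
    Measurable[inputSigma ξ α β S] (inputs ξ α β i) :=
  (comap_measurable _).mono (le_iSup₂_of_le i hi le_rfl) le_rfl

theorem inputSigma_mono {S T : Set (ℕ ⊕ (ℕ ⊕ ℕ))} (h : S ⊆ T) :
    inputSigma ξ α β S ≤ inputSigma ξ α β T := biSup_mono fun _ hi => h hi

theorem pastLabels_mono {k n : ℕ} (h : k ≤ n) : pastLabels k ⊆ pastLabels n :=
  fun _ ⟨l, hl, hi⟩ => ⟨l, hl.trans h, hi⟩

theorem measurable_memInd {m : MeasurableSpace Ω} {n : ℕ} (h : Measurable[m] (α n)) :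
    Measurable[m] (memInd α n) :=
  Measurable.ite (h (measurableSet_singleton 1)) measurable_const measurable_const

theorem measurable_memIdx {m : MeasurableSpace Ω} {n : ℕ}
    (h : Measurable[m] (fun ω => (β n ω : ℝ))) : Measurable[m] (memIdx β n) := by
  have h1 : Measurable[m] (β n) := by
    have := Nat.measurable_floor.comp h
    simpa [Function.comp_def] using this
  exact (measurable_from_nat (f := fun k => if k ∈ Finset.Icc 1 (n - 1) then k else 1)).comp h1

/-- The clusters are built from recollection data alone. The labels in `pastLabels n` include no
innovation, which later gives independence of clusters and innovations. -/
theorem member_mem_boundedMeasurable (ξ : ℕ → Ω → ℝ) (j : ℕ) {k n : ℕ} (hk : 1 ≤ k) (hkn : k ≤ n) :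
    member α β j k ∈ boundedMeasurable (inputSigma ξ α β (pastLabels n)) := by
  refine ⟨?_, 1, fun ω => by rcases member_eq (α := α) (β := β) j ω hk with h | h <;> simp [h]⟩
  revert hkn hk
  induction k using Nat.strong_induction_on with
  | _ k ih =>
    intro hk hkn
    obtain rfl | ⟨l, rfl⟩ : k = 1 ∨ ∃ l, k = l + 2 := by
      by_cases h : k = 1
      · exact Or.inl h
      · exact Or.inr ⟨k - 2, by omega⟩
    · have : member α β j 1 = fun _ => (Pi.single j 1 : ℕ → ℝ) 1 :=
        funext fun ω => rwStep_one _ _ _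
      rw [this]
      exact measurable_const
    · have : member α β j (l + 2) = _ := funext fun ω => member_succ j ω (n := l + 1) (by omega)
      rw [this]
      have hα := measurable_memInd (m := inputSigma ξ α β (pastLabels n)) (α := α) (n := l + 2)
        (measurable_inputs_inputSigma (i := Sum.inr (Sum.inl l)) ⟨l, hkn, Or.inl rfl⟩)
      have hβ := measurable_memIdx (m := inputSigma ξ α β (pastLabels n)) (β := β) (n := l + 2)
        (measurable_inputs_inputSigma (i := Sum.inr (Sum.inr l)) ⟨l, hkn, Or.inr rfl⟩)
      refine Measurable.add (Finset.measurable_fun_sum _ fun i hi => ?_)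
        ((measurable_const.sub hα).mul_const _)
      rw [Finset.mem_Icc] at hi
      exact (hα.mul (Measurable.ite (hβ (measurableSet_singleton i)) measurable_const
        measurable_const)).mul (ih i (by omega) hi.1 (by omega))

theorem clusterWeight_mem_boundedMeasurable (ξ : ℕ → Ω → ℝ) (w : ℕ → ℝ) (j n : ℕ) :
    clusterWeight w α β j n ∈ boundedMeasurable (inputSigma ξ α β (pastLabels n)) := by
  have : clusterWeight w α β j n = ∑ k ∈ Finset.Icc 1 n, w k • member α β j k := by
    ext ω; simp [clusterWeight]
  rw [this]
  refine Subalgebra.sum_mem _ fun k hk => Subalgebra.smul_mem _ ?_ _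
  rw [Finset.mem_Icc] at hk
  exact member_mem_boundedMeasurable ξ j hk.1 hk.2

end Model

/-! ### Conditional means and second moments of one step -/

namespace IsRWInput

variable {Ω : Type*} [mΩ : MeasurableSpace Ω] {P : Measure Ω} [IsProbabilityMeasure P]
  {p : ℝ} {μ : ℕ → ℝ} {ξ α : ℕ → Ω → ℝ} {β : ℕ → Ω → ℕ}

theorem measurable_inputs (h : IsRWInput P p μ ξ α β) (i : ℕ ⊕ (ℕ ⊕ ℕ)) :
    Measurable (inputs ξ α β i) := by
  rcases i with i | i | i
  · exact h.measurable_ξ _ (by omega)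
  · exact h.measurable_α _ (by omega)
  · exact (measurable_from_nat (f := fun k : ℕ => (k : ℝ))).comp (h.measurable_β _ (by omega))

theorem inputSigma_le (h : IsRWInput P p μ ξ α β) (S : Set (ℕ ⊕ (ℕ ⊕ ℕ))) :
    inputSigma ξ α β S ≤ mΩ :=
  iSup₂_le fun i _ => (h.measurable_inputs i).comap_le

theorem indepFun_of_disjoint (h : IsRWInput P p μ ξ α β) {S T : Set (ℕ ⊕ (ℕ ⊕ ℕ))}
    (hST : Disjoint S T) {A B : Type*} [MeasurableSpace A] [MeasurableSpace B] {f : Ω → A}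
    {g : Ω → B} (hf : Measurable[inputSigma ξ α β S] f) (hg : Measurable[inputSigma ξ α β T] g) :
    IndepFun f g P := by
  have h1 := indep_iSup_of_disjoint (fun i => (h.measurable_inputs i).comap_le)
    ((iIndepFun_iff_iIndep _ _ _).1 h.indep) hST
  rw [IndepFun_iff_Indep]
  exact indep_of_indep_of_le_left (indep_of_indep_of_le_right h1 hg.comap_le) hf.comap_le

theorem ae_memIdx_eq (h : IsRWInput P p μ ξ α β) (hμ : ∀ n, 1 ≤ n → 0 < μ n) {n : ℕ} (hn : 2 ≤ n) :
    ∀ᵐ ω ∂P, memIdx β n ω = β n ω := by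
  have hs : 0 < ∑ j ∈ Finset.Icc 1 (n - 1), μ j :=
    Finset.sum_pos (fun k hk => hμ k (Finset.mem_Icc.1 hk).1) ⟨1, Finset.mem_Icc.2 (by omega)⟩
  have := ae_mem_finset_of_sum_eq_one (h.measurable_β n hn) (Finset.Icc 1 (n - 1)) (by
    rw [Finset.sum_congr rfl (h.prob_β n hn), ← Finset.sum_div, div_self hs.ne'])
  filter_upwards [this] with ω hω
  rw [memIdx, if_pos hω]

theorem ae_memInd_eq (h : IsRWInput P p μ ξ α β) {n : ℕ} (hn : 2 ≤ n) :
    ∀ᵐ ω ∂P, memInd α n ω = α n ω := by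
  have := ae_mem_finset_of_sum_eq_one (h.measurable_α n hn) {0, 1} (by
    rw [Finset.sum_pair (by norm_num), h.prob_α_one n hn, h.prob_α_zero n hn]; ring)
  filter_upwards [this] with ω hω
  rw [Finset.mem_insert, Finset.mem_singleton] at hω
  rcases hω with hω | hω <;> simp [memInd, hω]

theorem integral_memInd (h : IsRWInput P p μ ξ α β) {n : ℕ} (hn : 2 ≤ n) :
    ∫ ω, memInd α n ω ∂P = p := by
  have h1 : memInd α n = Set.indicator {ω | α n ω = 1} 1 := by
    ext ω; simp [memInd, Set.indicator_apply]
  rw [h1, ← h.prob_α_one n hn]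
  exact integral_indicator_one (h.measurable_α n hn (measurableSet_singleton 1))

theorem integral_memIdx_eq (h : IsRWInput P p μ ξ α β) (hμ : ∀ n, 1 ≤ n → 0 < μ n) {n : ℕ}
    (hn : 2 ≤ n) {i : ℕ} (hi : i ∈ Finset.Icc 1 (n - 1)) :
    ∫ ω, (if memIdx β n ω = i then (1 : ℝ) else 0) ∂P =
      μ i / ∑ j ∈ Finset.Icc 1 (n - 1), μ j := by
  have h1 : (fun ω => if memIdx β n ω = i then (1 : ℝ) else 0) =ᵐ[P]
      Set.indicator {ω | β n ω = i} 1 := by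
    filter_upwards [h.ae_memIdx_eq hμ hn] with ω hω
    simp [hω, Set.indicator_apply]
  rw [integral_congr_ae h1, ← h.prob_β n hn i hi]
  exact integral_indicator_one (h.measurable_β n hn (measurableSet_singleton i))

/-- The indicator and the memory index at time n + 1 are independent of the past and of each other.
Testing against every bounded past-measurable `G` replaces conditional expectation here and below.
-/
theorem integral_mul_recall (h : IsRWInput P p μ ξ α β) (hμ : ∀ n, 1 ≤ n → 0 < μ n) {n : ℕ}
    (hn : 1 ≤ n) {G : Ω → ℝ} (hG : G ∈ boundedMeasurable (inputSigma ξ α β (pastLabels n))) {i : ℕ}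
    (hi : i ∈ Finset.Icc 1 n) :
    ∫ ω, G ω * (memInd α (n + 1) ω * if memIdx β (n + 1) ω = i then 1 else 0) ∂P =
      p * μ i / (∑ j ∈ Finset.Icc 1 n, μ j) * ∫ ω, G ω ∂P := by
  obtain ⟨l, rfl⟩ : ∃ l, n = l + 1 := ⟨n - 1, by omega⟩
  have hα : ∀ {S}, Sum.inr (Sum.inl l) ∈ S → Measurable[inputSigma ξ α β S] (memInd α (l + 2)) :=
    fun hS => measurable_memInd (measurable_inputs_inputSigma (ξ := ξ) (β := β)
      (i := Sum.inr (Sum.inl l)) hS)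
  have hβ : ∀ {S}, Sum.inr (Sum.inr l) ∈ S → Measurable[inputSigma ξ α β S]
      (fun ω => if memIdx β (l + 2) ω = i then (1 : ℝ) else 0) := fun hS =>
    Measurable.ite (measurable_memIdx (measurable_inputs_inputSigma (ξ := ξ) (α := α)
      (i := Sum.inr (Sum.inr l)) hS) (measurableSet_singleton i)) measurable_const measurable_const
  set T : Set (ℕ ⊕ (ℕ ⊕ ℕ)) := {Sum.inr (Sum.inl l), Sum.inr (Sum.inr l)} with hT
  have hd1 : Disjoint (pastLabels (l + 1)) T := by
    rw [Set.disjoint_left]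
    rintro x ⟨k, hk, hx⟩ hx2
    rw [hT, Set.mem_insert_iff, Set.mem_singleton_iff] at hx2
    rcases hx with rfl | rfl <;> simp at hx2 <;> omega
  have hd2 : Disjoint ({Sum.inr (Sum.inl l)} : Set (ℕ ⊕ (ℕ ⊕ ℕ))) {Sum.inr (Sum.inr l)} := by
    simp
  have hJ : Measurable[inputSigma ξ α β T] (fun ω => memInd α (l + 2) ω *
      if memIdx β (l + 2) ω = i then (1 : ℝ) else 0) :=
    (hα (Set.mem_insert _ _)).mul (hβ (Set.mem_insert_of_mem _ rfl))
  have hα' := (hα (Set.mem_singleton _)).mono (h.inputSigma_le _) le_rfl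
  have hβ' := (hβ (Set.mem_singleton _)).mono (h.inputSigma_le _) le_rfl
  rw [(h.indepFun_of_disjoint hd1 hG.1 hJ).integral_fun_mul_eq_mul_integral
      (hG.1.mono (h.inputSigma_le _) le_rfl).aestronglyMeasurable
      (hα'.mul hβ').aestronglyMeasurable,
    (h.indepFun_of_disjoint hd2 (hα rfl) (hβ rfl)).integral_fun_mul_eq_mul_integral
      hα'.aestronglyMeasurable hβ'.aestronglyMeasurable,
    h.integral_memInd (by omega), h.integral_memIdx_eq hμ (by omega) hi]
  change _ * (p * (μ i / ∑ j ∈ Finset.Icc 1 (l + 1), μ j)) = _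
  ring

theorem integral_mul_memInd (h : IsRWInput P p μ ξ α β) {n : ℕ}
    (hn : 1 ≤ n) {G : Ω → ℝ} (hG : G ∈ boundedMeasurable (inputSigma ξ α β (pastLabels n))) :
    ∫ ω, G ω * (1 - memInd α (n + 1) ω) ∂P = (1 - p) * ∫ ω, G ω ∂P := by
  obtain ⟨l, rfl⟩ : ∃ l, n = l + 1 := ⟨n - 1, by omega⟩
  have hα : Measurable[inputSigma ξ α β {Sum.inr (Sum.inl l)}] (fun ω => 1 - memInd α (l + 2) ω) :=
    measurable_const.sub (measurable_memInd (measurable_inputs_inputSigma (ξ := ξ) (β := β)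
      (i := Sum.inr (Sum.inl l)) rfl))
  have hd1 : Disjoint (pastLabels (l + 1)) {Sum.inr (Sum.inl l)} := by
    rw [Set.disjoint_left]
    rintro x ⟨k, hk, hx⟩ hx2
    rw [Set.mem_singleton_iff] at hx2
    rcases hx with rfl | rfl <;> simp at hx2
    omega
  have hint : Integrable (memInd α (l + 2)) P := by
    refine Integrable.of_bound (measurable_memInd (h.measurable_α _ (by omega))).aestronglyMeasurable
      1 (Eventually.of_forall fun ω => ?_)
    rcases memInd_eq α (l + 2) ω with h | h <;> simp [h]
  rw [(h.indepFun_of_disjoint hd1 hG.1 hα).integral_fun_mul_eq_mul_integral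
      (hG.1.mono (h.inputSigma_le _) le_rfl).aestronglyMeasurable
      (hα.mono (h.inputSigma_le _) le_rfl).aestronglyMeasurable,
    integral_sub (integrable_const _) hint, h.integral_memInd (by omega)]
  simp [mul_comm]

theorem integrable_of_past (h : IsRWInput P p μ ξ α β) {n : ℕ} {G : Ω → ℝ}
    (hG : G ∈ boundedMeasurable (inputSigma ξ α β (pastLabels n))) : Integrable G P :=
  integrable_of_boundedMeasurable (boundedMeasurable_mono (h.inputSigma_le _) hG)

/-- Given the past, cluster `j` is joined through one of its members i, each with probability p
μ_i/M_n; these add up to p W_j/M_n. -/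
theorem integral_mul_member (h : IsRWInput P p μ ξ α β) (hμ : ∀ n, 1 ≤ n → 0 < μ n) {n : ℕ}
    (hn : 1 ≤ n) {G : Ω → ℝ} (hG : G ∈ boundedMeasurable (inputSigma ξ α β (pastLabels n))) {j : ℕ}
    (hj : j ≤ n) :
    ∫ ω, G ω * member α β j (n + 1) ω ∂P =
      ∫ ω, p / (∑ j ∈ Finset.Icc 1 n, μ j) * (G ω * clusterWeight μ α β j n ω) ∂P := by
  have hm : ∀ i ∈ Finset.Icc 1 n, G * member α β j i ∈
      boundedMeasurable (inputSigma ξ α β (pastLabels n)) := fun i hi =>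
    Subalgebra.mul_mem _ hG (member_mem_boundedMeasurable ξ j (Finset.mem_Icc.1 hi).1
      (Finset.mem_Icc.1 hi).2)
  have hJ : ∀ i, Integrable (fun ω => G ω * member α β j i ω *
      (memInd α (n + 1) ω * if memIdx β (n + 1) ω = i then 1 else 0)) P ∨ i ∉ Finset.Icc 1 n := by
    intro i
    by_cases hi : i ∈ Finset.Icc 1 n
    · left
      refine (h.integrable_of_past (hm i hi)).mul_bdd (c := 1) ?_ (Eventually.of_forall fun ω => ?_)
      · refine Measurable.aestronglyMeasurable ?_
        refine (measurable_memInd (h.measurable_α _ (by omega))).mul (Measurable.ite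
          (measurable_memIdx ((measurable_from_nat (f := fun k : ℕ => (k : ℝ))).comp
            (h.measurable_β _ (by omega))) (measurableSet_singleton i))
          measurable_const measurable_const)
      · rcases memInd_eq α (n + 1) ω with h | h <;> rw [h] <;> split_ifs <;> simp
    · exact Or.inr hi
  have h1 : ∀ ω, G ω * member α β j (n + 1) ω = ∑ i ∈ Finset.Icc 1 n, G ω * member α β j i ω *
      (memInd α (n + 1) ω * if memIdx β (n + 1) ω = i then 1 else 0) := fun ω => by
    rw [member_succ j ω hn, if_neg (by omega), mul_zero, add_zero, Finset.mul_sum]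
    exact Finset.sum_congr rfl fun i _ => by ring
  simp only [h1]
  rw [integral_finsetSum _ fun i hi => (hJ i).resolve_right (not_not.2 hi)]
  have h2 : ∀ ω, p / (∑ j ∈ Finset.Icc 1 n, μ j) * (G ω * clusterWeight μ α β j n ω) =
      ∑ i ∈ Finset.Icc 1 n, p * μ i / (∑ j ∈ Finset.Icc 1 n, μ j) * (G * member α β j i) ω :=
    fun ω => by
      rw [clusterWeight, Finset.mul_sum, Finset.mul_sum]
      exact Finset.sum_congr rfl fun i _ => by rw [Pi.mul_apply]; ring
  simp only [h2]
  rw [integral_finsetSum _ fun i hi => (h.integrable_of_past (hm i hi)).const_mul _]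
  refine Finset.sum_congr rfl fun i hi => ?_
  rw [integral_const_mul]
  exact h.integral_mul_recall hμ hn (hm i hi) hi

/-- The increment of an additive cluster functional when time `n + 1` is revealed: the functional
grows by `H j` if the new time joins the cluster of `j`, and by `c` if it starts a new one. -/
noncomputable def _root_.clusterIncrement (α : ℕ → Ω → ℝ) (β : ℕ → Ω → ℕ) (n : ℕ) (H : ℕ → Ω → ℝ)
    (c : ℝ) (ω : Ω) : ℝ :=
  ∑ j ∈ Finset.Icc 1 n, member α β j (n + 1) ω * H j ω + (1 - memInd α (n + 1) ω) * c

/-- The conditional mean of `clusterIncrement` given the past. -/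
noncomputable def _root_.clusterDrift (p : ℝ) (μ : ℕ → ℝ) (α : ℕ → Ω → ℝ) (β : ℕ → Ω → ℕ) (n : ℕ)
    (H : ℕ → Ω → ℝ) (c : ℝ) (ω : Ω) : ℝ :=
  p / (∑ j ∈ Finset.Icc 1 n, μ j) * ∑ j ∈ Finset.Icc 1 n, clusterWeight μ α β j n ω * H j ω
    + (1 - p) * c

theorem _root_.clusterDrift_mem (ξ : ℕ → Ω → ℝ) {n : ℕ} {H : ℕ → Ω → ℝ} (c : ℝ)
    (hH : ∀ j ∈ Finset.Icc 1 n, H j ∈ boundedMeasurable (inputSigma ξ α β (pastLabels n))) :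
    clusterDrift p μ α β n H c ∈ boundedMeasurable (inputSigma ξ α β (pastLabels n)) := by
  have : clusterDrift p μ α β n H c = (p / (∑ j ∈ Finset.Icc 1 n, μ j)) •
      ∑ j ∈ Finset.Icc 1 n, clusterWeight μ α β j n * H j + fun _ => (1 - p) * c := by
    ext ω; simp [clusterDrift]
  rw [this]
  exact Subalgebra.add_mem _ (Subalgebra.smul_mem _ (Subalgebra.sum_mem _ fun j hj =>
    Subalgebra.mul_mem _ (clusterWeight_mem_boundedMeasurable ξ μ j n) (hH j hj)) _)
    (const_mem_boundedMeasurable _)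

theorem _root_.clusterIncrement_mem (ξ : ℕ → Ω → ℝ) {n : ℕ} (hn : 1 ≤ n) {H : ℕ → Ω → ℝ} (c : ℝ)
    (hH : ∀ j ∈ Finset.Icc 1 n, H j ∈ boundedMeasurable (inputSigma ξ α β (pastLabels n))) :
    clusterIncrement α β n H c ∈ boundedMeasurable (inputSigma ξ α β (pastLabels (n + 1))) := by
  have : clusterIncrement α β n H c =
      ∑ j ∈ Finset.Icc 1 n, member α β j (n + 1) * H j + c • member α β (n + 1) (n + 1) := by
    ext ω; simp [clusterIncrement, member_self ω hn, mul_comm]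
  rw [this]
  exact Subalgebra.add_mem _ (Subalgebra.sum_mem _ fun j hj =>
    Subalgebra.mul_mem _ (member_mem_boundedMeasurable ξ j (by omega) le_rfl)
      (boundedMeasurable_mono (inputSigma_mono (pastLabels_mono (Nat.le_succ n))) (hH j hj)))
    (Subalgebra.smul_mem _ (member_mem_boundedMeasurable ξ _ (by omega) le_rfl) _)

theorem integral_mul_clusterIncrement (h : IsRWInput P p μ ξ α β) (hμ : ∀ n, 1 ≤ n → 0 < μ n)
    {n : ℕ} (hn : 1 ≤ n) {G : Ω → ℝ}
    (hG : G ∈ boundedMeasurable (inputSigma ξ α β (pastLabels n))) {H : ℕ → Ω → ℝ} (c : ℝ)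
    (hH : ∀ j ∈ Finset.Icc 1 n, H j ∈ boundedMeasurable (inputSigma ξ α β (pastLabels n))) :
    ∫ ω, G ω * clusterIncrement α β n H c ω ∂P = ∫ ω, G ω * clusterDrift p μ α β n H c ω ∂P := by
  have hup : ∀ {f : Ω → ℝ}, f ∈ boundedMeasurable (inputSigma ξ α β (pastLabels n)) →
      f ∈ boundedMeasurable (inputSigma ξ α β (pastLabels (n + 1))) := fun hf =>
    boundedMeasurable_mono (inputSigma_mono (pastLabels_mono (Nat.le_succ n))) hf
  have hGH : ∀ j ∈ Finset.Icc 1 n, G * H j ∈ boundedMeasurable _ := fun j hj =>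
    Subalgebra.mul_mem _ hG (hH j hj)
  have hmem : ∀ j, member α β j (n + 1) ∈
      boundedMeasurable (inputSigma ξ α β (pastLabels (n + 1))) := fun j =>
    member_mem_boundedMeasurable ξ j (by omega) le_rfl
  have e1 : ∀ ω, G ω * clusterIncrement α β n H c ω = ∑ j ∈ Finset.Icc 1 n,
      (G * H j) ω * member α β j (n + 1) ω + c * (G ω * (1 - memInd α (n + 1) ω)) := fun ω => by
    rw [clusterIncrement, mul_add, Finset.mul_sum]
    congr 1
    · exact Finset.sum_congr rfl fun j _ => by rw [Pi.mul_apply]; ring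
    · ring
  have e2 : ∀ ω, G ω * clusterDrift p μ α β n H c ω = ∑ j ∈ Finset.Icc 1 n,
      p / (∑ j ∈ Finset.Icc 1 n, μ j) * ((G * H j) ω * clusterWeight μ α β j n ω) +
        c * ((1 - p) * G ω) := fun ω => by
    rw [clusterDrift, mul_add, Finset.mul_sum, Finset.mul_sum]
    congr 1
    · exact Finset.sum_congr rfl fun j _ => by rw [Pi.mul_apply]; ring
    · ring
  have i1 : ∀ j ∈ Finset.Icc 1 n, Integrable (fun ω => (G * H j) ω * member α β j (n + 1) ω) P :=
    fun j hj => h.integrable_of_past (Subalgebra.mul_mem _ (hup (hGH j hj)) (hmem j))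
  have i2 : Integrable (fun ω => c * (G ω * (1 - memInd α (n + 1) ω))) P := by
    have := h.integrable_of_past (Subalgebra.smul_mem _ (Subalgebra.mul_mem _ (hup hG)
      (hmem (n + 1))) c)
    refine this.congr (Eventually.of_forall fun ω => ?_)
    simp [member_self ω hn]
  have i3 : ∀ j ∈ Finset.Icc 1 n, Integrable (fun ω => p / (∑ j ∈ Finset.Icc 1 n, μ j) *
      ((G * H j) ω * clusterWeight μ α β j n ω)) P := fun j hj =>
    (h.integrable_of_past (Subalgebra.mul_mem _ (hGH j hj)
      (clusterWeight_mem_boundedMeasurable ξ μ j n))).const_mul _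
  have i4 : Integrable (fun ω => c * ((1 - p) * G ω)) P :=
    ((h.integrable_of_past hG).const_mul _).const_mul _
  simp only [e1, e2]
  rw [integral_add (integrable_finsetSum _ i1) i2, integral_add (integrable_finsetSum _ i3) i4,
    integral_finsetSum _ i1, integral_finsetSum _ i3, integral_const_mul, integral_const_mul,
    integral_const_mul, h.integral_mul_memInd hn hG]
  congr 1
  refine Finset.sum_congr rfl fun j hj => ?_
  exact h.integral_mul_member hμ hn (hGH j hj) (Finset.mem_Icc.1 hj).2

/-- Time n + 1 belongs to exactly one cluster, so squaring produces no cross terms. The founding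
term is the summand of index n + 1. -/
theorem _root_.clusterIncrement_sq {n : ℕ} (hn : 1 ≤ n) (H : ℕ → Ω → ℝ) (c : ℝ) (ω : Ω) :
    clusterIncrement α β n H c ω ^ 2 = clusterIncrement α β n (fun j ω => H j ω ^ 2) (c ^ 2) ω := by
  have := sum_member_mul_sq (α := α) (β := β) ω (k := n + 1) (by omega) (Finset.Icc 1 (n + 1))
    (fun j => if j = n + 1 then c else H j ω)
  rw [Finset.sum_Icc_succ_top (by omega), Finset.sum_Icc_succ_top (by omega)] at this
  have hne : ∀ j ∈ Finset.Icc 1 n, j ≠ n + 1 := fun j hj => by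
    rw [Finset.mem_Icc] at hj; omega
  simp only [clusterIncrement, ← member_self (β := β) ω hn]
  have e1 : ∑ j ∈ Finset.Icc 1 n, member α β j (n + 1) ω * H j ω = ∑ j ∈ Finset.Icc 1 n,
      member α β j (n + 1) ω * (if j = n + 1 then c else H j ω) :=
    Finset.sum_congr rfl fun j hj => by rw [if_neg (hne j hj)]
  have e2 : ∑ j ∈ Finset.Icc 1 n, member α β j (n + 1) ω * H j ω ^ 2 = ∑ j ∈ Finset.Icc 1 n,
      member α β j (n + 1) ω * (if j = n + 1 then c else H j ω) ^ 2 :=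
    Finset.sum_congr rfl fun j hj => by rw [if_neg (hne j hj)]
  rw [e1, e2]
  rwa [if_pos (rfl : n + 1 = n + 1)] at this

theorem _root_.integral_add_sq {f g : Ω → ℝ} (hf : Integrable (fun ω => f ω ^ 2) P)
    (hfg : Integrable (fun ω => f ω * g ω) P) (hg : Integrable (fun ω => g ω ^ 2) P) :
    ∫ ω, (f ω + g ω) ^ 2 ∂P = ∫ ω, f ω ^ 2 ∂P + 2 * ∫ ω, f ω * g ω ∂P + ∫ ω, g ω ^ 2 ∂P := by
  have h1 : Integrable (fun ω => 2 * (f ω * g ω)) P := hfg.const_mul 2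
  have h2 : Integrable (fun ω => f ω ^ 2 + 2 * (f ω * g ω)) P := hf.add h1
  rw [← integral_const_mul, ← integral_add hf h1, ← integral_add h2 hg]
  exact integral_congr_ae (Eventually.of_forall fun ω => by simp only; ring)

/-- The second moment of a functional after one step. -/
theorem integral_add_clusterIncrement_sq_le (h : IsRWInput P p μ ξ α β)
    (hμ : ∀ n, 1 ≤ n → 0 < μ n) {n : ℕ} (hn : 1 ≤ n) {G : Ω → ℝ}
    (hG : G ∈ boundedMeasurable (inputSigma ξ α β (pastLabels n))) {H : ℕ → Ω → ℝ} (c : ℝ)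
    (hH : ∀ j ∈ Finset.Icc 1 n, H j ∈ boundedMeasurable (inputSigma ξ α β (pastLabels n))) :
    ∫ ω, (G ω + clusterIncrement α β n H c ω) ^ 2 ∂P ≤
      ∫ ω, (G ω + clusterDrift p μ α β n H c ω) ^ 2 ∂P +
        ∫ ω, clusterDrift p μ α β n (fun j ω => H j ω ^ 2) (c ^ 2) ω ∂P := by
  have hI := clusterIncrement_mem ξ hn c hH
  have hD := clusterDrift_mem (p := p) (μ := μ) ξ c hH
  have hH2 : ∀ j ∈ Finset.Icc 1 n, (fun ω => H j ω ^ 2) ∈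
      boundedMeasurable (inputSigma ξ α β (pastLabels n)) := fun j hj =>
    Subalgebra.pow_mem _ (hH j hj) 2
  have hG' := boundedMeasurable_mono (inputSigma_mono (ξ := ξ) (α := α) (β := β)
    (pastLabels_mono (Nat.le_succ n))) hG
  have iG2 : Integrable (fun ω => G ω ^ 2) P := h.integrable_of_past (Subalgebra.pow_mem _ hG 2)
  have e1 := integral_add_sq iG2 (h.integrable_of_past (Subalgebra.mul_mem _ hG' hI))
    (h.integrable_of_past (Subalgebra.pow_mem _ hI 2))
  have e2 := integral_add_sq iG2 (h.integrable_of_past (Subalgebra.mul_mem _ hG hD))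
    (h.integrable_of_past (Subalgebra.pow_mem _ hD 2))
  have e3 : ∫ ω, clusterIncrement α β n H c ω ^ 2 ∂P =
      ∫ ω, clusterDrift p μ α β n (fun j ω => H j ω ^ 2) (c ^ 2) ω ∂P := by
    have := h.integral_mul_clusterIncrement hμ hn (const_mem_boundedMeasurable 1) (c ^ 2) hH2
    simpa [clusterIncrement_sq hn] using this
  -- Expanding both squares, the cross terms agree, and the two sides of the claim differ by exactly
  -- this nonnegative integral.
  have e4 : 0 ≤ ∫ ω, clusterDrift p μ α β n H c ω ^ 2 ∂P := integral_nonneg fun ω => sq_nonneg _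
  rw [e1, e2, e3, h.integral_mul_clusterIncrement hμ hn hG c hH]
  linarith

end IsRWInput

/-! ### Recursions with harmonic step sizes -/

/-- A discrete Grönwall inequality with harmonic step sizes. -/
theorem eventually_le_of_harmonic_step {e : ℕ → ℝ} {θ K : ℝ} (hθ : 0 < θ)
    (h : ∀ᶠ n : ℕ in atTop, e (n + 1) ≤ (1 - θ / n) * e n + K / n) {δ : ℝ} (hδ : 0 < δ) :
    ∀ᶠ n in atTop, e n ≤ K / θ + δ := by
  obtain ⟨N, hN⟩ := eventually_atTop.1 (h.and
    ((eventually_ge_atTop 1).and (tendsto_natCast_atTop_atTop.eventually (eventually_ge_atTop θ))))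
  set S : ℕ → ℝ := fun n => ∑ k ∈ Finset.range n, 1 / (k : ℝ) with hS
  have hSt : Tendsto S atTop atTop :=
    (not_summable_iff_tendsto_nat_atTop_of_nonneg fun k => by positivity).1
      Real.not_summable_one_div_natCast
  -- K/θ is the fixed point of the recursion. The excess over it, multiplied by exp(θ S_n), is
  -- nonincreasing, and the divergence of the harmonic series sends the excess to 0.
  set g : ℕ → ℝ := fun n => max (e n - K / θ) 0 with hg
  have hstep : ∀ n, N ≤ n → g (n + 1) * Real.exp (θ * S (n + 1)) ≤ g n * Real.exp (θ * S n) := by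
    intro n hn
    obtain ⟨h1, h2, h3⟩ := hN n hn
    have hn0 : (0 : ℝ) < n := by exact_mod_cast h2
    have hc : 0 ≤ 1 - θ / n := by
      rw [sub_nonneg, div_le_one hn0]; exact h3
    have h4 : g (n + 1) ≤ (1 - θ / n) * g n := by
      refine max_le ?_ (mul_nonneg hc (le_max_right _ _))
      have : (1 - θ / n) * (e n - K / θ) ≤ (1 - θ / n) * g n :=
        mul_le_mul_of_nonneg_left (le_max_left _ _) hc
      have h5 : (1 - θ / n) * (e n - K / θ) = (1 - θ / n) * e n + K / n - K / θ := by
        field_simp; ring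
      linarith
    have h6 : 1 - θ / n ≤ Real.exp (-(θ / n)) := by
      have := Real.add_one_le_exp (-(θ / n)); linarith
    have h7 : S (n + 1) = S n + 1 / n := Finset.sum_range_succ _ _
    calc g (n + 1) * Real.exp (θ * S (n + 1))
        ≤ (Real.exp (-(θ / n)) * g n) * Real.exp (θ * S (n + 1)) := by
          gcongr
          exact h4.trans (mul_le_mul_of_nonneg_right h6 (le_max_right _ _))
      _ = g n * (Real.exp (-(θ / n)) * Real.exp (θ * S (n + 1))) := by ring
      _ = g n * Real.exp (θ * S n) := by
          rw [← Real.exp_add, h7]; congr 2; ring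
  have hbd : ∀ n, N ≤ n → g n * Real.exp (θ * S n) ≤ g N * Real.exp (θ * S N) := by
    intro n hn
    induction n, hn using Nat.le_induction with
    | base => rfl
    | succ n hn ih => exact (hstep n hn).trans ih
  have hlim : Tendsto (fun n => g N * Real.exp (θ * S N) * Real.exp (-(θ * S n))) atTop (𝓝 0) := by
    simpa using ((Real.tendsto_exp_neg_atTop_nhds_zero.comp
      (hSt.const_mul_atTop hθ)).const_mul (g N * Real.exp (θ * S N)))
  filter_upwards [hlim.eventually (gt_mem_nhds hδ), eventually_ge_atTop N] with n h1 h2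
  have h3 := hbd n h2
  have h4 : g n ≤ g N * Real.exp (θ * S N) * Real.exp (-(θ * S n)) := by
    rw [Real.exp_neg, ← div_eq_mul_inv, le_div_iff₀ (Real.exp_pos _)]
    exact h3
  have : e n - K / θ ≤ g n := le_max_left _ _
  linarith

theorem tendsto_zero_of_harmonic_step {e : ℕ → ℝ} {θ : ℝ} (hθ : 0 < θ) (he : ∀ n, 0 ≤ e n)
    (h : ∀ ε > 0, ∀ᶠ n : ℕ in atTop, e (n + 1) ≤ (1 - θ / n) * e n + ε / n) :
    Tendsto e atTop (𝓝 0) := by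
  rw [Metric.tendsto_atTop]
  intro ε hε
  obtain ⟨N, hN⟩ := eventually_atTop.1 (eventually_le_of_harmonic_step hθ
    (h (ε / 3 * θ) (by positivity)) (show 0 < ε / 3 by linarith))
  refine ⟨N, fun n hn => ?_⟩
  have := hN n hn
  rw [mul_div_cancel_right₀ _ hθ.ne'] at this
  rw [Real.dist_eq, sub_zero, abs_of_nonneg (he n)]
  linarith

/-- The total memory weight of the times `1, …, n`. -/
def totalWeight (μ : ℕ → ℝ) (n : ℕ) : ℝ := ∑ j ∈ Finset.Icc 1 n, μ j

theorem totalWeight_pos {μ : ℕ → ℝ} (hμ : ∀ n, 1 ≤ n → 0 < μ n) {n : ℕ} (hn : 1 ≤ n) :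
    0 < totalWeight μ n :=
  Finset.sum_pos (fun k hk => hμ k (Finset.mem_Icc.1 hk).1) ⟨1, Finset.mem_Icc.2 ⟨le_rfl, hn⟩⟩

theorem totalWeight_succ (μ : ℕ → ℝ) (n : ℕ) :
    totalWeight μ (n + 1) = totalWeight μ n + μ (n + 1) := Finset.sum_Icc_succ_top (by omega) _

/-! ### Additive functionals of the clusters -/

section Pathwise

variable {Ω : Type*} {α : ℕ → Ω → ℝ} {β : ℕ → Ω → ℕ}

/-- The number of times up to `n` that belong to the cluster rooted at `j`. -/
noncomputable abbrev clusterSize (α : ℕ → Ω → ℝ) (β : ℕ → Ω → ℕ) (j n : ℕ) (ω : Ω) : ℝ :=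
  clusterWeight (fun _ => 1) α β j n ω

/-- An additive functional of the sizes and weights of the clusters. -/
noncomputable def clusterSum (μ : ℕ → ℝ) (α : ℕ → Ω → ℝ) (β : ℕ → Ω → ℕ) (Φ : ℝ → ℝ → ℝ) (n : ℕ)
    (ω : Ω) : ℝ :=
  ∑ j ∈ Finset.Icc 1 n, Φ (clusterSize α β j n ω) (clusterWeight μ α β j n ω)

/-- The condition Φ(0, 0) = 0 makes the cluster with index n + 1 contribute nothing when time n + 1
joins an older cluster. -/
theorem clusterSum_succ (μ : ℕ → ℝ) {Φ : ℝ → ℝ → ℝ} (hΦ : Φ 0 0 = 0) {n : ℕ} (hn : 1 ≤ n) (ω : Ω) :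
    clusterSum μ α β Φ (n + 1) ω = clusterSum μ α β Φ n ω + clusterIncrement α β n
      (fun j ω => Φ (clusterSize α β j n ω + 1) (clusterWeight μ α β j n ω + μ (n + 1)) -
        Φ (clusterSize α β j n ω) (clusterWeight μ α β j n ω)) (Φ 1 (μ (n + 1))) ω := by
  rw [clusterSum, Finset.sum_Icc_succ_top (by omega), clusterSum, clusterIncrement, ← add_assoc,
    ← Finset.sum_add_distrib]
  congr 1
  · refine Finset.sum_congr rfl fun j _ => ?_
    rw [clusterSize, clusterWeight_succ, clusterWeight_succ]
    rcases member_eq (α := α) (β := β) j ω (k := n + 1) (by omega) with h | h <;> simp [h]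
  · rw [clusterSize, clusterWeight_succ, clusterWeight_succ, clusterWeight_of_lt _ ω (by omega),
      clusterWeight_of_lt _ ω (by omega), member_self ω hn]
    rcases memInd_eq α (n + 1) ω with h | h <;> simp [h, hΦ]

theorem clusterIncrement_div (n : ℕ) (H : ℕ → Ω → ℝ) (c g : ℝ) (ω : Ω) :
    clusterIncrement α β n H c ω / g = clusterIncrement α β n (fun j ω => H j ω / g) (c / g) ω := by
  simp only [clusterIncrement, add_div, Finset.sum_div, mul_div_assoc]

theorem clusterDrift_div (p : ℝ) (μ : ℕ → ℝ) (n : ℕ) (H : ℕ → Ω → ℝ) (c g : ℝ) (ω : Ω) :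
    clusterDrift p μ α β n H c ω / g =
      clusterDrift p μ α β n (fun j ω => H j ω / g) (c / g) ω := by
  simp only [clusterDrift, add_div, mul_div_assoc, Finset.sum_div]

/-- The size of a cluster plus its rescaled weight. -/
noncomputable def clusterMass (μ : ℕ → ℝ) (α : ℕ → Ω → ℝ) (β : ℕ → Ω → ℕ) (l : ℝ) (j n : ℕ)
    (ω : Ω) : ℝ :=
  clusterSize α β j n ω + l * clusterWeight μ α β j n ω

theorem clusterMass_mem_boundedMeasurable (ξ : ℕ → Ω → ℝ) (μ : ℕ → ℝ) (l : ℝ) (j n : ℕ) :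
    clusterMass μ α β l j n ∈ boundedMeasurable (inputSigma ξ α β (pastLabels n)) :=
  Subalgebra.add_mem _ (clusterWeight_mem_boundedMeasurable ξ _ j n)
    (Subalgebra.smul_mem _ (clusterWeight_mem_boundedMeasurable ξ μ j n) l)

theorem clusterMass_nonneg {μ : ℕ → ℝ} (hμ : ∀ n, 1 ≤ n → 0 < μ n) {l : ℝ} (hl : 0 ≤ l) (j n : ℕ)
    (ω : Ω) : 0 ≤ clusterMass μ α β l j n ω :=
  add_nonneg (clusterWeight_nonneg (fun _ _ => zero_le_one) j n ω)
    (mul_nonneg hl (clusterWeight_nonneg (fun k hk => (hμ k hk).le) j n ω))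

theorem sum_pow_clusterMass_mem (ξ : ℕ → Ω → ℝ) (μ : ℕ → ℝ) (l : ℝ) (n r : ℕ) :
    (fun ω => ∑ j ∈ Finset.Icc 1 n, clusterMass μ α β l j n ω ^ r) ∈
      boundedMeasurable (inputSigma ξ α β (pastLabels n)) := by
  have : (fun ω => ∑ j ∈ Finset.Icc 1 n, clusterMass μ α β l j n ω ^ r) =
      ∑ j ∈ Finset.Icc 1 n, clusterMass μ α β l j n ^ r := by
    ext ω; simp
  rw [this]
  exact Subalgebra.sum_mem _ fun j _ =>
    Subalgebra.pow_mem _ (clusterMass_mem_boundedMeasurable ξ μ l j n) r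

end Pathwise

namespace IsRWInput

variable {Ω : Type*} [mΩ : MeasurableSpace Ω] {P : Measure Ω} [IsProbabilityMeasure P]
  {p : ℝ} {μ : ℕ → ℝ} {ξ α : ℕ → Ω → ℝ} {β : ℕ → Ω → ℕ}

/-- One step of the power sums of the cluster masses, in expectation. -/
theorem integral_sum_pow_clusterMass_succ (h : IsRWInput P p μ ξ α β)
    (hμ : ∀ n, 1 ≤ n → 0 < μ n) {n : ℕ} (hn : 1 ≤ n) (l : ℝ) {r : ℕ} (hr : r ≠ 0) :
    ∫ ω, ∑ j ∈ Finset.Icc 1 (n + 1), clusterMass μ α β l j (n + 1) ω ^ r ∂P =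
      ∫ ω, ∑ j ∈ Finset.Icc 1 n, clusterMass μ α β l j n ω ^ r +
        (p / totalWeight μ n * ∑ j ∈ Finset.Icc 1 n, clusterWeight μ α β j n ω *
          ((clusterMass μ α β l j n ω + (1 + l * μ (n + 1))) ^ r - clusterMass μ α β l j n ω ^ r) +
          (1 - p) * (1 + l * μ (n + 1)) ^ r) ∂P := by
  have hΦ : (fun x y : ℝ => (x + l * y) ^ r) 0 0 = 0 := by simp [hr]
  set H : ℕ → Ω → ℝ := fun j ω => (clusterMass μ α β l j n ω + (1 + l * μ (n + 1))) ^ r -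
    clusterMass μ α β l j n ω ^ r with hHdef
  have hH : ∀ j ∈ Finset.Icc 1 n, H j ∈ boundedMeasurable (inputSigma ξ α β (pastLabels n)) :=
    fun j _ => Subalgebra.sub_mem _ (Subalgebra.pow_mem _ (Subalgebra.add_mem _
      (clusterMass_mem_boundedMeasurable ξ μ l j n) (const_mem_boundedMeasurable _)) r)
      (Subalgebra.pow_mem _ (clusterMass_mem_boundedMeasurable ξ μ l j n) r)
  have e1 : ∀ ω, ∑ j ∈ Finset.Icc 1 (n + 1), clusterMass μ α β l j (n + 1) ω ^ r =
      ∑ j ∈ Finset.Icc 1 n, clusterMass μ α β l j n ω ^ r +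
        clusterIncrement α β n H ((1 + l * μ (n + 1)) ^ r) ω := fun ω => by
    have := clusterSum_succ (α := α) (β := β) μ (Φ := fun x y => (x + l * y) ^ r) hΦ hn ω
    have e : (fun j ω => (clusterSize α β j n ω + 1 +
        l * (clusterWeight μ α β j n ω + μ (n + 1))) ^ r -
        (clusterSize α β j n ω + l * clusterWeight μ α β j n ω) ^ r) = H := by
      ext j ω
      simp only [hHdef, clusterMass]
      ring
    rw [e] at this
    exact this
  have i1 := h.integrable_of_past (sum_pow_clusterMass_mem (α := α) (β := β) ξ μ l n r)
  have hI := clusterIncrement_mem ξ hn ((1 + l * μ (n + 1)) ^ r) hH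
  have hD := clusterDrift_mem (p := p) (μ := μ) ξ ((1 + l * μ (n + 1)) ^ r) hH
  have key := h.integral_mul_clusterIncrement hμ hn (const_mem_boundedMeasurable 1)
    ((1 + l * μ (n + 1)) ^ r) hH
  simp only [one_mul] at key
  simp only [e1]
  rw [integral_add i1 (h.integrable_of_past hI), key, ← integral_add i1 (h.integrable_of_past hD)]
  rfl

end IsRWInput

/-! ### Growth of the cluster masses and the third moment -/

section Scalar

variable {μ : ℕ → ℝ} {κ : ℝ}

theorem tendsto_totalWeight_ratio (hμ : ∀ n, 1 ≤ n → 0 < μ n)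
    (hκ : Tendsto (fun n : ℕ => n * μ (n + 1) / totalWeight μ n) atTop (𝓝 κ)) :
    Tendsto (fun n : ℕ => totalWeight μ (n + 1) / totalWeight μ n) atTop (𝓝 1) := by
  have h := (hκ.mul (tendsto_inv_atTop_nhds_zero_nat (𝕜 := ℝ))).const_add 1
  rw [mul_zero, add_zero] at h
  refine h.congr' ?_
  filter_upwards [eventually_ge_atTop 1] with n hn
  have hn0 : (n : ℝ) ≠ 0 := by positivity
  have := (totalWeight_pos hμ hn).ne'
  rw [totalWeight_succ]
  field_simp

theorem tendsto_succ_div_nat : Tendsto (fun n : ℕ => ((n : ℝ) + 1) / n) atTop (𝓝 1) := by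
  have h := (tendsto_inv_atTop_nhds_zero_nat (𝕜 := ℝ)).const_add 1
  rw [add_zero] at h
  refine h.congr' ?_
  filter_upwards [eventually_ge_atTop 1] with n hn
  have hn0 : (n : ℝ) ≠ 0 := by positivity
  field_simp

theorem tendsto_weight_succ_ratio (hμ : ∀ n, 1 ≤ n → 0 < μ n)
    (hκ : Tendsto (fun n : ℕ => n * μ (n + 1) / totalWeight μ n) atTop (𝓝 κ)) :
    Tendsto (fun n : ℕ => ((n : ℝ) + 1) / totalWeight μ (n + 1) * μ (n + 1)) atTop (𝓝 κ) := by
  have h := (tendsto_succ_div_nat.mul hκ).div (tendsto_totalWeight_ratio hμ hκ) one_ne_zero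
  rw [one_mul, div_one] at h
  refine h.congr' ?_
  filter_upwards [eventually_ge_atTop 1] with n hn
  have hn0 : (n : ℝ) ≠ 0 := by positivity
  have := (totalWeight_pos hμ hn).ne'
  have := (totalWeight_pos hμ (Nat.le_succ_of_le hn)).ne'
  simp only [Pi.div_apply]
  field_simp

/-- The cluster masses grow at rate at most `c` in mean, for a suitable weight factor `L`. -/
theorem exists_mass_growth (hμ : ∀ n, 1 ≤ n → 0 < μ n)
    (hκ : Tendsto (fun n : ℕ => n * μ (n + 1) / totalWeight μ n) atTop (𝓝 κ)) {p : ℝ} (hp : p * κ < κ - 1 / 2) :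
    ∃ L c H : ℝ, 1 ≤ L ∧ 0 < c ∧ c < 1 / 2 ∧ 1 ≤ H ∧ ∀ᶠ n : ℕ in atTop,
      1 + L * (n + 1) / totalWeight μ (n + 1) * μ (n + 1) ≤ H ∧
      L * (n + 1) / totalWeight μ (n + 1) + p / totalWeight μ n *
        (1 + L * (n + 1) / totalWeight μ (n + 1) * μ (n + 1)) ≤
          (1 + c / n) * (L * n / totalWeight μ n) := by
  -- Multiplied by M_n, the second inequality becomes Ls + p < cL in the limit. The hypothesis on p
  -- is s < 1/2, so c fits between max(s, 0) and 1/2, and L is then chosen so large that L(c - s)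
  -- exceeds p.
  set s := 1 - κ + p * κ with hs
  set c := (max s 0 + 1 / 2) / 2 with hc
  have hs2 : max s 0 < 1 / 2 := max_lt (by linarith) (by norm_num)
  have hs0 : 0 ≤ max s 0 := le_max_right _ _
  have hss : s ≤ max s 0 := le_max_left _ _
  have hcs : 0 < c - s := by linarith
  set L := max 1 ((p + 1) / (c - s)) with hL
  have hL1 : 1 ≤ L := le_max_left _ _
  have hLp : p + 1 ≤ L * (c - s) := by
    rw [← div_le_iff₀ hcs]; exact le_max_right _ _
  have hh : Tendsto (fun n : ℕ => 1 + L * ((n : ℝ) + 1) / totalWeight μ (n + 1) * μ (n + 1)) atTop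
      (𝓝 (1 + L * κ)) := by
    refine (((tendsto_weight_succ_ratio hμ hκ).const_mul L).const_add 1).congr fun n => ?_
    ring
  have hdiff : Tendsto (fun n : ℕ => L * ((1 - n * μ (n + 1) / totalWeight μ n) /
      (totalWeight μ (n + 1) / totalWeight μ n)) +
      p * (1 + L * ((n : ℝ) + 1) / totalWeight μ (n + 1) * μ (n + 1))) atTop
      (𝓝 (L * ((1 - κ) / 1) + p * (1 + L * κ))) :=
    (((hκ.const_sub 1).div (tendsto_totalWeight_ratio hμ hκ) one_ne_zero).const_mul L).add
      (hh.const_mul p)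
  have hlt : L * ((1 - κ) / 1) + p * (1 + L * κ) < c * L := by
    have : L * ((1 - κ) / 1) + p * (1 + L * κ) = L * s + p := by rw [hs]; ring
    rw [this]; linarith
  refine ⟨L, c, max 1 (1 + L * κ + 1), hL1, by linarith, by linarith, le_max_left _ _, ?_⟩
  filter_upwards [hh.eventually (gt_mem_nhds (show 1 + L * κ < 1 + L * κ + 1 by linarith)),
    hdiff.eventually (gt_mem_nhds hlt), eventually_ge_atTop 1] with n h1 h2 hn
  refine ⟨h1.le.trans (le_max_right _ _), ?_⟩
  have hn0 : (0 : ℝ) < n := by positivity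
  have hM := totalWeight_pos hμ hn
  have hM' := totalWeight_pos hμ (Nat.le_succ_of_le hn)
  have hM2 : μ (n + 1) = totalWeight μ (n + 1) - totalWeight μ n := by
    rw [totalWeight_succ]; ring
  have e1 : L * ((1 - n * μ (n + 1) / totalWeight μ n) /
      (totalWeight μ (n + 1) / totalWeight μ n)) =
      L * (n + 1) / totalWeight μ (n + 1) * totalWeight μ n - L * n := by
    rw [hM2]; field_simp; ring
  rw [e1] at h2
  have e2 : (1 + c / n) * (L * n / totalWeight μ n) = (L * n + c * L) / totalWeight μ n := by
    field_simp
  rw [e2, le_div_iff₀ hM, add_mul]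
  have e3 : ∀ x : ℝ, p / totalWeight μ n * x * totalWeight μ n = p * x := fun x => by
    field_simp
  rw [e3]
  linarith

/-- Recursions for the second and third moments force the third moment to be negligible. -/
theorem tendsto_third_moment {Q2 Q3 : ℕ → ℝ} {c H : ℝ} (hc0 : 0 < c) (hc : c < 1 / 2) (hH : 1 ≤ H)
    (hQ2 : ∀ n, 1 ≤ n → 0 ≤ Q2 n) (hQ3 : ∀ n, 1 ≤ n → 0 ≤ Q3 n)
    (hstep : ∀ᶠ n : ℕ in atTop, Q2 (n + 1) ≤ (1 + c / n) ^ 2 * Q2 n + H ^ 2 ∧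
      Q3 (n + 1) ≤ (1 + c / n) ^ 3 * Q3 n + 6 * H ^ 2 * (Q2 n / n) + H ^ 3) :
    Tendsto (fun n : ℕ => |Q3 n| / (n * √n)) atTop (𝓝 0) := by
  -- The factor n/(n+1)·(1 + c/n)² is 1 - (1 - 2c)/n up to O(1/n²); half of the rate is given up to
  -- absorb the remainder.
  set θ := (1 - 2 * c) / 2 with hθ
  have hθ0 : 0 < θ := by linarith
  have hcoef : ∀ᶠ n : ℕ in atTop, (n : ℝ) / (n + 1) * (1 + c / n) ^ 2 ≤ 1 - θ / n := by
    obtain ⟨N, hN⟩ := exists_nat_gt (4 / θ)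
    filter_upwards [eventually_ge_atTop (N + 1)] with n hn
    have hn0 : (0 : ℝ) < n := by exact_mod_cast (by omega : 0 < n)
    have hNn : (N : ℝ) ≤ n := by exact_mod_cast (by omega : N ≤ n)
    have h4 : 4 < n * θ := by
      have := hN.trans_le hNn
      rwa [div_lt_iff₀ hθ0] at this
    have e : (n : ℝ) / (n + 1) * (1 + c / n) ^ 2 = (n + c) ^ 2 / (n * (n + 1)) := by field_simp
    have e' : 1 - θ / n = (n - θ) * (n + 1) / (n * (n + 1)) := by field_simp
    rw [e, e', div_le_div_iff_of_pos_right (by positivity)]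
    nlinarith
  have hq2 : ∃ K : ℝ, 0 ≤ K ∧ ∀ᶠ n : ℕ in atTop, Q2 n / n ≤ K := by
    refine ⟨H ^ 2 / θ + 1, by positivity, eventually_le_of_harmonic_step (e := fun n => Q2 n / n)
      hθ0 (K := H ^ 2) ?_ one_pos⟩
    filter_upwards [hstep, hcoef, eventually_ge_atTop 1] with n h1 h2 hn
    have hn0 : (0 : ℝ) < n := by positivity
    have hq := div_nonneg (hQ2 n hn) hn0.le
    push_cast
    calc Q2 (n + 1) / ((n : ℝ) + 1) ≤ ((1 + c / n) ^ 2 * Q2 n + H ^ 2) / ((n : ℝ) + 1) := by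
          gcongr; exact h1.1
      _ = (n : ℝ) / (n + 1) * (1 + c / n) ^ 2 * (Q2 n / n) + H ^ 2 / ((n : ℝ) + 1) := by
          field_simp
      _ ≤ (1 - θ / n) * (Q2 n / n) + H ^ 2 / n := by
          gcongr
          linarith
  obtain ⟨K, hK0, hK⟩ := hq2
  set K' := 6 * H ^ 2 * K + H ^ 3 with hK'
  have hK'0 : 0 ≤ K' := by positivity
  -- Normalizing by n^{3/2} gives the contraction factor x√x ≤ x, where x is the factor of the
  -- second moment. The forcing is O(n^{-3/2}), because Q2 = O(n), and so at most ε/n eventually.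
  -- The absolute value is there because `Q3 0` has no prescribed sign.
  refine tendsto_zero_of_harmonic_step hθ0 (fun n => by positivity) fun ε hε => ?_
  have hsq : Tendsto (fun n : ℕ => √(n : ℝ)) atTop atTop :=
    Real.tendsto_sqrt_atTop.comp tendsto_natCast_atTop_atTop
  filter_upwards [hstep, hcoef, eventually_ge_atTop 1, hK,
    hsq.eventually (eventually_ge_atTop (K' / ε)),
    tendsto_natCast_atTop_atTop.eventually (eventually_ge_atTop θ)] with n h1 h2 hn h3 h4 h5
  have hn0 : (0 : ℝ) < n := by positivity
  rw [abs_of_nonneg (hQ3 n hn), abs_of_nonneg (hQ3 (n + 1) (by omega))]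
  have hx0 : 0 ≤ (n : ℝ) / (n + 1) * (1 + c / n) ^ 2 := by positivity
  have hθn : 0 ≤ θ / n := by positivity
  have hsx : √((n : ℝ) / (n + 1) * (1 + c / n) ^ 2) ≤ 1 :=
    (Real.sqrt_le_sqrt (by linarith)).trans_eq Real.sqrt_one
  have e1 : √((n : ℝ) / (n + 1) * (1 + c / n) ^ 2) = √n / √(n + 1) * (1 + c / n) := by
    rw [Real.sqrt_mul (by positivity), Real.sqrt_div hn0.le, Real.sqrt_sq (by positivity)]
  have hs0 : 0 < √(n : ℝ) := Real.sqrt_pos.2 hn0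
  have hs1 : 0 < √((n : ℝ) + 1) := Real.sqrt_pos.2 (by positivity)
  have hss : √(n : ℝ) ≤ √((n : ℝ) + 1) := Real.sqrt_le_sqrt (by linarith)
  have hq := div_nonneg (hQ3 n hn) (mul_pos hn0 hs0).le
  have h6 : Q3 (n + 1) ≤ (1 + c / n) ^ 3 * Q3 n + K' := by
    have := mul_le_mul_of_nonneg_left h3 (show 0 ≤ 6 * H ^ 2 by positivity)
    linarith [h1.2]
  have h7 : K' ≤ ε * √n := by
    rw [div_le_iff₀ hε] at h4; linarith
  push_cast
  calc Q3 (n + 1) / (((n : ℝ) + 1) * √((n : ℝ) + 1))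
      ≤ ((1 + c / n) ^ 3 * Q3 n + K') / (((n : ℝ) + 1) * √((n : ℝ) + 1)) := by gcongr
    _ = ((n : ℝ) / (n + 1) * (1 + c / n) ^ 2) * √((n : ℝ) / (n + 1) * (1 + c / n) ^ 2) *
          (Q3 n / (n * √n)) + K' / (((n : ℝ) + 1) * √((n : ℝ) + 1)) := by
        rw [e1]; field_simp
    _ ≤ (1 - θ / n) * (Q3 n / (n * √n)) + ε * √n / (n * √n) := by
        gcongr
        · exact (mul_le_of_le_one_right hx0 hsx).trans h2
        · linarith
    _ = _ := by field_simp

end Scalar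

namespace IsRWInput

variable {Ω : Type*} [mΩ : MeasurableSpace Ω] {P : Measure Ω} [IsProbabilityMeasure P]
  {p : ℝ} {μ : ℕ → ℝ} {ξ α : ℕ → Ω → ℝ} {β : ℕ → Ω → ℕ} {κ : ℝ}

set_option maxHeartbeats 1000000 in
/-- One step of the second and third moment sums of the cluster masses. -/
theorem moment_step (h : IsRWInput P p μ ξ α β) (hμ : ∀ n, 1 ≤ n → 0 < μ n)
    (hp0 : 0 ≤ p) (hp1 : p ≤ 1) {L c H : ℝ} (hL : 1 ≤ L) (hc0 : 0 < c) (hc : c < 1 / 2) {l : ℕ → ℝ}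
    (hl : l = fun n : ℕ => L * n / totalWeight μ n) {n : ℕ} (hn1 : 1 ≤ n)
    (hnH : 1 + L * (n + 1) / totalWeight μ (n + 1) * μ (n + 1) ≤ H)
    (hng : L * (n + 1) / totalWeight μ (n + 1) + p / totalWeight μ n *
        (1 + L * (n + 1) / totalWeight μ (n + 1) * μ (n + 1)) ≤
          (1 + c / n) * (L * n / totalWeight μ n)) :
    ∫ ω, ∑ j ∈ Finset.Icc 1 (n + 1), clusterMass μ α β (l (n + 1)) j (n + 1) ω ^ 2 ∂P ≤
        (1 + c / n) ^ 2 * ∫ ω, ∑ j ∈ Finset.Icc 1 n, clusterMass μ α β (l n) j n ω ^ 2 ∂P + H ^ 2 ∧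
      ∫ ω, ∑ j ∈ Finset.Icc 1 (n + 1), clusterMass μ α β (l (n + 1)) j (n + 1) ω ^ 3 ∂P ≤
        (1 + c / n) ^ 3 * ∫ ω, ∑ j ∈ Finset.Icc 1 n, clusterMass μ α β (l n) j n ω ^ 3 ∂P +
        6 * H ^ 2 * ((∫ ω, ∑ j ∈ Finset.Icc 1 n, clusterMass μ α β (l n) j n ω ^ 2 ∂P) / n) +
        H ^ 3 := by
  have hl0 : ∀ n, 1 ≤ n → 0 ≤ l n := fun n hn => by
    have := totalWeight_pos hμ hn
    simp only [hl]; positivity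
  have hint : ∀ (r n : ℕ) (x : ℝ),
      Integrable (fun ω => ∑ j ∈ Finset.Icc 1 n, clusterMass μ α β x j n ω ^ r) P := fun r n x =>
    h.integrable_of_past (sum_pow_clusterMass_mem ξ μ x n r)
  have hn0 : (0 : ℝ) < n := by positivity
  have hn1' : (1 : ℝ) ≤ n := by exact_mod_cast hn1
  have hM := totalWeight_pos hμ hn1
  have hl' : l (n + 1) = L * (n + 1) / totalWeight μ (n + 1) := by simp [hl]
  rw [← hl'] at hnH hng
  set d := 1 + l (n + 1) * μ (n + 1) with hd
  have hd0 : 0 ≤ d := by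
    have := mul_nonneg (hl0 (n + 1) (by omega)) (hμ (n + 1) (by omega)).le
    linarith
  set s := 1 + c / n with hs
  have hs1 : 1 ≤ s := by have : 0 ≤ c / n := by positivity
                         linarith
  have hs2 : s ≤ 2 := by
    have : c / n ≤ 1 := by rw [div_le_one hn0]; linarith
    linarith
  have hW : ∀ j ω, 0 ≤ clusterWeight μ α β j n ω := fun j ω =>
    clusterWeight_nonneg (fun k hk => (hμ k hk).le) j n ω
  have hN : ∀ j ω, 0 ≤ clusterSize α β j n ω := fun j ω =>
    clusterWeight_nonneg (fun k hk => zero_le_one) j n ω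
  have hq : 0 ≤ p / totalWeight μ n := by positivity
  have hY0 : ∀ j ω, 0 ≤ clusterMass μ α β (l (n + 1)) j n ω := fun j ω =>
    clusterMass_nonneg hμ (hl0 _ (by omega)) j n ω
  -- The mass with the updated weight factor plus its mean gain: the weight part is the growth
  -- hypothesis times W_j, the size part uses only s ≥ 1.
  have hYs : ∀ j ω, clusterMass μ α β (l (n + 1)) j n ω +
      p / totalWeight μ n * d * clusterWeight μ α β j n ω ≤ s * clusterMass μ α β (l n) j n ω := by
    intro j ω
    have h1 := mul_le_mul_of_nonneg_right hng (hW j ω)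
    have h2 := mul_le_mul_of_nonneg_right hs1 (hN j ω)
    simp only [clusterMass]
    have e : s * (L * n / totalWeight μ n) * clusterWeight μ α β j n ω =
      s * (l n * clusterWeight μ α β j n ω) := by simp only [hl]; ring
    rw [e] at h1
    nlinarith
  have hqW : ∀ j ω, 0 ≤ p / totalWeight μ n * clusterWeight μ α β j n ω := fun j ω =>
    mul_nonneg hq (hW j ω)
  have hqdW : ∀ j ω, 0 ≤ p / totalWeight μ n * d * clusterWeight μ α β j n ω := fun j ω =>
    mul_nonneg (mul_nonneg hq hd0) (hW j ω)
  have hsumW : ∀ ω, p / totalWeight μ n * ∑ j ∈ Finset.Icc 1 n, clusterWeight μ α β j n ω = p :=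
    fun ω => by
      rw [sum_clusterWeight]
      exact div_mul_cancel₀ _ hM.ne'
  have hWY : ∀ j ω, p / totalWeight μ n * clusterWeight μ α β j n ω ≤
      clusterMass μ α β (l n) j n ω / n := fun j ω => by
    have e1 : p / totalWeight μ n * clusterWeight μ α β j n ω * n =
      p * (n / totalWeight μ n * clusterWeight μ α β j n ω) := by ring
    have h0 : 0 ≤ n / totalWeight μ n * clusterWeight μ α β j n ω :=
      mul_nonneg (by positivity) (hW j ω)
    rw [le_div_iff₀ hn0, e1, clusterMass]
    have h1 : p * (n / totalWeight μ n * clusterWeight μ α β j n ω) ≤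
      n / totalWeight μ n * clusterWeight μ α β j n ω := mul_le_of_le_one_left h0 hp1
    have h2 : n / totalWeight μ n * clusterWeight μ α β j n ω ≤
        L * (n / totalWeight μ n * clusterWeight μ α β j n ω) := le_mul_of_one_le_left h0 hL
    have h3 : l n * clusterWeight μ α β j n ω =
      L * (n / totalWeight μ n * clusterWeight μ α β j n ω) := by simp only [hl]; ring
    rw [h3]
    linarith [hN j ω]
  constructor
  · have := h.integral_sum_pow_clusterMass_succ hμ hn1 (l (n + 1)) (r := 2) (by norm_num)
    rw [this, ← integral_const_mul]
    have hb : ∫ ω, (s ^ 2 * ∑ j ∈ Finset.Icc 1 n, clusterMass μ α β (l n) j n ω ^ 2 + H ^ 2) ∂P =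
        ∫ ω, s ^ 2 * ∑ j ∈ Finset.Icc 1 n, clusterMass μ α β (l n) j n ω ^ 2 ∂P + H ^ 2 := by
      rw [integral_add ((hint 2 n (l n)).const_mul _) (integrable_const _)]; simp
    rw [← hb]
    refine integral_mono_of_nonneg (Eventually.of_forall fun ω => ?_)
      (((hint 2 n (l n)).const_mul _).add (integrable_const _)) (Eventually.of_forall fun ω => ?_)
    · refine add_nonneg (Finset.sum_nonneg fun j _ => sq_nonneg _) (add_nonneg (mul_nonneg hq
        (Finset.sum_nonneg fun j _ => mul_nonneg (hW j ω) ?_))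
        (mul_nonneg (by linarith) (sq_nonneg _)))
      rw [sub_nonneg]
      exact pow_le_pow_left₀ (hY0 j ω) (by linarith) 2
    · have e1 : ∑ j ∈ Finset.Icc 1 n, clusterMass μ α β (l (n + 1)) j n ω ^ 2 +
          (p / totalWeight μ n * ∑ j ∈ Finset.Icc 1 n, clusterWeight μ α β j n ω *
            ((clusterMass μ α β (l (n + 1)) j n ω + d) ^ 2 -
              clusterMass μ α β (l (n + 1)) j n ω ^ 2) + (1 - p) * d ^ 2) =
          ∑ j ∈ Finset.Icc 1 n, (clusterMass μ α β (l (n + 1)) j n ω ^ 2 +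
            2 * clusterMass μ α β (l (n + 1)) j n ω *
              (p / totalWeight μ n * d * clusterWeight μ α β j n ω)) +
          (p / totalWeight μ n * ∑ j ∈ Finset.Icc 1 n, clusterWeight μ α β j n ω) * d ^ 2 +
          (1 - p) * d ^ 2 := by
        rw [Finset.mul_sum, Finset.mul_sum, Finset.sum_mul, ← add_assoc,
          ← Finset.sum_add_distrib, ← Finset.sum_add_distrib]
        congr 1
        exact Finset.sum_congr rfl fun j _ => by ring
      -- These are the leading terms of (Y_j + mean gain)², whose last term is nonnegative. The
      -- remaining terms total p d² + (1 - p) d² = d², because the cluster weights add up to M_n.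
      have e2 : ∑ j ∈ Finset.Icc 1 n, (clusterMass μ α β (l (n + 1)) j n ω ^ 2 +
            2 * clusterMass μ α β (l (n + 1)) j n ω *
              (p / totalWeight μ n * d * clusterWeight μ α β j n ω)) ≤
          s ^ 2 * ∑ j ∈ Finset.Icc 1 n, clusterMass μ α β (l n) j n ω ^ 2 := by
        rw [Finset.mul_sum]
        refine Finset.sum_le_sum fun j _ => ?_
        have := pow_le_pow_left₀ (add_nonneg (hY0 j ω) (hqdW j ω)) (hYs j ω) 2
        nlinarith [sq_nonneg (p / totalWeight μ n * d * clusterWeight μ α β j n ω)]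
      have e3 : d ^ 2 ≤ H ^ 2 := pow_le_pow_left₀ hd0 hnH 2
      simp only [← hd]
      rw [e1, hsumW]
      linarith
  · have := h.integral_sum_pow_clusterMass_succ hμ hn1 (l (n + 1)) (r := 3) (by norm_num)
    have hi2 := ((hint 2 n (l n)).const_mul (6 * H ^ 2 / n))
    have hi3 := ((hint 3 n (l n)).const_mul (s ^ 3))
    have hb : ∫ ω, (s ^ 3 * ∑ j ∈ Finset.Icc 1 n, clusterMass μ α β (l n) j n ω ^ 3 +
          6 * H ^ 2 / n * ∑ j ∈ Finset.Icc 1 n, clusterMass μ α β (l n) j n ω ^ 2 + H ^ 3) ∂P =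
        s ^ 3 * ∫ ω, ∑ j ∈ Finset.Icc 1 n, clusterMass μ α β (l n) j n ω ^ 3 ∂P +
        6 * H ^ 2 * ((∫ ω, ∑ j ∈ Finset.Icc 1 n, clusterMass μ α β (l n) j n ω ^ 2 ∂P) / n) +
        H ^ 3 := by
      have hi32 : Integrable (fun ω => s ^ 3 * ∑ j ∈ Finset.Icc 1 n, clusterMass μ α β (l n) j n ω ^ 3 +
          6 * H ^ 2 / n * ∑ j ∈ Finset.Icc 1 n, clusterMass μ α β (l n) j n ω ^ 2) P := hi3.add hi2
      rw [integral_add hi32 (integrable_const _), integral_add hi3 hi2,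
        integral_const_mul, integral_const_mul]
      simp only [integral_const, probReal_univ, one_smul]
      ring
    rw [this, ← hb]
    refine integral_mono_of_nonneg (Eventually.of_forall fun ω => ?_)
      ((hi3.add hi2).add (integrable_const _)) (Eventually.of_forall fun ω => ?_)
    · refine add_nonneg (Finset.sum_nonneg fun j _ => pow_nonneg (hY0 j ω) 3) (add_nonneg
        (mul_nonneg hq (Finset.sum_nonneg fun j _ => mul_nonneg (hW j ω) ?_))
        (mul_nonneg (by linarith) (pow_nonneg hd0 3)))
      rw [sub_nonneg]
      exact pow_le_pow_left₀ (hY0 j ω) (by linarith) 3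
    · have e1 : ∑ j ∈ Finset.Icc 1 n, clusterMass μ α β (l (n + 1)) j n ω ^ 3 +
          (p / totalWeight μ n * ∑ j ∈ Finset.Icc 1 n, clusterWeight μ α β j n ω *
            ((clusterMass μ α β (l (n + 1)) j n ω + d) ^ 3 -
              clusterMass μ α β (l (n + 1)) j n ω ^ 3) + (1 - p) * d ^ 3) =
          ∑ j ∈ Finset.Icc 1 n, (clusterMass μ α β (l (n + 1)) j n ω ^ 3 +
            3 * clusterMass μ α β (l (n + 1)) j n ω ^ 2 *
              (p / totalWeight μ n * d * clusterWeight μ α β j n ω)) +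
          ∑ j ∈ Finset.Icc 1 n, 3 * d ^ 2 * (clusterMass μ α β (l (n + 1)) j n ω *
              (p / totalWeight μ n * clusterWeight μ α β j n ω)) +
          (p / totalWeight μ n * ∑ j ∈ Finset.Icc 1 n, clusterWeight μ α β j n ω) * d ^ 3 +
          (1 - p) * d ^ 3 := by
        rw [Finset.mul_sum, Finset.mul_sum, Finset.sum_mul, ← add_assoc,
          ← Finset.sum_add_distrib, ← Finset.sum_add_distrib, ← Finset.sum_add_distrib]
        congr 1
        exact Finset.sum_congr rfl fun j _ => by ring
      have e2 : ∑ j ∈ Finset.Icc 1 n, (clusterMass μ α β (l (n + 1)) j n ω ^ 3 +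
            3 * clusterMass μ α β (l (n + 1)) j n ω ^ 2 *
              (p / totalWeight μ n * d * clusterWeight μ α β j n ω)) ≤
          s ^ 3 * ∑ j ∈ Finset.Icc 1 n, clusterMass μ α β (l n) j n ω ^ 3 := by
        rw [Finset.mul_sum]
        refine Finset.sum_le_sum fun j _ => ?_
        have h1 := pow_le_pow_left₀ (add_nonneg (hY0 j ω) (hqdW j ω)) (hYs j ω) 3
        rw [mul_pow] at h1
        refine le_trans ?_ h1
        have a0 := hY0 j ω
        have b0 := hqdW j ω
        have h2 : 0 ≤ 3 * clusterMass μ α β (l (n + 1)) j n ω *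
          (p / totalWeight μ n * d * clusterWeight μ α β j n ω) ^ 2 +
          (p / totalWeight μ n * d * clusterWeight μ α β j n ω) ^ 3 := by positivity
        have h3 : ∀ a b : ℝ, (a + b) ^ 3 = a ^ 3 + 3 * a ^ 2 * b + (3 * a * b ^ 2 + b ^ 3) :=
          fun a b => by ring
        rw [h3]
        linarith
      have e3 : d ^ 3 ≤ H ^ 3 := pow_le_pow_left₀ hd0 hnH 3
      -- The term linear in Y_j is not part of the contraction. The bounds Y_j ≤ 2V_j and pW_j/M_n ≤
      -- V_j/n turn it into the second moment divided by n.
      have e4 : ∑ j ∈ Finset.Icc 1 n, 3 * d ^ 2 * (clusterMass μ α β (l (n + 1)) j n ω *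
              (p / totalWeight μ n * clusterWeight μ α β j n ω)) ≤
          6 * H ^ 2 / n * ∑ j ∈ Finset.Icc 1 n, clusterMass μ α β (l n) j n ω ^ 2 := by
        rw [Finset.mul_sum]
        refine Finset.sum_le_sum fun j _ => ?_
        have y0 := clusterMass_nonneg (α := α) (β := β) hμ (hl0 n hn1) j n ω
        have h1 : clusterMass μ α β (l (n + 1)) j n ω ≤ 2 * clusterMass μ α β (l n) j n ω := by
          have := mul_le_mul_of_nonneg_right hs2 y0
          linarith [hYs j ω, hqdW j ω]
        have h2 := mul_le_mul h1 (hWY j ω) (hqW j ω) (by linarith)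
        have h3 : d ^ 2 ≤ H ^ 2 := pow_le_pow_left₀ hd0 hnH 2
        calc _ ≤ 3 * H ^ 2 * (2 * clusterMass μ α β (l n) j n ω *
              (clusterMass μ α β (l n) j n ω / n)) :=
              mul_le_mul (by linarith) h2 (mul_nonneg (hY0 j ω) (hqW j ω)) (by positivity)
          _ = _ := by ring
      simp only [← hd]
      rw [e1, hsumW]
      linarith

/-- The third moment sum of the cluster masses is negligible. -/
theorem tendsto_third_moment_clusterMass (h : IsRWInput P p μ ξ α β) (hμ : ∀ n, 1 ≤ n → 0 < μ n)
    (hκ : Tendsto (fun n : ℕ => n * μ (n + 1) / totalWeight μ n) atTop (𝓝 κ))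
    (hp0 : 0 ≤ p) (hp1 : p ≤ 1) (hp : p * κ < κ - 1 / 2) :
    Tendsto (fun n : ℕ => (∫ ω, ∑ j ∈ Finset.Icc 1 n,
      clusterMass μ α β (n / totalWeight μ n) j n ω ^ 3 ∂P) / (n * √n)) atTop (𝓝 0) := by
  obtain ⟨L, c, H, hL, hc0, hc, hH, hev⟩ := exists_mass_growth hμ hκ hp
  set l : ℕ → ℝ := fun n => L * n / totalWeight μ n with hl
  set Q : ℕ → ℕ → ℝ := fun r n =>
    ∫ ω, ∑ j ∈ Finset.Icc 1 n, clusterMass μ α β (l n) j n ω ^ r ∂P with hQ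
  have hl0 : ∀ n, 1 ≤ n → 0 ≤ l n := fun n hn => by
    have := totalWeight_pos hμ hn
    simp only [hl]; positivity
  have hint : ∀ (r n : ℕ) (x : ℝ),
      Integrable (fun ω => ∑ j ∈ Finset.Icc 1 n, clusterMass μ α β x j n ω ^ r) P := fun r n x =>
    h.integrable_of_past (sum_pow_clusterMass_mem ξ μ x n r)
  have hQ0 : ∀ r n, 1 ≤ n → 0 ≤ Q r n := fun r n hn => integral_nonneg fun ω =>
    Finset.sum_nonneg fun j _ => pow_nonneg (clusterMass_nonneg hμ (hl0 n hn) j n ω) r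
  have hq3 := tendsto_third_moment hc0 hc hH (hQ0 2) (hQ0 3) (by
    filter_upwards [hev, eventually_ge_atTop 1] with n hn hn1
    exact h.moment_step hμ hp0 hp1 hL hc0 hc hl hn1 hn.1 hn.2)
  -- Since L ≥ 1, the masses with weight factor Ln/M_n dominate those in the claim.
  refine squeeze_zero' ?_ ?_ hq3
  · filter_upwards [eventually_ge_atTop 1] with n hn
    have := totalWeight_pos hμ hn
    exact div_nonneg (integral_nonneg fun ω => Finset.sum_nonneg fun j _ =>
      pow_nonneg (clusterMass_nonneg hμ (by positivity) j n ω) 3) (by positivity)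
  · filter_upwards [eventually_ge_atTop 1] with n hn
    have hM := totalWeight_pos hμ hn
    rw [abs_of_nonneg (hQ0 3 n hn)]
    gcongr
    refine integral_mono (hint 3 n _) (hint 3 n _) fun ω => Finset.sum_le_sum fun j _ => ?_
    refine pow_le_pow_left₀ (clusterMass_nonneg hμ (by positivity) j n ω) ?_ 3
    have hW : 0 ≤ clusterWeight μ α β j n ω :=
      clusterWeight_nonneg (fun k hk => (hμ k hk).le) j n ω
    have : (n : ℝ) / totalWeight μ n ≤ l n := by
      simp only [hl]; gcongr; exact le_mul_of_one_le_left (by positivity) hL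
    simp only [clusterMass]
    gcongr

end IsRWInput

/-! ### L² concentration of additive functionals -/

/-- A damped step with an input close to its target. -/
theorem damped_step_sq_le {a x z n θ : ℝ} (hn : 1 ≤ n) (hθ : 0 < θ) (ha0 : 0 ≤ a)
    (ha : a ≤ 1 - 3 / 4 * θ / n) :
    (a * x + z / n) ^ 2 ≤ (1 - θ / 4 / n) * x ^ 2 + (2 / θ + 1) * z ^ 2 / n := by
  have hn0 : 0 < n := by linarith
  have hi : 0 < n⁻¹ := inv_pos.2 hn0
  have hi1 : n⁻¹ ≤ 1 := inv_le_one_of_one_le₀ hn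
  have ha1 : a ≤ 1 := by
    have : 0 ≤ 3 / 4 * θ / n := by positivity
    linarith
  have h1 : a ^ 2 * x ^ 2 ≤ (1 - 3 / 4 * θ / n) * x ^ 2 :=
    mul_le_mul_of_nonneg_right (by nlinarith) (sq_nonneg x)
  -- Young's inequality spends θ/2 of the damping rate 3θ/4 on the cross term, leaving θ/4.
  have h2 : 2 * (a * x) * z ≤ θ / 2 * x ^ 2 + 2 / θ * z ^ 2 := by
    have e : θ / 2 * x ^ 2 + 2 / θ * z ^ 2 - 2 * (a * x) * z =
        2 / θ * (z - θ * a * x / 2) ^ 2 + θ / 2 * (1 - a ^ 2) * x ^ 2 := by field_simp; ring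
    have : 0 ≤ 1 - a ^ 2 := by nlinarith
    have : 0 ≤ 2 / θ * (z - θ * a * x / 2) ^ 2 + θ / 2 * (1 - a ^ 2) * x ^ 2 := by positivity
    linarith
  have h3 : n⁻¹ * (z ^ 2 * n⁻¹) ≤ n⁻¹ * z ^ 2 :=
    mul_le_mul_of_nonneg_left (mul_le_of_le_one_right (sq_nonneg z) hi1) hi.le
  have h4 := mul_le_mul_of_nonneg_left h2 hi.le
  have e1 : (a * x + z / n) ^ 2 =
      a ^ 2 * x ^ 2 + n⁻¹ * (2 * (a * x) * z) + n⁻¹ * (z ^ 2 * n⁻¹) := by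
    rw [div_eq_mul_inv]; ring
  have e2 : (1 - θ / 4 / n) * x ^ 2 + (2 / θ + 1) * z ^ 2 / n = (1 - 3 / 4 * θ / n) * x ^ 2 +
      n⁻¹ * (θ / 2 * x ^ 2 + 2 / θ * z ^ 2) + n⁻¹ * z ^ 2 := by
    simp only [div_eq_mul_inv]; ring
  rw [e1, e2]
  linarith

section

variable {Ω : Type*} {α : ℕ → Ω → ℝ} {β : ℕ → Ω → ℕ} {μ : ℕ → ℝ} {p : ℝ}

/-- The conditional second moment of an increment that is controlled by the cluster masses. -/
theorem clusterDrift_sq_le (hμ : ∀ n, 1 ≤ n → 0 < μ n) (hp0 : 0 ≤ p) (hp1 : p ≤ 1) {n : ℕ}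
    (hn : 1 ≤ n) {H : ℕ → Ω → ℝ} {c k : ℝ} (ω : Ω)
    (hH : ∀ j, |H j ω| ≤ k * (clusterMass μ α β (n / totalWeight μ n) j n ω + 1)) (hc : |c| ≤ k) :
    clusterDrift p μ α β n (fun j ω => H j ω ^ 2) (c ^ 2) ω ≤ k ^ 2 *
      (2 / n * ∑ j ∈ Finset.Icc 1 n, clusterMass μ α β (n / totalWeight μ n) j n ω ^ 3 + 3) := by
  have hn0 : (0 : ℝ) < n := by positivity
  have hM := totalWeight_pos hμ hn
  have hq : 0 ≤ p / totalWeight μ n := by positivity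
  have hc2 : c ^ 2 ≤ k ^ 2 := sq_le_sq' (by linarith [(abs_le.1 hc).1]) (abs_le.1 hc).2
  -- Uses W_j/M_n ≤ V_j/n and (V+1)² ≤ 2V² + 2. The lower order terms sum to 2k², and the founding
  -- term adds k², whence the constant 3.
  have hterm : ∀ j, p / totalWeight μ n * (clusterWeight μ α β j n ω * H j ω ^ 2) ≤
      k ^ 2 * (2 / n * clusterMass μ α β (n / totalWeight μ n) j n ω ^ 3) +
        2 * k ^ 2 * (clusterWeight μ α β j n ω / totalWeight μ n) := fun j => by
    set V := clusterMass μ α β (n / totalWeight μ n) j n ω with hV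
    set W := clusterWeight μ α β j n ω with hWdef
    have hW : 0 ≤ W := clusterWeight_nonneg (fun k hk => (hμ k hk).le) j n ω
    have hN : 0 ≤ clusterSize α β j n ω := clusterWeight_nonneg (fun _ _ => zero_le_one) j n ω
    have hV0 : 0 ≤ V := clusterMass_nonneg hμ (by positivity) j n ω
    have h1 : H j ω ^ 2 ≤ (k * (V + 1)) ^ 2 := by
      rw [← sq_abs]; exact pow_le_pow_left₀ (abs_nonneg _) (hH j) 2
    have h2 : W / totalWeight μ n ≤ V / n := by
      rw [le_div_iff₀ hn0, hV, clusterMass]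
      have : n / totalWeight μ n * W = W / totalWeight μ n * n := by ring
      rw [this]; linarith
    have hw0 : 0 ≤ W / totalWeight μ n := by positivity
    have h3 : (V + 1) ^ 2 ≤ 2 * V ^ 2 + 2 := by nlinarith [sq_nonneg (V - 1)]
    calc p / totalWeight μ n * (W * H j ω ^ 2) = p * (W / totalWeight μ n * H j ω ^ 2) := by ring
      _ ≤ 1 * (W / totalWeight μ n * H j ω ^ 2) := by gcongr
      _ ≤ W / totalWeight μ n * (k ^ 2 * (2 * V ^ 2 + 2)) := by
          rw [one_mul]
          refine mul_le_mul_of_nonneg_left (h1.trans ?_) hw0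
          rw [mul_pow]; gcongr
      _ = 2 * k ^ 2 * V ^ 2 * (W / totalWeight μ n) +
            2 * k ^ 2 * (W / totalWeight μ n) := by ring
      _ ≤ 2 * k ^ 2 * V ^ 2 * (V / n) + 2 * k ^ 2 * (W / totalWeight μ n) := by gcongr
      _ = _ := by ring
  have hsum : ∑ j ∈ Finset.Icc 1 n, clusterWeight μ α β j n ω / totalWeight μ n = 1 := by
    rw [← Finset.sum_div, sum_clusterWeight]
    exact div_self hM.ne'
  have h1 := Finset.sum_le_sum fun j (_ : j ∈ Finset.Icc 1 n) => hterm j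
  rw [← Finset.mul_sum, Finset.sum_add_distrib, ← Finset.mul_sum, ← Finset.mul_sum,
    ← Finset.mul_sum, hsum] at h1
  have h2 : (1 - p) * c ^ 2 ≤ 1 * k ^ 2 :=
    mul_le_mul (by linarith) hc2 (sq_nonneg c) zero_le_one
  have h3 : clusterDrift p μ α β n (fun j ω => H j ω ^ 2) (c ^ 2) ω = p / totalWeight μ n *
    ∑ j ∈ Finset.Icc 1 n, clusterWeight μ α β j n ω * H j ω ^ 2 + (1 - p) * c ^ 2 := rfl
  rw [h3]
  linarith

end

namespace IsRWInput

variable {Ω : Type*} [mΩ : MeasurableSpace Ω] {P : Measure Ω} [IsProbabilityMeasure P]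
  {p : ℝ} {μ : ℕ → ℝ} {ξ α : ℕ → Ω → ℝ} {β : ℕ → Ω → ℕ}

/-- An additive cluster functional whose normalized drift is linear and damped concentrates
around the fixed point of the drift. -/
theorem tendsto_clusterSum_of_drift (h : IsRWInput P p μ ξ α β) (hμ : ∀ n, 1 ≤ n → 0 < μ n)
    (hp0 : 0 ≤ p) (hp1 : p ≤ 1)
    (h3 : Tendsto (fun n : ℕ => (∫ ω, ∑ j ∈ Finset.Icc 1 n,
      clusterMass μ α β (n / totalWeight μ n) j n ω ^ 3 ∂P) / (n * √n)) atTop (𝓝 0))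
    {Φ : ℝ → ℝ → ℝ} (hΦ : Φ 0 0 = 0)
    (hΦm : ∀ {m : MeasurableSpace Ω} {f g : Ω → ℝ}, f ∈ boundedMeasurable m →
      g ∈ boundedMeasurable m → (fun ω => Φ (f ω) (g ω)) ∈ boundedMeasurable m)
    {g : ℕ → ℝ} {θ : ℕ → ℝ} {θ₀ : ℝ}
    (hθ : Tendsto θ atTop (𝓝 θ₀)) (hθ₀ : 0 < θ₀) {Y : ℕ → Ω → ℝ} {y : ℝ}
    (hYm : ∀ n, Y n ∈ boundedMeasurable (inputSigma ξ α β (pastLabels n)))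
    (hY : Tendsto (fun n => ∫ ω, (Y n ω - y) ^ 2 ∂P) atTop (𝓝 0)) {K : ℝ}
    (hdrift : ∀ᶠ n : ℕ in atTop, ∀ ω, (clusterSum μ α β Φ n ω + clusterDrift p μ α β n
      (fun j ω => Φ (clusterSize α β j n ω + 1) (clusterWeight μ α β j n ω + μ (n + 1)) -
        Φ (clusterSize α β j n ω) (clusterWeight μ α β j n ω)) (Φ 1 (μ (n + 1))) ω) / g (n + 1) =
      (1 - θ n / n) * (clusterSum μ α β Φ n ω / g n) + Y n ω / n)
    (hH : ∀ᶠ n : ℕ in atTop, ∀ j ω,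
      |(Φ (clusterSize α β j n ω + 1) (clusterWeight μ α β j n ω + μ (n + 1)) -
        Φ (clusterSize α β j n ω) (clusterWeight μ α β j n ω)) / g (n + 1)| ≤
        K / n * (clusterMass μ α β (n / totalWeight μ n) j n ω + 1))
    (hc : ∀ᶠ n : ℕ in atTop, |Φ 1 (μ (n + 1)) / g (n + 1)| ≤ K / n) :
    Tendsto (fun n => ∫ ω, (clusterSum μ α β Φ n ω / g n - y / θ₀) ^ 2 ∂P) atTop (𝓝 0) := by
  set x := y / θ₀ with hx
  set X : ℕ → Ω → ℝ := fun n ω => clusterSum μ α β Φ n ω with hXdef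
  have hXm : ∀ n, X n ∈ boundedMeasurable (inputSigma ξ α β (pastLabels n)) := fun n => by
    have : X n = ∑ j ∈ Finset.Icc 1 n, fun ω =>
        Φ (clusterSize α β j n ω) (clusterWeight μ α β j n ω) := by
      ext ω; simp [hXdef, clusterSum]
    rw [this]
    exact Subalgebra.sum_mem _ fun j _ => hΦm (clusterWeight_mem_boundedMeasurable ξ _ j n)
      (clusterWeight_mem_boundedMeasurable ξ μ j n)
  have hdivm : ∀ {n : ℕ} {f : Ω → ℝ} (a b : ℝ),
      f ∈ boundedMeasurable (inputSigma ξ α β (pastLabels n)) →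
      (fun ω => f ω / a - b) ∈ boundedMeasurable (inputSigma ξ α β (pastLabels n)) := by
    intro n f a b hf
    have : (fun ω => f ω / a - b) = a⁻¹ • f - fun _ => b := by
      ext ω; simp [div_eq_inv_mul]
    rw [this]
    exact Subalgebra.sub_mem _ (Subalgebra.smul_mem _ hf _) (const_mem_boundedMeasurable _)
  have iX : ∀ n, Integrable (fun ω => (X n ω / g n - x) ^ 2) P := fun n =>
    h.integrable_of_past (Subalgebra.pow_mem _ (hdivm (g n) x (hXm n)) 2)
  have iY : ∀ n, Integrable (fun ω => (Y n ω - y) ^ 2) P := fun n =>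
    h.integrable_of_past (Subalgebra.pow_mem _
      (Subalgebra.sub_mem _ (hYm n) (const_mem_boundedMeasurable y)) 2)
  set T : ℕ → ℝ := fun n => ∫ ω, ∑ j ∈ Finset.Icc 1 n,
      clusterMass μ α β (n / totalWeight μ n) j n ω ^ 3 ∂P with hT
  -- This is n times the bound on the conditional variance of a step, so the noise is o(1/n) and
  -- fits the harmonic recursion.
  have hTn : Tendsto (fun n : ℕ => K ^ 2 * (2 * (T n / (n * √n) * (√(n : ℝ))⁻¹) + 3 * (n : ℝ)⁻¹))
      atTop (𝓝 0) := by
    have e1 : Tendsto (fun n : ℕ => (√(n : ℝ))⁻¹) atTop (𝓝 0) :=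
      tendsto_inv_atTop_zero.comp (Real.tendsto_sqrt_atTop.comp tendsto_natCast_atTop_atTop)
    simpa using (((h3.mul e1).const_mul 2).add
      ((tendsto_inv_atTop_nhds_zero_nat (𝕜 := ℝ)).const_mul 3)).const_mul (K ^ 2)
  have hin : Tendsto (fun n => (2 / θ₀ + 1) * (2 * ∫ ω, (Y n ω - y) ^ 2 ∂P +
      2 * ((θ₀ - θ n) * x) ^ 2)) atTop (𝓝 0) := by
    simpa using ((hY.const_mul 2).add ((((hθ.const_sub θ₀).mul_const x).pow 2).const_mul
      2)).const_mul (2 / θ₀ + 1)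
  refine tendsto_zero_of_harmonic_step (θ := θ₀ / 4) (by linarith)
    (fun n => integral_nonneg fun ω => sq_nonneg _) fun ε hε => ?_
  filter_upwards [hdrift, hH, hc, eventually_ge_atTop 1, hTn.eventually (gt_mem_nhds (half_pos hε)),
    hin.eventually (gt_mem_nhds (half_pos hε)),
    hθ.eventually (lt_mem_nhds (show 3 / 4 * θ₀ < θ₀ by linarith)),
    hθ.eventually (gt_mem_nhds (show θ₀ < 2 * θ₀ by linarith)),
    tendsto_natCast_atTop_atTop.eventually (eventually_ge_atTop (2 * θ₀))]
    with n hd hHn hcn hn hTn hin hθ1 hθ2 hn2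
  have hn0 : (0 : ℝ) < n := by positivity
  set H : ℕ → Ω → ℝ := fun j ω =>
    Φ (clusterSize α β j n ω + 1) (clusterWeight μ α β j n ω + μ (n + 1)) -
        Φ (clusterSize α β j n ω) (clusterWeight μ α β j n ω) with hHdef
  have hHm : ∀ j ∈ Finset.Icc 1 n, (fun ω => H j ω / g (n + 1)) ∈
      boundedMeasurable (inputSigma ξ α β (pastLabels n)) := fun j _ => by
    have e1 : H j ∈ boundedMeasurable (inputSigma ξ α β (pastLabels n)) :=
      Subalgebra.sub_mem _ (hΦm
        (Subalgebra.add_mem _ (clusterWeight_mem_boundedMeasurable ξ _ j n)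
          (const_mem_boundedMeasurable 1))
        (Subalgebra.add_mem _ (clusterWeight_mem_boundedMeasurable ξ μ j n)
          (const_mem_boundedMeasurable (μ (n + 1)))))
        (hΦm (clusterWeight_mem_boundedMeasurable ξ _ j n)
          (clusterWeight_mem_boundedMeasurable ξ μ j n))
    have := hdivm (g (n + 1)) 0 e1
    simpa using this
  have key := h.integral_add_clusterIncrement_sq_le hμ hn (hdivm (g (n + 1)) x (hXm n))
    (Φ 1 (μ (n + 1)) / g (n + 1)) hHm
  have e1 : ∀ ω, X (n + 1) ω / g (n + 1) - x = X n ω / g (n + 1) - x +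
      clusterIncrement α β n (fun j ω => H j ω / g (n + 1)) (Φ 1 (μ (n + 1)) / g (n + 1)) ω :=
    fun ω => by
      simp only [hXdef]
      rw [clusterSum_succ μ hΦ hn ω, add_div, clusterIncrement_div]
      ring
  simp only [← e1] at key
  have hpt : ∀ ω, (X n ω / g (n + 1) - x + clusterDrift p μ α β n (fun j ω => H j ω / g (n + 1))
      (Φ 1 (μ (n + 1)) / g (n + 1)) ω) ^ 2 ≤ (1 - θ₀ / 4 / n) * (X n ω / g n - x) ^ 2 +
        (2 / θ₀ + 1) / n * (2 * (Y n ω - y) ^ 2 + 2 * ((θ₀ - θ n) * x) ^ 2) := fun ω => by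
    -- Recentring at the fixed point: since y = θ₀x, the deviation is damped by 1 - θ_n/n and driven
    -- only by Y_n - y and θ₀ - θ_n.
    have e2 : X n ω / g (n + 1) - x + clusterDrift p μ α β n (fun j ω => H j ω / g (n + 1))
      (Φ 1 (μ (n + 1)) / g (n + 1)) ω = (1 - θ n / n) * (X n ω / g n - x) +
        (Y n ω - y + (θ₀ - θ n) * x) / n := by
      have e3 := hd ω
      rw [add_div, clusterDrift_div] at e3
      have e4 : y = θ₀ * x := by rw [hx]; field_simp
      rw [e4]
      calc _ = X n ω / g (n + 1) + clusterDrift p μ α β n (fun j ω => H j ω / g (n + 1))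
            (Φ 1 (μ (n + 1)) / g (n + 1)) ω - x := by ring
        _ = (1 - θ n / n) * (X n ω / g n) + Y n ω / n - x := by rw [← e3]
        _ = _ := by field_simp; ring
    rw [e2]
    refine (damped_step_sq_le (by exact_mod_cast hn) hθ₀ ?_ ?_).trans ?_
    · rw [sub_nonneg, div_le_one hn0]; linarith
    · gcongr
    · rw [mul_div_right_comm]
      gcongr
      nlinarith [sq_nonneg (Y n ω - y - (θ₀ - θ n) * x)]
  have hi1 : Integrable (fun ω => (1 - θ₀ / 4 / n) * (X n ω / g n - x) ^ 2) P := (iX n).const_mul _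
  have hi2 : Integrable (fun ω => (2 / θ₀ + 1) / n *
      (2 * (Y n ω - y) ^ 2 + 2 * ((θ₀ - θ n) * x) ^ 2)) P :=
    (((iY n).const_mul 2).add (integrable_const _)).const_mul _
  have hb1 := integral_mono_of_nonneg (Eventually.of_forall fun ω => sq_nonneg _) (hi1.add hi2)
    (Eventually.of_forall hpt)
  simp only [Pi.add_apply] at hb1
  rw [integral_add hi1 hi2, integral_const_mul, integral_const_mul,
    integral_add ((iY n).const_mul 2) (integrable_const _), integral_const_mul] at hb1
  simp only [integral_const, probReal_univ, one_smul] at hb1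
  have hi3 := (h.integrable_of_past
    (sum_pow_clusterMass_mem (α := α) (β := β) ξ μ (n / totalWeight μ n) n 3)).const_mul (2 / n : ℝ)
  have hb2 := integral_mono_of_nonneg (μ := P) (Eventually.of_forall fun ω => ?_)
    ((hi3.add (integrable_const 3)).const_mul ((K / n) ^ 2)) (Eventually.of_forall fun ω =>
      clusterDrift_sq_le (p := p) hμ hp0 hp1 hn (H := fun j ω => H j ω / g (n + 1))
        ω (fun j => hHn j ω) hcn)
  · rw [integral_const_mul] at hb2
    simp only [Pi.add_apply] at hb2
    rw [integral_add hi3 (integrable_const _), integral_const_mul] at hb2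
    simp only [integral_const, probReal_univ, one_smul] at hb2
    have e5 : (2 / θ₀ + 1) / n * (2 * ∫ ω, (Y n ω - y) ^ 2 ∂P + 2 * ((θ₀ - θ n) * x) ^ 2) ≤
        ε / 2 / n := by
      rw [div_mul_eq_mul_div]; gcongr
    have e6 : (K / n) ^ 2 * (2 / n * T n + 3) ≤ ε / 2 / n := by
      have : (K / n) ^ 2 * (2 / n * T n + 3) =
          (K ^ 2 * (2 * (T n / (n * √n) * (√(n : ℝ))⁻¹) + 3 * (n : ℝ)⁻¹)) / n := by
        have hs : √(n : ℝ) * √n = n := Real.mul_self_sqrt hn0.le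
        have hs0 : √(n : ℝ) ≠ 0 := (Real.sqrt_pos.2 hn0).ne'
        have : T n / (n * √n) * (√(n : ℝ))⁻¹ = T n / (n * n) := by
          rw [← div_eq_mul_inv, div_div, mul_assoc, hs]
        rw [this]
        field_simp
      rw [this]; gcongr
    calc _ ≤ _ := key
      _ ≤ _ := add_le_add hb1 hb2
      _ ≤ (1 - θ₀ / 4 / n) * ∫ ω, (X n ω / g n - x) ^ 2 ∂P + (ε / 2 / n + ε / 2 / n) := by
          linarith
      _ = _ := by ring
  · have hM := totalWeight_pos hμ hn
    refine add_nonneg (mul_nonneg (div_nonneg hp0 hM.le) (Finset.sum_nonneg fun j _ => mul_nonneg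
      (clusterWeight_nonneg (fun k hk => (hμ k hk).le) j n ω) (sq_nonneg _)))
      (mul_nonneg (by linarith) (sq_nonneg _))

end IsRWInput

/-- Carries the concentration of one functional over to the input of the next equation of the
triangular system, whose coefficients converge but vary with n. -/
theorem tendsto_integral_sq_affine {Ω : Type*} [MeasurableSpace Ω] {P : Measure Ω}
    [IsProbabilityMeasure P] {Z : ℕ → Ω → ℝ} {z : ℝ}
    (hi : ∀ n, Integrable (fun ω => (Z n ω - z) ^ 2) P)
    (hZ : Tendsto (fun n => ∫ ω, (Z n ω - z) ^ 2 ∂P) atTop (𝓝 0)) {a b : ℕ → ℝ} {a₀ b₀ : ℝ}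
    (ha : Tendsto a atTop (𝓝 a₀)) (hb : Tendsto b atTop (𝓝 b₀)) :
    Tendsto (fun n => ∫ ω, (a n * Z n ω + b n - (a₀ * z + b₀)) ^ 2 ∂P) atTop (𝓝 0) := by
  have hlim : Tendsto (fun n => 2 * a n ^ 2 * ∫ ω, (Z n ω - z) ^ 2 ∂P +
      2 * ((a n - a₀) * z + (b n - b₀)) ^ 2) atTop (𝓝 0) := by
    have h1 := (((ha.pow 2).const_mul 2).mul hZ).add
      (((((ha.sub_const a₀).mul_const z).add (hb.sub_const b₀)).pow 2).const_mul 2)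
    simpa using h1
  refine squeeze_zero (fun n => integral_nonneg fun ω => sq_nonneg _) (fun n => ?_) hlim
  have h1 := integral_mono_of_nonneg (μ := P)
    (f := fun ω => (a n * Z n ω + b n - (a₀ * z + b₀)) ^ 2)
    (Eventually.of_forall fun ω => sq_nonneg _)
    (((hi n).const_mul (2 * a n ^ 2)).add
      (integrable_const (2 * ((a n - a₀) * z + (b n - b₀)) ^ 2)))
    (Eventually.of_forall fun ω => ?_)
  · simp only [Pi.add_apply] at h1
    rw [integral_add ((hi n).const_mul _) (integrable_const _), integral_const_mul] at h1
    simpa using h1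
  · simp only [Pi.add_apply]
    nlinarith [sq_nonneg (a n * (Z n ω - z) - ((a n - a₀) * z + (b n - b₀)))]

/-! ### The triangular system for ∑ W_j², ∑ N_j W_j and ∑ N_j² -/

section

variable {Ω : Type*} {α : ℕ → Ω → ℝ} {β : ℕ → Ω → ℕ} {μ : ℕ → ℝ} {p : ℝ}

/-- The drift of `∑ W_j ^ 2`. -/
theorem clusterDrift_weight_sq (hμ : ∀ n, 1 ≤ n → 0 < μ n) {n : ℕ} (hn : 1 ≤ n) (m : ℝ) (ω : Ω) :
    clusterDrift p μ α β n (fun j ω => (clusterWeight μ α β j n ω + m) ^ 2 -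
        clusterWeight μ α β j n ω ^ 2) (m ^ 2) ω =
      2 * p * m / totalWeight μ n * clusterSum μ α β (fun _ y => y ^ 2) n ω + m ^ 2 := by
  have hM := (totalWeight_pos hμ hn).ne'
  have e : ∑ j ∈ Finset.Icc 1 n, clusterWeight μ α β j n ω *
      ((clusterWeight μ α β j n ω + m) ^ 2 - clusterWeight μ α β j n ω ^ 2) =
      2 * m * clusterSum μ α β (fun _ y => y ^ 2) n ω + m ^ 2 * totalWeight μ n := by
    rw [totalWeight, ← sum_clusterWeight (α := α) (β := β) μ n ω, clusterSum, Finset.mul_sum,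
      Finset.mul_sum, ← Finset.sum_add_distrib]
    exact Finset.sum_congr rfl fun j _ => by ring
  change p / totalWeight μ n * ∑ j ∈ Finset.Icc 1 n, clusterWeight μ α β j n ω *
      ((clusterWeight μ α β j n ω + m) ^ 2 - clusterWeight μ α β j n ω ^ 2) + (1 - p) * m ^ 2 = _
  rw [e]
  field_simp
  ring

/-- The drift of `∑ N_j W_j`. -/
theorem clusterDrift_size_mul_weight (hμ : ∀ n, 1 ≤ n → 0 < μ n) {n : ℕ} (hn : 1 ≤ n) (m : ℝ)
    (ω : Ω) :
    clusterDrift p μ α β n (fun j ω => (clusterSize α β j n ω + 1) *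
        (clusterWeight μ α β j n ω + m) - clusterSize α β j n ω * clusterWeight μ α β j n ω)
        (1 * m) ω =
      p * m / totalWeight μ n * clusterSum μ α β (fun x y => x * y) n ω +
        p / totalWeight μ n * clusterSum μ α β (fun _ y => y ^ 2) n ω + m := by
  have hM := (totalWeight_pos hμ hn).ne'
  have e : ∑ j ∈ Finset.Icc 1 n, clusterWeight μ α β j n ω * ((clusterSize α β j n ω + 1) *
        (clusterWeight μ α β j n ω + m) - clusterSize α β j n ω * clusterWeight μ α β j n ω) =
      m * clusterSum μ α β (fun x y => x * y) n ω + clusterSum μ α β (fun _ y => y ^ 2) n ω +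
        m * totalWeight μ n := by
    rw [totalWeight, ← sum_clusterWeight (α := α) (β := β) μ n ω, clusterSum, clusterSum,
      Finset.mul_sum, Finset.mul_sum, ← Finset.sum_add_distrib, ← Finset.sum_add_distrib]
    exact Finset.sum_congr rfl fun j _ => by ring
  change p / totalWeight μ n * ∑ j ∈ Finset.Icc 1 n, clusterWeight μ α β j n ω *
      ((clusterSize α β j n ω + 1) * (clusterWeight μ α β j n ω + m) -
        clusterSize α β j n ω * clusterWeight μ α β j n ω) + (1 - p) * (1 * m) = _
  rw [e]
  field_simp
  ring

/-- The drift of `∑ N_j ^ 2`. -/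
theorem clusterDrift_size_sq (hμ : ∀ n, 1 ≤ n → 0 < μ n) {n : ℕ} (hn : 1 ≤ n) (ω : Ω) :
    clusterDrift p μ α β n (fun j ω => (clusterSize α β j n ω + 1) ^ 2 -
        clusterSize α β j n ω ^ 2) (1 ^ 2) ω =
      2 * p / totalWeight μ n * clusterSum μ α β (fun x y => x * y) n ω + 1 := by
  have hM := (totalWeight_pos hμ hn).ne'
  have e : ∑ j ∈ Finset.Icc 1 n, clusterWeight μ α β j n ω * ((clusterSize α β j n ω + 1) ^ 2 -
        clusterSize α β j n ω ^ 2) =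
      2 * clusterSum μ α β (fun x y => x * y) n ω + totalWeight μ n := by
    rw [totalWeight, ← sum_clusterWeight (α := α) (β := β) μ n ω, clusterSum,
      Finset.mul_sum, ← Finset.sum_add_distrib]
    exact Finset.sum_congr rfl fun j _ => by ring
  change p / totalWeight μ n * ∑ j ∈ Finset.Icc 1 n, clusterWeight μ α β j n ω *
      ((clusterSize α β j n ω + 1) ^ 2 - clusterSize α β j n ω ^ 2) + (1 - p) * 1 ^ 2 = _
  rw [e]
  field_simp
  ring

theorem size_and_weight_le (hμ : ∀ n, 1 ≤ n → 0 < μ n) {n : ℕ} (hn : 1 ≤ n) (j : ℕ) (ω : Ω) :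
    0 ≤ clusterSize α β j n ω ∧ 0 ≤ clusterWeight μ α β j n ω ∧
      clusterSize α β j n ω ≤ clusterMass μ α β (n / totalWeight μ n) j n ω ∧
      clusterWeight μ α β j n ω / totalWeight μ n ≤
        clusterMass μ α β (n / totalWeight μ n) j n ω / n := by
  have hn0 : (0 : ℝ) < n := by positivity
  have hM := totalWeight_pos hμ hn
  have hW : 0 ≤ clusterWeight μ α β j n ω := clusterWeight_nonneg (fun k hk => (hμ k hk).le) j n ω
  have hN : 0 ≤ clusterSize α β j n ω := clusterWeight_nonneg (fun _ _ => zero_le_one) j n ω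
  have hp : 0 ≤ n / totalWeight μ n * clusterWeight μ α β j n ω := by positivity
  refine ⟨hN, hW, ?_, ?_⟩
  · simp only [clusterMass]; linarith
  · rw [le_div_iff₀ hn0, clusterMass]
    have : n / totalWeight μ n * clusterWeight μ α β j n ω =
      clusterWeight μ α β j n ω / totalWeight μ n * n := by ring
    linarith

end

namespace IsRWInput

variable {Ω : Type*} [mΩ : MeasurableSpace Ω] {P : Measure Ω} [IsProbabilityMeasure P]
  {p : ℝ} {μ : ℕ → ℝ} {ξ α : ℕ → Ω → ℝ} {β : ℕ → Ω → ℕ} {κ : ℝ}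

theorem integrable_clusterSum_sub_sq (h : IsRWInput P p μ ξ α β) {Φ : ℝ → ℝ → ℝ}
    (hΦm : ∀ {m : MeasurableSpace Ω} {f g : Ω → ℝ}, f ∈ boundedMeasurable m →
      g ∈ boundedMeasurable m → (fun ω => Φ (f ω) (g ω)) ∈ boundedMeasurable m) (n : ℕ) (a b : ℝ) :
    (fun ω => a * clusterSum μ α β Φ n ω + b) ∈
        boundedMeasurable (inputSigma ξ α β (pastLabels n)) ∧
      Integrable (fun ω => (clusterSum μ α β Φ n ω / a - b) ^ 2) P := by
  have hm : clusterSum μ α β Φ n ∈ boundedMeasurable (inputSigma ξ α β (pastLabels n)) := by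
    have : clusterSum μ α β Φ n = ∑ j ∈ Finset.Icc 1 n, fun ω =>
        Φ (clusterSize α β j n ω) (clusterWeight μ α β j n ω) := by
      ext ω; simp [clusterSum]
    rw [this]
    exact Subalgebra.sum_mem _ fun j _ => hΦm (clusterWeight_mem_boundedMeasurable ξ _ j n)
      (clusterWeight_mem_boundedMeasurable ξ μ j n)
  refine ⟨Subalgebra.add_mem _ (Subalgebra.smul_mem _ hm a) (const_mem_boundedMeasurable b), ?_⟩
  have : (fun ω => (clusterSum μ α β Φ n ω / a - b) ^ 2) =
      (a⁻¹ • clusterSum μ α β Φ n - fun _ => b) ^ 2 := by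
    ext ω; simp [div_eq_inv_mul]
  rw [this]
  exact h.integrable_of_past (Subalgebra.pow_mem _ (Subalgebra.sub_mem _
    (Subalgebra.smul_mem _ hm _) (const_mem_boundedMeasurable b)) 2)

/-- The normalization M_n²/n grows at relative rate (2κ - 1)/n and the drift feeds back 2pκ/n, which
leaves the damping 2κ - 1 - 2pκ. The input is deterministic with limit κ². -/
theorem tendsto_sum_weight_sq (h : IsRWInput P p μ ξ α β) (hμ : ∀ n, 1 ≤ n → 0 < μ n)
    (hκ : Tendsto (fun n : ℕ => n * μ (n + 1) / totalWeight μ n) atTop (𝓝 κ))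
    (hp0 : 0 ≤ p) (hp1 : p ≤ 1) (hp : p * κ < κ - 1 / 2) :
    Tendsto (fun n : ℕ => ∫ ω, (clusterSum μ α β (fun _ y => y ^ 2) n ω /
      (totalWeight μ n ^ 2 / n) - κ ^ 2 / (2 * κ - 1 - 2 * p * κ)) ^ 2 ∂P) atTop (𝓝 0) := by
  have hr := tendsto_totalWeight_ratio hμ hκ
  have hi := tendsto_inv_atTop_nhds_zero_nat (𝕜 := ℝ)
  -- The damping at time n is defined so that the drift identity holds exactly; only its limit is
  -- approximate.
  have hθ : Tendsto (fun n : ℕ => (n : ℝ) * (1 - (n + 1) / n *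
      (1 + 2 * p * (n * μ (n + 1) / totalWeight μ n) / n) /
        (totalWeight μ (n + 1) / totalWeight μ n) ^ 2)) atTop (𝓝 (2 * κ - 1 - 2 * p * κ)) := by
    have h1 := ((((hκ.const_mul 2).sub_const 1).sub (hκ.const_mul (2 * p))).add
      (((hκ.pow 2).sub (hκ.const_mul (2 * p))).mul hi)).div (hr.pow 2) (by norm_num)
    simp only [mul_zero, add_zero, one_pow, div_one] at h1
    refine h1.congr' ?_
    filter_upwards [eventually_ge_atTop 1] with n hn
    have hn0 : (0 : ℝ) < n := by positivity
    have hM := totalWeight_pos hμ hn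
    have hM' := totalWeight_pos hμ (Nat.le_succ_of_le hn)
    have hm : μ (n + 1) = totalWeight μ (n + 1) - totalWeight μ n := by
      rw [totalWeight_succ]; ring
    simp only [Pi.div_apply]
    rw [hm]
    field_simp
    ring
  have hY : Tendsto (fun n : ℕ => n * μ (n + 1) ^ 2 / (totalWeight μ (n + 1) ^ 2 / (n + 1))) atTop
      (𝓝 (κ ^ 2)) := by
    have h1 := ((hκ.pow 2).mul tendsto_succ_div_nat).div (hr.pow 2) (by norm_num)
    simp only [one_pow, mul_one, div_one] at h1
    refine h1.congr' ?_
    filter_upwards [eventually_ge_atTop 1] with n hn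
    have hn0 : (0 : ℝ) < n := by positivity
    have hM := totalWeight_pos hμ hn
    have hM' := totalWeight_pos hμ (Nat.le_succ_of_le hn)
    simp only [Pi.div_apply]
    field_simp
  have hY2 : Tendsto (fun n : ℕ => ∫ _ : Ω, (n * μ (n + 1) ^ 2 /
      (totalWeight μ (n + 1) ^ 2 / (n + 1)) - κ ^ 2) ^ 2 ∂P) atTop (𝓝 0) := by
    have h1 := (hY.sub_const (κ ^ 2)).pow 2
    rw [sub_self, zero_pow two_ne_zero] at h1
    simpa using h1
  have hκK := hκ.eventually (gt_mem_nhds (show κ < |κ| + 1 by linarith [le_abs_self κ]))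
  have hbound : ∀ᶠ n : ℕ in atTop, μ (n + 1) / totalWeight μ n ≤ (|κ| + 1) / n := by
    filter_upwards [hκK, eventually_ge_atTop 1] with n h1 hn
    have hn0 : (0 : ℝ) < n := by positivity
    rw [le_div_iff₀ hn0, div_mul_eq_mul_div, mul_comm]
    exact h1.le
  set k := |κ| + 1 with hk
  have hk0 : 0 < k := by positivity
  refine h.tendsto_clusterSum_of_drift hμ hp0 hp1
    (h.tendsto_third_moment_clusterMass hμ hκ hp0 hp1 hp) (Φ := fun _ y => y ^ 2) (by simp)
    (fun _ hg => Subalgebra.pow_mem _ hg 2) (g := fun n : ℕ => totalWeight μ n ^ 2 / n) hθ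
    (by linarith) (Y := fun n _ => n * μ (n + 1) ^ 2 / (totalWeight μ (n + 1) ^ 2 / (n + 1)))
    (fun n => const_mem_boundedMeasurable _) hY2 (K := 2 * (2 * k + k ^ 2))
    ?_ ?_ ?_
  · filter_upwards [eventually_ge_atTop 1] with n hn ω
    have hn0 : (0 : ℝ) < n := by positivity
    have hM := totalWeight_pos hμ hn
    have hM' := totalWeight_pos hμ (Nat.le_succ_of_le hn)
    rw [clusterDrift_weight_sq hμ hn]
    push_cast
    field_simp
    ring
  · filter_upwards [hbound, eventually_ge_atTop 1] with n h1 hn j ω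
    obtain ⟨-, hW, -, h2⟩ := size_and_weight_le (α := α) (β := β) hμ hn j ω
    have hn0 : (0 : ℝ) < n := by positivity
    have hn1 : (1 : ℝ) ≤ n := by exact_mod_cast hn
    have hM := totalWeight_pos hμ hn
    have hM' := totalWeight_pos hμ (Nat.le_succ_of_le hn)
    have hm := hμ (n + 1) (by omega)
    have hMM : totalWeight μ n ≤ totalWeight μ (n + 1) := by rw [totalWeight_succ]; linarith
    set W := clusterWeight μ α β j n ω
    set V := clusterMass μ α β (n / totalWeight μ n) j n ω
    have hw0 : 0 ≤ W / totalWeight μ n := by positivity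
    have hV : 0 ≤ V := by
      have := hw0.trans h2
      rwa [le_div_iff₀ hn0, zero_mul] at this
    push_cast
    rw [abs_of_nonneg (div_nonneg (by nlinarith) (by positivity))]
    have e1 : (W + μ (n + 1)) ^ 2 - W ^ 2 = totalWeight μ n ^ 2 * (2 * (W / totalWeight μ n) *
        (μ (n + 1) / totalWeight μ n) + (μ (n + 1) / totalWeight μ n) ^ 2) := by
      field_simp; ring
    calc ((W + μ (n + 1)) ^ 2 - W ^ 2) / (totalWeight μ (n + 1) ^ 2 / (n + 1))
        ≤ totalWeight μ n ^ 2 * (2 * (V / n) * (k / n) + (k / n) ^ 2) /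
          (totalWeight μ n ^ 2 / (n + 1)) := by rw [e1]; gcongr
      _ = (2 * k * V + k ^ 2) * ((n + 1) / n) / n := by field_simp
      _ ≤ (2 * k * V + k ^ 2) * 2 / n := by
          gcongr
          rw [div_le_iff₀ hn0]; linarith
      _ ≤ (2 * k * V + k ^ 2 * V + 2 * k + k ^ 2) * 2 / n := by
          gcongr
          nlinarith [mul_nonneg (sq_nonneg k) hV]
      _ = _ := by ring
  · filter_upwards [hbound, eventually_ge_atTop 1] with n h1 hn
    have hn0 : (0 : ℝ) < n := by positivity
    have hn1 : (1 : ℝ) ≤ n := by exact_mod_cast hn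
    have hM := totalWeight_pos hμ hn
    have hM' := totalWeight_pos hμ (Nat.le_succ_of_le hn)
    have hm := hμ (n + 1) (by omega)
    have hMM : totalWeight μ n ≤ totalWeight μ (n + 1) := by rw [totalWeight_succ]; linarith
    push_cast
    rw [abs_of_nonneg (by positivity)]
    have e1 : μ (n + 1) ^ 2 = totalWeight μ n ^ 2 * (μ (n + 1) / totalWeight μ n) ^ 2 := by
      field_simp
    calc μ (n + 1) ^ 2 / (totalWeight μ (n + 1) ^ 2 / (n + 1))
        ≤ totalWeight μ n ^ 2 * (k / n) ^ 2 / (totalWeight μ n ^ 2 / (n + 1)) := by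
          rw [e1]; gcongr
      _ = k ^ 2 * ((n + 1) / n) / n := by field_simp
      _ ≤ k ^ 2 * 2 / n := by
          gcongr
          rw [div_le_iff₀ hn0]; linarith
      _ ≤ _ := div_le_div_of_nonneg_right (by nlinarith) hn0.le

/-- Normalization by M_n has relative growth κ/n against a feedback pκ/n. The input is p times the
normalized ∑ W_j², plus the founding and joining contribution κ. -/
theorem tendsto_sum_size_mul_weight (h : IsRWInput P p μ ξ α β) (hμ : ∀ n, 1 ≤ n → 0 < μ n)
    (hκ : Tendsto (fun n : ℕ => n * μ (n + 1) / totalWeight μ n) atTop (𝓝 κ))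
    (hp0 : 0 ≤ p) (hp1 : p ≤ 1) (hp : p * κ < κ - 1 / 2) :
    Tendsto (fun n : ℕ => ∫ ω, (clusterSum μ α β (fun x y => x * y) n ω / totalWeight μ n -
      (p * (κ ^ 2 / (2 * κ - 1 - 2 * p * κ)) + κ) / (κ - p * κ)) ^ 2 ∂P) atTop (𝓝 0) := by
  have hA := h.tendsto_sum_weight_sq hμ hκ hp0 hp1 hp
  have hr := tendsto_totalWeight_ratio hμ hκ
  have hθ : Tendsto (fun n : ℕ => (n : ℝ) * (1 -
      (1 + p * (n * μ (n + 1) / totalWeight μ n) / n) /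
        (totalWeight μ (n + 1) / totalWeight μ n))) atTop (𝓝 (κ - p * κ)) := by
    have h1 := (hκ.sub (hκ.const_mul p)).div hr one_ne_zero
    rw [div_one] at h1
    refine h1.congr' ?_
    filter_upwards [eventually_ge_atTop 1] with n hn
    have hn0 : (0 : ℝ) < n := by positivity
    have hM := totalWeight_pos hμ hn
    have hM' := totalWeight_pos hμ (Nat.le_succ_of_le hn)
    have hm : μ (n + 1) = totalWeight μ (n + 1) - totalWeight μ n := by
      rw [totalWeight_succ]; ring
    simp only [Pi.div_apply]
    rw [hm]
    field_simp
    ring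
  have ha : Tendsto (fun n : ℕ => p / (totalWeight μ (n + 1) / totalWeight μ n)) atTop (𝓝 p) := by
    have h1 := (tendsto_const_nhds (x := p)).div hr one_ne_zero
    rwa [div_one] at h1
  have hb : Tendsto (fun n : ℕ => n * μ (n + 1) / totalWeight μ n /
      (totalWeight μ (n + 1) / totalWeight μ n)) atTop (𝓝 κ) := by
    have h1 := hκ.div hr one_ne_zero
    rwa [div_one] at h1
  have hm2 : ∀ {m : MeasurableSpace Ω} {f g : Ω → ℝ}, f ∈ boundedMeasurable m →
      g ∈ boundedMeasurable m → (fun ω => g ω ^ 2) ∈ boundedMeasurable m :=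
    fun _ hg => Subalgebra.pow_mem _ hg 2
  have hY := tendsto_integral_sq_affine
    (fun n => (h.integrable_clusterSum_sub_sq (Φ := fun _ y => y ^ 2) hm2 n _ _).2) hA ha hb
  have hκK := hκ.eventually (gt_mem_nhds (show κ < |κ| + 1 by linarith [le_abs_self κ]))
  have hbound : ∀ᶠ n : ℕ in atTop, μ (n + 1) / totalWeight μ n ≤ (|κ| + 1) / n := by
    filter_upwards [hκK, eventually_ge_atTop 1] with n h1 hn
    have hn0 : (0 : ℝ) < n := by positivity
    rw [le_div_iff₀ hn0, div_mul_eq_mul_div, mul_comm]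
    exact h1.le
  set k := |κ| + 1 with hk
  have hk0 : 0 < k := by positivity
  have hθ0 : 0 < κ - p * κ := by linarith
  refine h.tendsto_clusterSum_of_drift hμ hp0 hp1
    (h.tendsto_third_moment_clusterMass hμ hκ hp0 hp1 hp) (Φ := fun x y => x * y) (by simp)
    (fun hf hg => Subalgebra.mul_mem _ hf hg) (g := totalWeight μ) hθ hθ0 ?_ hY (K := 1 + 2 * k)
    ?_ ?_ ?_
  · intro n
    have := (h.integrable_clusterSum_sub_sq (Φ := fun _ y => y ^ 2) hm2 n
      (p / (totalWeight μ (n + 1) / totalWeight μ n) / (totalWeight μ n ^ 2 / n))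
      (n * μ (n + 1) / totalWeight μ n / (totalWeight μ (n + 1) / totalWeight μ n))).1
    convert this using 2
    ring
  · filter_upwards [eventually_ge_atTop 1] with n hn ω
    have hn0 : (0 : ℝ) < n := by positivity
    have hM := totalWeight_pos hμ hn
    have hM' := totalWeight_pos hμ (Nat.le_succ_of_le hn)
    rw [clusterDrift_size_mul_weight hμ hn]
    field_simp
    ring
  · filter_upwards [hbound, eventually_ge_atTop 1] with n h1 hn j ω
    obtain ⟨hN, hW, h3, h2⟩ := size_and_weight_le (α := α) (β := β) hμ hn j ω
    have hn0 : (0 : ℝ) < n := by positivity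
    have hM := totalWeight_pos hμ hn
    have hM' := totalWeight_pos hμ (Nat.le_succ_of_le hn)
    have hm := hμ (n + 1) (by omega)
    have hMM : totalWeight μ n ≤ totalWeight μ (n + 1) := by rw [totalWeight_succ]; linarith
    set W := clusterWeight μ α β j n ω
    set N := clusterSize α β j n ω
    set V := clusterMass μ α β (n / totalWeight μ n) j n ω
    have hV : 0 ≤ V := hN.trans h3
    have e1 : (N + 1) * (W + μ (n + 1)) - N * W = totalWeight μ n * (W / totalWeight μ n +
        N * (μ (n + 1) / totalWeight μ n) + μ (n + 1) / totalWeight μ n) := by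
      field_simp; ring
    rw [abs_of_nonneg (div_nonneg (by rw [e1]; positivity) hM'.le), e1]
    calc totalWeight μ n * (W / totalWeight μ n +
        N * (μ (n + 1) / totalWeight μ n) + μ (n + 1) / totalWeight μ n) / totalWeight μ (n + 1)
        ≤ totalWeight μ n * (V / n + V * (k / n) + k / n) / totalWeight μ n := by gcongr
      _ = (V + k * V + k) / n := by field_simp
      _ ≤ ((1 + 2 * k) * (V + 1)) / n := by gcongr; nlinarith
      _ = _ := by ring
  · filter_upwards [hbound, eventually_ge_atTop 1] with n h1 hn
    have hn0 : (0 : ℝ) < n := by positivity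
    have hM := totalWeight_pos hμ hn
    have hM' := totalWeight_pos hμ (Nat.le_succ_of_le hn)
    have hm := hμ (n + 1) (by omega)
    have hMM : totalWeight μ n ≤ totalWeight μ (n + 1) := by rw [totalWeight_succ]; linarith
    rw [one_mul, abs_of_nonneg (by positivity)]
    calc μ (n + 1) / totalWeight μ (n + 1) ≤ μ (n + 1) / totalWeight μ n := by gcongr
      _ ≤ k / n := h1
      _ ≤ _ := by gcongr; linarith

/-- Here there is no feedback, so the damping 1 comes from the normalization n alone. The limit is
that of the input 2p ∑ N_j W_j/M_n + 1. -/
theorem tendsto_sum_size_sq (h : IsRWInput P p μ ξ α β) (hμ : ∀ n, 1 ≤ n → 0 < μ n)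
    (hκ : Tendsto (fun n : ℕ => n * μ (n + 1) / totalWeight μ n) atTop (𝓝 κ))
    (hp0 : 0 ≤ p) (hp1 : p ≤ 1) (hp : p * κ < κ - 1 / 2) :
    Tendsto (fun n : ℕ => ∫ ω, (clusterSum μ α β (fun x _ => x ^ 2) n ω / n -
      (2 * p * ((p * (κ ^ 2 / (2 * κ - 1 - 2 * p * κ)) + κ) / (κ - p * κ)) + 1)) ^ 2 ∂P) atTop
      (𝓝 0) := by
  have hB := h.tendsto_sum_size_mul_weight hμ hκ hp0 hp1 hp
  have hr : Tendsto (fun n : ℕ => (n : ℝ) / (n + 1)) atTop (𝓝 1) := by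
    have := tendsto_succ_div_nat.inv₀ one_ne_zero
    simpa using this
  have hθ : Tendsto (fun n : ℕ => (n : ℝ) * (1 - n / (n + 1))) atTop (𝓝 1) := by
    refine hr.congr fun n => ?_
    have : (n : ℝ) + 1 ≠ 0 := by positivity
    field_simp
    ring
  have ha : Tendsto (fun n : ℕ => 2 * p * ((n : ℝ) / (n + 1))) atTop (𝓝 (2 * p)) := by
    simpa using hr.const_mul (2 * p)
  have hm2 : ∀ {m : MeasurableSpace Ω} {f g : Ω → ℝ}, f ∈ boundedMeasurable m →
      g ∈ boundedMeasurable m → (fun ω => f ω * g ω) ∈ boundedMeasurable m :=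
    fun hf hg => Subalgebra.mul_mem _ hf hg
  have hY := tendsto_integral_sq_affine
    (fun n => (h.integrable_clusterSum_sub_sq (Φ := fun x y => x * y) hm2 n _ _).2) hB ha hr
  have key := h.tendsto_clusterSum_of_drift hμ hp0 hp1
    (h.tendsto_third_moment_clusterMass hμ hκ hp0 hp1 hp) (Φ := fun x _ => x ^ 2) (by simp)
    (fun hf _ => Subalgebra.pow_mem _ hf 2) (g := fun n : ℕ => (n : ℝ)) hθ one_pos ?_ hY (K := 2)
    ?_ ?_ ?_
  · simpa using key
  · intro n
    have := (h.integrable_clusterSum_sub_sq (Φ := fun x y => x * y) hm2 n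
      (2 * p * ((n : ℝ) / (n + 1)) / totalWeight μ n) ((n : ℝ) / (n + 1))).1
    convert this using 2
    ring
  · filter_upwards [eventually_ge_atTop 1] with n hn ω
    have hn0 : (0 : ℝ) < n := by positivity
    have hM := totalWeight_pos hμ hn
    rw [clusterDrift_size_sq hμ hn]
    push_cast
    field_simp
    ring
  · filter_upwards [eventually_ge_atTop 1] with n hn j ω
    obtain ⟨hN, hW, h3, h2⟩ := size_and_weight_le (α := α) (β := β) hμ hn j ω
    have hn0 : (0 : ℝ) < n := by positivity
    push_cast
    rw [abs_of_nonneg (div_nonneg (by nlinarith) (by positivity))]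
    calc ((clusterSize α β j n ω + 1) ^ 2 - clusterSize α β j n ω ^ 2) / ((n : ℝ) + 1)
        ≤ (2 * (clusterMass μ α β (n / totalWeight μ n) j n ω + 1)) / n := by
          gcongr
          · have := hN.trans h3; linarith
          · nlinarith
          · linarith
      _ = _ := by ring
  · filter_upwards [eventually_ge_atTop 1] with n hn
    have hn0 : (0 : ℝ) < n := by positivity
    push_cast
    rw [abs_of_nonneg (by positivity)]
    gcongr
    · norm_num
    · linarith

end IsRWInput

/-! ### Central limit theorem with independent random weights -/

/-- Replace the factors one at a time; all others have norm at most 1. -/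
theorem norm_prod_sub_prod_le {ι : Type*} (s : Finset ι) {f g : ι → ℂ} (hf : ∀ i ∈ s, ‖f i‖ ≤ 1)
    (hg : ∀ i ∈ s, ‖g i‖ ≤ 1) : ‖∏ i ∈ s, f i - ∏ i ∈ s, g i‖ ≤ ∑ i ∈ s, ‖f i - g i‖ := by
  classical
  induction s using Finset.induction_on with
  | empty => simp
  | insert a s ha ih =>
    rw [Finset.prod_insert ha, Finset.prod_insert ha, Finset.sum_insert ha]
    have h1 := ih (fun i hi => hf i (Finset.mem_insert_of_mem hi))
      (fun i hi => hg i (Finset.mem_insert_of_mem hi))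
    have h2 : ‖∏ i ∈ s, f i‖ ≤ 1 := by
      rw [norm_prod]
      exact Finset.prod_le_one (fun _ _ => norm_nonneg _)
        fun i hi => hf i (Finset.mem_insert_of_mem hi)
    have h3 := hg a (Finset.mem_insert_self _ _)
    have e : f a * ∏ i ∈ s, f i - g a * ∏ i ∈ s, g i =
        (f a - g a) * ∏ i ∈ s, f i + g a * (∏ i ∈ s, f i - ∏ i ∈ s, g i) := by ring
    rw [e]
    refine (norm_add_le _ _).trans ?_
    rw [norm_mul, norm_mul]
    exact add_le_add (mul_le_of_le_one_right (norm_nonneg _) h2)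
      ((mul_le_of_le_one_left (norm_nonneg _) h3).trans h1)

/-- A standardized characteristic function is close to the Gaussian one near the origin. -/
theorem exists_norm_charFun_sub_exp_le {Ω : Type*} [MeasurableSpace Ω] {P : Measure Ω}
    [IsProbabilityMeasure P] {X : Ω → ℝ} (hX : AEMeasurable X P) (h0 : P[X] = 0)
    (h1 : P[X ^ 2] = 1) {η : ℝ} (hη : 0 < η) :
    ∃ C, 0 ≤ C ∧ ∀ s : ℝ, ‖charFun (P.map X) s - (Real.exp (-s ^ 2 / 2) : ℂ)‖ ≤
      η * s ^ 2 + C * |s| ^ 3 := by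
  have := Measure.isProbabilityMeasure_map hX
  have h2 := (taylor_charFun_two hX h0 h1).def (half_pos hη)
  obtain ⟨δ, hδ, hδ2⟩ := Metric.eventually_nhds_iff.1 h2
  -- Within r, the Taylor error is at most (η/2)s² and the Gaussian remainder s⁴/4 is as well.
  -- Beyond r, the trivial bound 2 is at most 2(|s|/r)³, so no third moment of `X` is needed.
  set r := min δ (min 1 η) with hr
  have hr0 : 0 < r := lt_min hδ (lt_min one_pos hη)
  have hrδ : r ≤ δ := min_le_left _ _
  have hr1 : r ≤ 1 := (min_le_right _ _).trans (min_le_left _ _)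
  have hrη : r ≤ η := (min_le_right _ _).trans (min_le_right _ _)
  refine ⟨2 / r ^ 3, by positivity, fun s => ?_⟩
  have hs0 := abs_nonneg s
  by_cases hs : |s| < r
  · have e1 := hδ2 (y := s) (by rw [Real.dist_eq, sub_zero]; linarith)
    rw [Real.norm_of_nonneg (sq_nonneg s)] at e1
    have hs2 : s ^ 2 = |s| ^ 2 := (sq_abs s).symm
    have hs3 : s ^ 2 ≤ η := by rw [hs2]; nlinarith
    have hs4 : s ^ 2 ≤ 1 := by rw [hs2]; nlinarith
    have e2 := Real.abs_exp_sub_one_sub_id_le (x := -s ^ 2 / 2)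
      (by rw [neg_div, abs_neg, abs_of_nonneg (by positivity)]; linarith)
    have e3 : ‖(1 - (s : ℂ) ^ 2 / 2) - (Real.exp (-s ^ 2 / 2) : ℂ)‖ ≤ (-s ^ 2 / 2) ^ 2 := by
      have : (1 - (s : ℂ) ^ 2 / 2) - (Real.exp (-s ^ 2 / 2) : ℂ) =
          ((-(Real.exp (-s ^ 2 / 2) - 1 - -s ^ 2 / 2) : ℝ) : ℂ) := by push_cast; ring
      rw [this, Complex.norm_real, Real.norm_eq_abs, abs_neg]
      exact e2
    have e4 := norm_sub_le_norm_sub_add_norm_sub (charFun (P.map X) s) (1 - (s : ℂ) ^ 2 / 2)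
      (Real.exp (-s ^ 2 / 2) : ℂ)
    have e5 : (-s ^ 2 / 2) ^ 2 ≤ η / 2 * s ^ 2 := by nlinarith [sq_nonneg s]
    have e6 : 0 ≤ 2 / r ^ 3 * |s| ^ 3 := by positivity
    linarith
  · have e1 : ‖charFun (P.map X) s - (Real.exp (-s ^ 2 / 2) : ℂ)‖ ≤ 2 := by
      refine (norm_sub_le _ _).trans ?_
      have e2 := norm_charFun_le_one (μ := P.map X) s
      have e3 : ‖(Real.exp (-s ^ 2 / 2) : ℂ)‖ ≤ 1 := by
        rw [Complex.norm_real, Real.norm_eq_abs, Real.abs_exp, Real.exp_le_one_iff]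
        nlinarith [sq_nonneg s]
      linarith
    have e2 : 2 ≤ 2 / r ^ 3 * |s| ^ 3 := by
      rw [div_mul_eq_mul_div, le_div_iff₀ (by positivity)]
      have := pow_le_pow_left₀ hr0.le (not_lt.1 hs) 3
      linarith
    have e3 : 0 ≤ η * s ^ 2 := by positivity
    linarith

theorem abs_exp_neg_sub_exp_neg_le {x y : ℝ} (hx : 0 ≤ x) (hy : 0 ≤ y) :
    |Real.exp (-x) - Real.exp (-y)| ≤ |x - y| := by
  wlog hxy : x ≤ y generalizing x y
  · rw [abs_sub_comm, abs_sub_comm x]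
    exact this hy hx (le_of_not_ge hxy)
  have h1 : Real.exp (-y) ≤ Real.exp (-x) := Real.exp_le_exp.2 (by linarith)
  have h2 := Real.add_one_le_exp (x - y)
  have h3 : Real.exp (-y) = Real.exp (-x) * Real.exp (x - y) := by rw [← Real.exp_add]; ring_nf
  have h4 : Real.exp (-x) ≤ 1 := Real.exp_le_one_iff.2 (by linarith)
  rw [abs_of_nonneg (by linarith), abs_sub_comm, abs_of_nonneg (by linarith), h3]
  nlinarith [Real.exp_pos (-x)]

/-- Integrates the elementary bound |z| ≤ ε/2 + (2/ε)z². -/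
theorem tendsto_integral_abs_of_sq {Ω : Type*} [MeasurableSpace Ω] {P : Measure Ω}
    [IsProbabilityMeasure P] {Z : ℕ → Ω → ℝ} (hi : ∀ n, Integrable (fun ω => Z n ω ^ 2) P)
    (hZ : Tendsto (fun n => ∫ ω, Z n ω ^ 2 ∂P) atTop (𝓝 0)) :
    Tendsto (fun n => ∫ ω, |Z n ω| ∂P) atTop (𝓝 0) := by
  rw [Metric.tendsto_atTop]
  intro ε hε
  have h1 : Tendsto (fun n => ε / 2 + 2 / ε * ∫ ω, Z n ω ^ 2 ∂P) atTop (𝓝 (ε / 2)) := by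
    simpa using (hZ.const_mul (2 / ε)).const_add (ε / 2)
  obtain ⟨N, hN⟩ := eventually_atTop.1 (h1.eventually (gt_mem_nhds (half_lt_self hε)))
  refine ⟨N, fun n hn => ?_⟩
  rw [Real.dist_eq, sub_zero, abs_of_nonneg (integral_nonneg fun ω => abs_nonneg _)]
  refine lt_of_le_of_lt ?_ (hN n hn)
  have h2 := integral_mono_of_nonneg (μ := P) (f := fun ω => |Z n ω|)
    (g := fun ω => ε / 2 + 2 / ε * Z n ω ^ 2)
    (Eventually.of_forall fun ω => abs_nonneg _) ((integrable_const _).add ((hi n).const_mul _))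
    (Eventually.of_forall fun ω => ?_)
  · rw [integral_add (integrable_const _) ((hi n).const_mul _), integral_const_mul] at h2
    simpa using h2
  · have e : ε / 2 + 2 / ε * Z n ω ^ 2 - |Z n ω| =
        2 / ε * ((|Z n ω| - ε / 4) ^ 2 + 3 * ε ^ 2 / 16) := by
      rw [← sq_abs (Z n ω)]; field_simp; ring
    have : 0 ≤ 2 / ε * ((|Z n ω| - ε / 4) ^ 2 + 3 * ε ^ 2 / 16) := by positivity
    simp only
    linarith

/-- Products of characteristic functions at random arguments that are asymptotically negligible,
with concentrating sum of squares, converge to a Gaussian characteristic function. -/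
theorem tendsto_integral_prod {Ω : Type*} [MeasurableSpace Ω] {P : Measure Ω}
    [IsProbabilityMeasure P] {φ : ℝ → ℂ} (hφc : Continuous φ) (hφ1 : ∀ s, ‖φ s‖ ≤ 1)
    (hφ : ∀ η > 0, ∃ C, 0 ≤ C ∧ ∀ s : ℝ, ‖φ s - (Real.exp (-s ^ 2 / 2) : ℂ)‖ ≤
      η * s ^ 2 + C * |s| ^ 3)
    {s : ℕ → ℕ → Ω → ℝ} (hsm : ∀ n j, Measurable (s n j)) {w : ℝ} (hw : 0 ≤ w)
    (hi2 : ∀ n, Integrable (fun ω => (∑ j ∈ Finset.Icc 1 n, s n j ω ^ 2 - w) ^ 2) P)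
    (hi3 : ∀ n, Integrable (fun ω => ∑ j ∈ Finset.Icc 1 n, |s n j ω| ^ 3) P)
    (h2 : Tendsto (fun n => ∫ ω, (∑ j ∈ Finset.Icc 1 n, s n j ω ^ 2 - w) ^ 2 ∂P) atTop (𝓝 0))
    (h3 : Tendsto (fun n => ∫ ω, ∑ j ∈ Finset.Icc 1 n, |s n j ω| ^ 3 ∂P) atTop (𝓝 0)) :
    Tendsto (fun n => ∫ ω, ∏ j ∈ Finset.Icc 1 n, φ (s n j ω) ∂P) atTop
      (𝓝 (Real.exp (-w / 2) : ℂ)) := by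
  set U : ℕ → Ω → ℝ := fun n ω => ∑ j ∈ Finset.Icc 1 n, s n j ω ^ 2 with hU
  have hUm : ∀ n, Measurable (U n) := fun n =>
    Finset.measurable_fun_sum _ fun j _ => (hsm n j).pow_const 2
  have h1 := tendsto_integral_abs_of_sq (Z := fun n ω => U n ω - w) hi2 h2
  have hi1 : ∀ n, Integrable (fun ω => |U n ω - w|) P := fun n => by
    have : MemLp (fun ω => U n ω - w) 2 P :=
      (memLp_two_iff_integrable_sq ((hUm n).sub_const w).aestronglyMeasurable).2 (hi2 n)
    exact (this.integrable one_le_two).abs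
  have hprodm : ∀ n, Measurable fun ω => ∏ j ∈ Finset.Icc 1 n, φ (s n j ω) := fun n =>
    Finset.measurable_fun_prod _ fun j _ => hφc.measurable.comp (hsm n j)
  have hprodi : ∀ n, Integrable (fun ω => ∏ j ∈ Finset.Icc 1 n, φ (s n j ω)) P := fun n =>
    Integrable.of_bound (hprodm n).aestronglyMeasurable 1 (Eventually.of_forall fun ω => by
      rw [norm_prod]
      exact Finset.prod_le_one (fun _ _ => norm_nonneg _) fun j _ => hφ1 _)
  -- Replacing every factor by its Gaussian counterpart costs ηU + C∑|s|³. The Gaussian product is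
  -- exp(-U/2), at distance at most |U - w| from exp(-w/2), and U ≤ w + |U - w|.
  have hpt : ∀ η C : ℝ, (∀ x : ℝ, ‖φ x - (Real.exp (-x ^ 2 / 2) : ℂ)‖ ≤ η * x ^ 2 + C * |x| ^ 3) →
      ∀ n ω, 0 < η → ‖∏ j ∈ Finset.Icc 1 n, φ (s n j ω) - (Real.exp (-w / 2) : ℂ)‖ ≤
        η * w + (η + 1) * |U n ω - w| + C * ∑ j ∈ Finset.Icc 1 n, |s n j ω| ^ 3 := by
    intro η C hC n ω hη
    have e1 := norm_prod_sub_prod_le (Finset.Icc 1 n) (f := fun j => φ (s n j ω))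
      (g := fun j => (Real.exp (-s n j ω ^ 2 / 2) : ℂ)) (fun _ _ => hφ1 _) fun j _ => by
        rw [Complex.norm_real, Real.norm_eq_abs, Real.abs_exp, Real.exp_le_one_iff]
        nlinarith [sq_nonneg (s n j ω)]
    have e2 := Finset.sum_le_sum fun j (_ : j ∈ Finset.Icc 1 n) => hC (s n j ω)
    rw [Finset.sum_add_distrib, ← Finset.mul_sum, ← Finset.mul_sum] at e2
    have e3 : ∏ j ∈ Finset.Icc 1 n, (Real.exp (-s n j ω ^ 2 / 2) : ℂ) =
        (Real.exp (-(U n ω / 2)) : ℂ) := by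
      rw [← Complex.ofReal_prod, ← Real.exp_sum]
      congr 2
      rw [hU]
      simp only [Finset.sum_div, ← Finset.sum_neg_distrib]
      exact Finset.sum_congr rfl fun j _ => by ring
    have hU0 : 0 ≤ U n ω := Finset.sum_nonneg fun j _ => sq_nonneg _
    have e4 : ‖(Real.exp (-(U n ω / 2)) : ℂ) - (Real.exp (-w / 2) : ℂ)‖ ≤ |U n ω - w| := by
      rw [← Complex.ofReal_sub, Complex.norm_real, Real.norm_eq_abs, neg_div]
      refine (abs_exp_neg_sub_exp_neg_le (by positivity) (by positivity)).trans ?_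
      rw [← sub_div, abs_div, abs_two]
      linarith [abs_nonneg (U n ω - w)]
    have e5 := norm_sub_le_norm_sub_add_norm_sub (∏ j ∈ Finset.Icc 1 n, φ (s n j ω))
      (Real.exp (-(U n ω / 2)) : ℂ) (Real.exp (-w / 2) : ℂ)
    rw [← e3] at e5
    rw [← e3] at e4
    have e6 : η * U n ω ≤ η * w + η * |U n ω - w| := by
      rw [← mul_add]
      exact mul_le_mul_of_nonneg_left (by linarith [le_abs_self (U n ω - w)]) hη.le
    linarith
  rw [Metric.tendsto_atTop]
  intro ε hε
  set η := ε / (2 * (w + 1)) with hη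
  have hη0 : 0 < η := by positivity
  obtain ⟨C, hC0, hC⟩ := hφ η hη0
  have hlim : Tendsto (fun n => (η + 1) * ∫ ω, |U n ω - w| ∂P +
      C * ∫ ω, ∑ j ∈ Finset.Icc 1 n, |s n j ω| ^ 3 ∂P) atTop (𝓝 0) := by
    simpa using (h1.const_mul (η + 1)).add (h3.const_mul C)
  obtain ⟨N, hN⟩ := eventually_atTop.1 (hlim.eventually (gt_mem_nhds (half_pos hε)))
  refine ⟨N, fun n hn => ?_⟩
  rw [dist_eq_norm]
  have e1 : ∫ ω, ∏ j ∈ Finset.Icc 1 n, φ (s n j ω) ∂P - (Real.exp (-w / 2) : ℂ) =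
      ∫ ω, (∏ j ∈ Finset.Icc 1 n, φ (s n j ω) - (Real.exp (-w / 2) : ℂ)) ∂P := by
    rw [integral_sub (hprodi n) (integrable_const _)]
    simp
  rw [e1]
  have i1 : Integrable (fun ω => η * w + (η + 1) * |U n ω - w|) P :=
    (integrable_const _).add ((hi1 n).const_mul _)
  have e2 := norm_integral_le_of_norm_le (i1.add ((hi3 n).const_mul C))
    (Eventually.of_forall fun ω => hpt η C hC n ω hη0)
  simp only [Pi.add_apply] at e2
  rw [integral_add i1 ((hi3 n).const_mul C), integral_add (integrable_const _)
    ((hi1 n).const_mul _), integral_const_mul, integral_const_mul,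
    integral_const_mul] at e2
  simp only [integral_const, probReal_univ, one_smul] at e2
  have e3 : η * w ≤ ε / 2 := by
    have : η * (w + 1) = ε / 2 := by rw [hη]; field_simp
    nlinarith
  have := hN n hn
  linarith

/-- The characteristic function of a sum of independent variables with independent random
weights. -/
theorem integral_exp_sum_mul {Ω ι : Type*} [Fintype ι] [MeasurableSpace Ω] {P : Measure Ω}
    [IsProbabilityMeasure P] {ξ V : ι → Ω → ℝ} (hξm : ∀ i, Measurable (ξ i))
    (hVm : ∀ i, Measurable (V i)) (hξ : iIndepFun ξ P)
    (hind : IndepFun (fun ω i => ξ i ω) (fun ω i => V i ω) P) {ν : Measure ℝ}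
    (hν : ∀ i, P.map (ξ i) = ν) :
    ∫ ω, Complex.exp (((∑ i, V i ω * ξ i ω : ℝ) : ℂ) * Complex.I) ∂P =
      ∫ ω, ∏ i, charFun ν (V i ω) ∂P := by
  set F : (ι → ℝ) × (ι → ℝ) → ℂ := fun q =>
    Complex.exp (((∑ i, q.2 i * q.1 i : ℝ) : ℂ) * Complex.I) with hF
  have hFc : Continuous F := by
    simp only [hF]; fun_prop
  have hFn : ∀ q, ‖F q‖ ≤ 1 := fun q => (Complex.norm_exp_ofReal_mul_I _).le
  have hΞ : Measurable (fun ω i => ξ i ω) := measurable_pi_lambda _ hξm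
  have hV : Measurable (fun ω i => V i ω) := measurable_pi_lambda _ hVm
  have := Measure.isProbabilityMeasure_map (μ := P) hΞ.aemeasurable
  have := Measure.isProbabilityMeasure_map (μ := P) hV.aemeasurable
  have h1 : ∫ ω, Complex.exp (((∑ i, V i ω * ξ i ω : ℝ) : ℂ) * Complex.I) ∂P =
      ∫ q, F q ∂(P.map fun ω => ((fun i => ξ i ω), fun i => V i ω)) := by
    rw [integral_map (hΞ.prodMk hV).aemeasurable hFc.aestronglyMeasurable]
  rw [h1, (indepFun_iff_map_prod_eq_prod_map_map hΞ.aemeasurable hV.aemeasurable).1 hind,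
    integral_prod_symm F (Integrable.of_bound hFc.aestronglyMeasurable 1
      (Eventually.of_forall hFn))]
  -- By Fubini the weights may be frozen; independence of the `ξ i` then factorizes the inner
  -- integral.
  have h2 : ∀ v : ι → ℝ, ∫ x, F (x, v) ∂(P.map fun ω i => ξ i ω) = ∏ i, charFun ν (v i) := by
    intro v
    have hFv : Continuous fun x => F (x, v) := hFc.comp (by fun_prop)
    rw [integral_map hΞ.aemeasurable hFv.aestronglyMeasurable]
    have e1 : ∀ ω, F ((fun i => ξ i ω), v) =
        ∏ i, Complex.exp ((v i : ℂ) * (ξ i ω : ℂ) * Complex.I) := fun ω => by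
      simp only [hF]
      rw [← Complex.exp_sum]
      push_cast
      rw [Finset.sum_mul]
    simp only [e1]
    have hc : ∀ i, Continuous fun x : ℝ => Complex.exp ((v i : ℂ) * (x : ℂ) * Complex.I) :=
      fun i => by fun_prop
    have h3 := (hξ.comp (fun i (x : ℝ) => Complex.exp ((v i : ℂ) * (x : ℂ) * Complex.I))
      fun i => (hc i).measurable).integral_fun_prod_eq_prod_integral
      fun i => ((hc i).measurable.comp (hξm i)).aestronglyMeasurable
    simp only [Function.comp_def] at h3
    rw [h3]
    refine Finset.prod_congr rfl fun i _ => ?_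
    rw [← hν i, charFun_apply_real,
      integral_map (hξm i).aemeasurable (hc i).aestronglyMeasurable]
  simp only [h2]
  -- For empty `ι` nothing makes `ν` finite, so continuity of `charFun ν` is not at hand; both sides
  -- are then the integral of 1.
  by_cases hι : Nonempty ι
  · obtain ⟨i⟩ := hι
    have : IsProbabilityMeasure ν := by
      rw [← hν i]; exact Measure.isProbabilityMeasure_map (hξm i).aemeasurable
    rw [integral_map hV.aemeasurable]
    have : Continuous fun v : ι → ℝ => ∏ i, charFun ν (v i) :=
      continuous_finsetProd _ fun i _ => continuous_charFun.comp (continuous_apply i)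
    exact this.aestronglyMeasurable
  · have := not_nonempty_iff.1 hι
    simp

/-- A rational identity between v² and 2pB + 1. The value at p̂ is no exception: it is the general
formula evaluated there, where 1 - p = 1/(γ + 1). -/
theorem limitVariance_eq {γ p : ℝ} (hγ : -(1 / 2) < γ) (hp : p < pCrit γ) :
    limitVariance γ p = 2 * p * ((p * ((γ + 1) ^ 2 / (2 * (γ + 1) - 1 - 2 * p * (γ + 1))) +
      (γ + 1)) / ((γ + 1) - p * (γ + 1))) + 1 := by
  have hκ : 0 < γ + 1 := by linarith
  rw [pCrit, lt_div_iff₀ hκ] at hp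
  have hD : 2 * (γ + 1) - 1 - 2 * p * (γ + 1) ≠ 0 := by
    have : 0 < 2 * (γ + 1) - 1 - 2 * p * (γ + 1) := by linarith
    exact this.ne'
  have hp1 : 0 < 1 - p := by nlinarith
  have hE : (γ + 1) - p * (γ + 1) ≠ 0 := by
    have : 0 < (1 - p) * (γ + 1) := mul_pos hp1 hκ
    nlinarith
  have hgen : (2 * γ + 1 - p) / ((1 - p) * (2 * (1 - p) * (γ + 1) - 1)) =
      2 * p * ((p * ((γ + 1) ^ 2 / (2 * (γ + 1) - 1 - 2 * p * (γ + 1))) +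
      (γ + 1)) / ((γ + 1) - p * (γ + 1))) + 1 := by
    have e1 : 2 * (1 - p) * (γ + 1) - 1 = 2 * (γ + 1) - 1 - 2 * p * (γ + 1) := by ring
    have e2 : (γ + 1) - p * (γ + 1) = (1 - p) * (γ + 1) := by ring
    rw [e1, e2]
    have := hp1.ne'
    have := hκ.ne'
    field_simp
    ring
  rw [limitVariance]
  split_ifs with h
  · rw [← hgen, h, pHat]
    have e1 : 1 - γ / (γ + 1) = 1 / (γ + 1) := by field_simp; ring
    rw [e1]
    field_simp
    ring
  · exact hgen

theorem sum_Icc_one_eq_sum_fin {M : Type*} [AddCommMonoid M] (n : ℕ) (f : ℕ → M) :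
    ∑ j ∈ Finset.Icc 1 n, f j = ∑ i : Fin n, f (i + 1) := by
  rw [Fin.sum_univ_eq_sum_range (fun i => f (i + 1)), Finset.range_eq_Ico,
    Finset.sum_Ico_add' f 0 n 1]
  rfl

theorem prod_Icc_one_eq_prod_fin {M : Type*} [CommMonoid M] (n : ℕ) (f : ℕ → M) :
    ∏ j ∈ Finset.Icc 1 n, f j = ∏ i : Fin n, f (i + 1) := by
  rw [Fin.prod_univ_eq_prod_range (fun i => f (i + 1)), Finset.range_eq_Ico,
    Finset.prod_Ico_add' f 0 n 1]
  rfl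

/-! ### Gaussian limit of the walk -/

namespace IsRWInput

variable {Ω : Type*} [mΩ : MeasurableSpace Ω] {P : Measure Ω} [IsProbabilityMeasure P]
  {p : ℝ} {μ : ℕ → ℝ} {ξ α : ℕ → Ω → ℝ} {β : ℕ → Ω → ℕ}

/-- Off a single null set the forced indicators and indices agree with the given ones at all times,
so both recursions produce the same walk. -/
theorem rwPosition_ae_eq (h : IsRWInput P p μ ξ α β) (hμ : ∀ n, 1 ≤ n → 0 < μ n) (n : ℕ) :
    ∀ᵐ ω ∂P, rwPosition ξ α β n ω = ∑ j ∈ Finset.Icc 1 n, ξ j ω * clusterSize α β j n ω := by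
  have h1 : ∀ᵐ ω ∂P, ∀ k, 2 ≤ k → memInd α k ω = α k ω ∧ memIdx β k ω = β k ω := by
    rw [ae_all_iff]
    intro k
    by_cases hk : 2 ≤ k
    · filter_upwards [h.ae_memInd_eq hk, h.ae_memIdx_eq hμ hk] with ω h1 h2 _
      exact ⟨h1, h2⟩
    · exact Eventually.of_forall fun ω h => absurd h hk
  filter_upwards [h1] with ω hω
  rw [rwPosition, ← sum_rwStep_eq_sum_clusterWeight (α := α) (β := β) (fun j => ξ j ω) n ω]
  refine Finset.sum_congr rfl fun k hk => ?_
  -- The guard in the recursion bounds the memory index from above only, so the induction has to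
  -- include index 0.
  clear hk
  induction k using Nat.strong_induction_on with
  | _ k ih =>
    match k, ih with
    | 0, _ => rw [rwStep, rwStep]
    | 1, _ => rw [rwStep_one, rwStep_one]
    | k + 2, ih =>
      have h2 := hω (k + 2) (by omega)
      conv_lhs => rw [rwStep]
      conv_rhs => rw [rwStep]
      rw [h2.1]
      simp only [h2.2]
      congr 2
      split_ifs with hb
      · exact ih _ hb
      · rfl

theorem measurable_clusterSize (h : IsRWInput P p μ ξ α β) (j n : ℕ) :
    Measurable (clusterSize α β j n) :=
  (clusterWeight_mem_boundedMeasurable ξ _ j n).1.mono (h.inputSigma_le _) le_rfl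

theorem aemeasurable_rwPosition (h : IsRWInput P p μ ξ α β) (hμ : ∀ n, 1 ≤ n → 0 < μ n) (n : ℕ) :
    AEMeasurable (rwPosition ξ α β n) P := by
  refine AEMeasurable.congr ?_ ((h.rwPosition_ae_eq hμ n).mono fun ω hω => hω.symm)
  exact (Finset.measurable_fun_sum _ fun j hj => (h.measurable_ξ j (Finset.mem_Icc.1 hj).1).mul
    (h.measurable_clusterSize j n)).aemeasurable

/-- Conditioning on the clusters, the characteristic function of the position is the mean of a
product. -/
theorem charFun_rwPosition (h : IsRWInput P p μ ξ α β) (hμ : ∀ n, 1 ≤ n → 0 < μ n) (n : ℕ) (t : ℝ) :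
    charFun (P.map fun ω => rwPosition ξ α β n ω / √(n : ℝ)) t =
      ∫ ω, ∏ j ∈ Finset.Icc 1 n, charFun (P.map (ξ 1)) (t / √n * clusterSize α β j n ω) ∂P := by
  have hind : IndepFun (fun ω (i : Fin n) => ξ (i + 1) ω)
      (fun ω (i : Fin n) => t / √n * clusterSize α β (i + 1) n ω) P := by
    have hd : Disjoint (Set.range (Sum.inl : ℕ → ℕ ⊕ (ℕ ⊕ ℕ))) (pastLabels n) := by
      rw [Set.disjoint_left]
      rintro _ ⟨k, rfl⟩ ⟨l, _, hl⟩
      simp at hl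
    refine h.indepFun_of_disjoint hd ?_ ?_
    · exact @measurable_pi_lambda Ω (Fin n) (fun _ => ℝ) (inputSigma ξ α β _) _ _ fun i =>
        measurable_inputs_inputSigma (i := Sum.inl (i : ℕ)) (Set.mem_range_self _)
    · exact @measurable_pi_lambda Ω (Fin n) (fun _ => ℝ) (inputSigma ξ α β _) _ _ fun i =>
        (clusterWeight_mem_boundedMeasurable ξ _ _ n).1.const_mul _
  have hiξ : iIndepFun (fun (i : Fin n) => ξ (i + 1)) P :=
    h.indep.precomp (g := fun i : Fin n => Sum.inl (i : ℕ)) fun i j hij =>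
      Fin.ext (Sum.inl_injective hij)
  have key := integral_exp_sum_mul (P := P) (ξ := fun i : Fin n => ξ (i + 1))
    (V := fun (i : Fin n) ω => t / √n * clusterSize α β (i + 1) n ω)
    (fun i => h.measurable_ξ _ (by omega)) (fun i => (h.measurable_clusterSize _ n).const_mul _)
    hiξ hind (fun i => (h.identDistrib_ξ _ (by omega)).map_eq)
  simp only [prod_Icc_one_eq_prod_fin]
  rw [← key, charFun_apply_real, integral_map ((h.aemeasurable_rwPosition hμ n).div_const _)
    (by fun_prop)]
  refine integral_congr_ae ?_
  filter_upwards [h.rwPosition_ae_eq hμ n] with ω hω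
  rw [hω, sum_Icc_one_eq_sum_fin, ← Complex.ofReal_mul]
  congr 3
  rw [Finset.sum_div, Finset.mul_sum]
  exact Finset.sum_congr rfl fun i _ => by ring

/-- With arguments tN_j/√n the sum of squares is t²∑N_j²/n, which concentrates at t²v, and the sum
of cubes is at most |t|³∑V_j³/n^{3/2} because N_j ≤ V_j. -/
theorem tendsto_charFun_rwPosition (h : IsRWInput P p μ ξ α β) (hμ : ∀ n, 1 ≤ n → 0 < μ n)
    (hξ : ∫ ω, ξ 1 ω ^ 2 ∂P = 1) {v : ℝ} (hv : 0 ≤ v)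
    (hi : ∀ n : ℕ, Integrable
      (fun ω => (clusterSum μ α β (fun x _ => x ^ 2) n ω / n - v) ^ 2) P)
    (h2 : Tendsto (fun n : ℕ => ∫ ω, (clusterSum μ α β (fun x _ => x ^ 2) n ω / n - v) ^ 2 ∂P)
      atTop (𝓝 0))
    (h3 : Tendsto (fun n : ℕ => (∫ ω, ∑ j ∈ Finset.Icc 1 n,
      clusterMass μ α β (n / totalWeight μ n) j n ω ^ 3 ∂P) / (n * √n)) atTop (𝓝 0)) (t : ℝ) :
    Tendsto (fun n : ℕ => charFun (P.map fun ω => rwPosition ξ α β n ω / √(n : ℝ)) t) atTop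
      (𝓝 (Real.exp (-(t ^ 2 * v) / 2) : ℂ)) := by
  simp only [h.charFun_rwPosition hμ]
  have hm := h.measurable_ξ 1 le_rfl
  have := Measure.isProbabilityMeasure_map (μ := P) hm.aemeasurable
  have hsq : ∀ (n : ℕ) ω, ∑ j ∈ Finset.Icc 1 n, (t / √(n : ℝ) * clusterSize α β j n ω) ^ 2 - t ^ 2 * v =
      t ^ 2 * (clusterSum μ α β (fun x _ => x ^ 2) n ω / n - v) := fun n ω => by
    simp only [mul_pow, div_pow, Real.sq_sqrt (Nat.cast_nonneg n), clusterSum]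
    rw [← Finset.mul_sum]
    ring
  have hcm : ∀ n : ℕ, Integrable (fun ω => ∑ j ∈ Finset.Icc 1 n,
      |t / √(n : ℝ) * clusterSize α β j n ω| ^ 3) P := fun n => by
    -- With weight factor 0 the mass is the size, so integrability of the mass power sums applies.
    have : ∀ ω, ∑ j ∈ Finset.Icc 1 n, |t / √(n : ℝ) * clusterSize α β j n ω| ^ 3 =
        |t / √(n : ℝ)| ^ 3 * ∑ j ∈ Finset.Icc 1 n, clusterMass μ α β 0 j n ω ^ 3 := fun ω => by
      rw [Finset.mul_sum]
      refine Finset.sum_congr rfl fun j _ => ?_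
      have h0 : 0 ≤ clusterSize α β j n ω := clusterWeight_nonneg (fun _ _ => zero_le_one) j n ω
      rw [abs_mul, mul_pow, abs_of_nonneg h0, clusterMass, zero_mul, add_zero]
    simp only [this]
    exact (h.integrable_of_past (sum_pow_clusterMass_mem ξ μ 0 n 3)).const_mul _
  refine tendsto_integral_prod (φ := charFun (P.map (ξ 1))) continuous_charFun
    (fun s => norm_charFun_le_one s) (fun η hη => exists_norm_charFun_sub_exp_le hm.aemeasurable
      h.mean_ξ hξ hη) (s := fun n j ω => t / √(n : ℝ) * clusterSize α β j n ω)
    (fun n j => (h.measurable_clusterSize j n).const_mul _) (by positivity) ?_ hcm ?_ ?_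
  · intro n
    simp only [hsq]
    simp only [mul_pow]
    exact (hi n).const_mul _
  · simp only [hsq]
    simp only [mul_pow, integral_const_mul]
    simpa using h2.const_mul ((t ^ 2) ^ 2)
  · have hlim : Tendsto (fun n : ℕ => |t| ^ 3 * ((∫ ω, ∑ j ∈ Finset.Icc 1 n,
        clusterMass μ α β (n / totalWeight μ n) j n ω ^ 3 ∂P) / (n * √n))) atTop (𝓝 0) := by
      simpa using h3.const_mul (|t| ^ 3)
    refine squeeze_zero' (Eventually.of_forall fun n => integral_nonneg fun ω =>
      Finset.sum_nonneg fun j _ => by positivity) ?_ hlim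
    filter_upwards [eventually_ge_atTop 1] with n hn
    have hn0 : (0 : ℝ) < n := by positivity
    have hs : √(n : ℝ) ^ 3 = n * √n := by
      rw [pow_succ, Real.sq_sqrt hn0.le]
    rw [← mul_div_assoc, mul_div_right_comm, ← integral_const_mul]
    refine integral_mono (hcm n)
      ((h.integrable_of_past (sum_pow_clusterMass_mem ξ μ _ n 3)).const_mul _) fun ω => ?_
    simp only
    rw [Finset.mul_sum]
    refine Finset.sum_le_sum fun j _ => ?_
    obtain ⟨hN, -, hNV, -⟩ := size_and_weight_le (α := α) (β := β) hμ hn j ω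
    rw [abs_mul, mul_pow, abs_of_nonneg hN, abs_div, div_pow, abs_of_nonneg (Real.sqrt_nonneg _),
      hs]
    gcongr

end IsRWInput

theorem mainTheorem8 {Ω : Type*} [MeasurableSpace Ω] (P : Measure Ω) [IsProbabilityMeasure P]
    (γ p : ℝ) (hγ : -(1 / 2) < γ) (hp0 : 0 ≤ p) (hp : p < pCrit γ)
    (μ : ℕ → ℝ) (hμ : IsRegularlyVarying μ γ)
    (ξ α : ℕ → Ω → ℝ) (β : ℕ → Ω → ℕ) (hinput : IsRWInput P p μ ξ α β)
    (hξ : ∫ ω, ξ 1 ω ^ 2 ∂P = 1) :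
    ∃ v2 : NNReal, (v2 : ℝ) = limitVariance γ p ∧
      TendstoInDistribution (fun (n : ℕ) (ω : Ω) => rwPosition ξ α β n ω / √(n : ℝ)) atTop
        id (fun _ => P) (gaussianReal 0 v2) := by
  have hκ0 : 0 < γ + 1 := by linarith
  have hκ := hμ.tendsto_mul_succ_div_sum (by linarith)
  -- The subcritical condition p < p_c, written with κ = γ + 1.
  have hp' : p * (γ + 1) < (γ + 1) - 1 / 2 := by
    rw [pCrit, lt_div_iff₀ hκ0] at hp
    linarith
  have hp1 : p ≤ 1 := by nlinarith
  have hv : 0 ≤ limitVariance γ p := by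
    rw [limitVariance_eq hγ hp]
    have h1 : 0 < 2 * (γ + 1) - 1 - 2 * p * (γ + 1) := by linarith
    have h2 : 0 < (γ + 1) - p * (γ + 1) := by linarith
    positivity
  have h2 := hinput.tendsto_sum_size_sq hμ.1 hκ hp0 hp1 hp'
  rw [← limitVariance_eq hγ hp] at h2
  have h3 := hinput.tendsto_third_moment_clusterMass hμ.1 hκ hp0 hp1 hp'
  obtain ⟨v2, hv2⟩ : ∃ v2 : NNReal, (v2 : ℝ) = limitVariance γ p := ⟨⟨_, hv⟩, rfl⟩
  refine ⟨v2, hv2,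
    fun n => (hinput.aemeasurable_rwPosition hμ.1 n).div_const _, aemeasurable_id, ?_⟩
  -- Lévy's continuity theorem.
  refine ProbabilityMeasure.tendsto_iff_tendsto_charFun.2 fun t => ?_
  have key := hinput.tendsto_charFun_rwPosition hμ.1 hξ hv
    (fun n => (hinput.integrable_clusterSum_sub_sq (Φ := fun x _ => x ^ 2)
      (fun hf _ => Subalgebra.pow_mem _ hf 2) n _ _).2) h2 h3 t
  have e : (Real.exp (-(t ^ 2 * limitVariance γ p) / 2) : ℂ) =
      charFun ((gaussianReal 0 v2).map id) t := by
    rw [Measure.map_id, charFun_gaussianReal, ← hv2]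
    push_cast
    congr 1
    ring
  rw [e] at key
  exact key
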